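/- Let $N\ge 0$, $A=(A^\alpha)\in\mathbb C^N$, and let $\overline F=(F^1,\dots,F^N)$, $F^\alpha\in\mathbb C[[t^1,\dots,t^N]]$, be a vector potential of a flat F-manifold with unit $A^\alpha\partial_{t^\alpha}$: with $c^\alpha_{\beta\gamma}=\partial_{t^\beta}\partial_{t^\gamma}F^\alpha$ (sums over repeated Greek indices), $A^\mu c^\alpha_{\mu\beta}=\delta^\alpha_\beta$ and $c^\alpha_{\beta\mu}c^\mu_{\gamma\delta}=c^\alpha_{\gamma\mu}c^\mu_{\beta\delta}$. Suppose that it is semisimple at the origin: the algebra on $\mathbb C^N$ with structure constants $c^\alpha_{\beta\gamma}(0)$ has a basis $\pi_1,\dots,\pi_N$ with $\pi_k\circ\pi_l=\delta_{kl}\pi_k$. Its constant part is the flat F-manifold with the same unit and vector potential $\frac12c^\alpha_{\beta\gamma}(0)t^\beta t^\gamma$. *Ancestor cones.* A calibration is a sequence of matrices $\Omega^d_0=(\Omega^{\alpha,d}_{\beta,0})$, $d\ge-1$, over $\mathbb C[[t^*]]$ with $\Omega^{-1}_0=\mathrm{Id}$ and $\partial_{t^\gamma}\Omega^{\alpha,d}_{\beta,0}=c^\mu_{\gamma\beta}\Omega^{\alpha,d-1}_{\mu,0}$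 for $d\ge0$. Let $\sum_{k\ge0}(-1)^k\Omega^0_{k-1}z^k$ be the inverse of $\sum_{k\ge0}\Omega^{k-1}_0z^k$, and put $\Omega^p_q=\sum_{i=0}^q(-1)^{q-i}\Omega^{p+q-i}_0\Omega^0_{i-1}$ for $p,q\ge0$. If $A^\beta\Omega^{\alpha,0}_{\beta,0}$ has no constant term, let $v=(v^\alpha)$, $v^\alpha\in\mathbb C[[t^\beta_b\,;\,1\le\beta\le N,\,b\ge0]]$, be the solution of $$\frac{\partial v^\alpha}{\partial t^\beta_d}=A^\mu\frac{\partial}{\partial t^\mu_0}\bigl(\Omega^{\alpha,0}_{\beta,d}(v)\bigr),\qquad v^\alpha|_{t^*_{\ge1}=0}=t^\alpha_0 .$$ The functions $\mathcal F^{\alpha,a}=\sum_{b\ge0}\Omega^{\alpha,a}_{\beta,b}(v)\,q^\beta_b$, $a\ge0$, with $q^\beta_b=t^\beta_b-A^\beta\delta_{b,1}$, are the ancestor vector potentials if moreover $\partial\mathcal F^{\alpha,a}/\partial t^\beta_b|_{t^*_*=0}=0$ for all $\alpha,\beta$ and $a,b\ge0$. The ancestor cone is the graph $\{p^\alpha_a=\mathcal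 F^{\alpha,a}(q)\}$ in the space $\mathbb C^N[[z,z^{-1}]]$ of series $\sum_{a\ge0}(-1)^{a+1}p^\alpha_a\phi_\alpha z^{-a-1}+\sum_{a\ge0}q^\alpha_a\phi_\alpha z^a$, where $\phi_1,\dots,\phi_N$ is the standard basis of $\mathbb C^N$. It is understood as a formal germ, i.e. through its points with coefficients in rings of formal power series over $\mathbb C$, where $q^\alpha_0$ and $q^\alpha_1+A^\alpha$ have zero constant term and the $q^\alpha_a$, $a\ge2$, are arbitrary. Let $\mathcal C$ and $\mathcal C^{\mathrm{const}}$ be the ancestor cones of the given flat F-manifold and of its constant part. The group $G_+=\{\mathrm{Id}+\sum_{i\ge1}R_iz^i\in\mathrm{End}(\mathbb C^N)[[z]]\}$ acts by left multiplication. *Canonical data.* Consider canonical coordinates $u^i\in\mathbb C[[t^*]]$, that is, $\widetilde\Psi=(\partial u^i/\partial t^\alpha)$ is invertible and $\partial_{u^k}\circ\partial_{u^l}=\delta_{kl}\partial_{u^k}$; $U=\mathrm{diag}(u^1,\dots,u^N)$; the decomposition $d\widetilde\Psi\,\widetilde\Psi^{-1}=\widetilde D+[\widetilde\Gamma,dU]$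 with $\widetilde D$ diagonal and $\widetilde\Gamma$ of zero diagonal; an invertible diagonal matrix $H$ with $dH\,H^{-1}=-\widetilde D$; $\Psi=H\widetilde\Psi$, $\Gamma=H\widetilde\Gamma H^{-1}$; and matrices $R_0=\mathrm{Id},R_1,R_2,\dots$ over $\mathbb C[[t^*]]$ with $dR_{k-1}+R_{k-1}[\Gamma,dU]=[R_k,dU]$, $k\ge1$. Write $R(z,t^*)=\sum_{k\ge0}R_k(t^*)z^k$. **Theorem.** The constant part is again a flat F-manifold with unit $A^\alpha\partial_{t^\alpha}$, ancestor vector potentials exist both for the given flat F-manifold and for its constant part, and canonical data as above exist. There is an element $R(z)\in G_+$ with $\mathcal C=R(z)\,\mathcal C^{\mathrm{const}}$ (multiplication by $R(z)$ being well defined on $\mathcal C^{\mathrm{const}}$). Explicitly, for every choice of the canonical data, $\Psi^{-1}(0)R^{-1}(-z,0)\Psi(0)\in G_+$ and $$\mathcal C=\Psi^{-1}(0)\,R^{-1}(-z,0)\,\Psi(0)\,\mathcal C^{\mathrm{const}} .$$ -/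

import Mathlib

open MvPowerSeries

noncomputable section

namespace FlatF

/-! ### Formal flat F-manifolds -/

/-- Formal power series `ℂ[[t¹, …, tᴺ]]`. -/
abbrev Fun (N : ℕ) : Type := MvPowerSeries (Fin N) ℂ

/-- The ring of formal power series in the variables `t^β_b`, `1 ≤ β ≤ N`, `b ≥ 0`;
the variable `t^β_b` is `X (β, b)`. -/
abbrev BigFun (N : ℕ) : Type := MvPowerSeries (Fin N × ℕ) ℂ

/-- The structure constants `c^α_{βγ} = ∂²F^α / ∂t^β ∂t^γ`. -/
def structureConst {N : ℕ} (F : Fin N → Fun N) (α β γ : Fin N) : Fun N :=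
  pderiv ℂ β (pderiv ℂ γ (F α))

/-- `F = (F¹, …, Fᴺ)` is a vector potential of a flat F-manifold (on the formal neighbourhood of
the origin of `ℂᴺ`) with unit `A^α ∂/∂t^α`. -/
structure IsVectorPotential {N : ℕ} (A : Fin N → ℂ) (F : Fin N → Fun N) : Prop where
  unit : ∀ α β, ∑ μ, A μ • structureConst F α μ β = if α = β then 1 else 0
  assoc : ∀ α β γ δ,
    ∑ μ, structureConst F α β μ * structureConst F μ γ δ =
      ∑ μ, structureConst F α γ μ * structureConst F μ β δ

/-- The structure constants at the origin. -/
def structureConstAtZero {N : ℕ} (F : Fin N → Fun N) (α β γ : Fin N) : ℂ :=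
  constantCoeff (structureConst F α β γ)

/-- The algebra on the tangent space at the origin has a basis of orthogonal idempotents. -/
def IsSemisimpleAtOrigin {N : ℕ} (F : Fin N → Fun N) : Prop :=
  ∃ π : Module.Basis (Fin N) ℂ (Fin N → ℂ), ∀ k l α,
    ∑ β, ∑ γ, structureConstAtZero F α β γ * π k β * π l γ = if k = l then π k α else 0

/-- The vector potential of the constant part: the flat F-manifold (with the same unit) whose
structure constants are the constants `c^α_{βγ}(0)`. -/
def constantPart {N : ℕ} (F : Fin N → Fun N) (α : Fin N) : Fun N :=
  ∑ β, ∑ γ, C (structureConstAtZero F α β γ / 2) * X β * X γ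

/-! ### Calibrations and descendant vector potentials -/

/-- `Om k` stands for the matrix `Ω^{k-1}_0`, `k ≥ 0`; row index `α`, column index `β` for
`Ω^{α,k-1}_{β,0}`. -/
structure IsCalibration {N : ℕ} (F : Fin N → Fun N)
    (Om : ℕ → Matrix (Fin N) (Fin N) (Fun N)) : Prop where
  zero : Om 0 = 1
  deriv : ∀ k α β γ,
    pderiv ℂ γ (Om (k + 1) α β) = ∑ μ, structureConst F μ γ β * Om k α μ

/-- `lowerOm Om k` is the matrix `Ω^0_{k-1}`, determined by
`(∑_k (-1)^k Ω^0_{k-1} z^k) (∑_k Ω^{k-1}_0 z^k) = Id`. -/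
def lowerOm {N : ℕ} (Om : ℕ → Matrix (Fin N) (Fin N) (Fun N)) (k : ℕ) :
    Matrix (Fin N) (Fin N) (Fun N) :=
  (-1) ^ k * PowerSeries.coeff k (PowerSeries.invOfUnit (PowerSeries.mk Om) 1)

/-- `Ω^p_q = ∑_{i=0}^q (-1)^{q-i} Ω^{p+q-i}_0 Ω^0_{i-1}`. -/
def biOm {N : ℕ} (Om : ℕ → Matrix (Fin N) (Fin N) (Fun N)) (p q : ℕ) :
    Matrix (Fin N) (Fin N) (Fun N) :=
  ∑ i ∈ Finset.range (q + 1), (-1) ^ (q - i) * (Om (p + q - i + 1) * lowerOm Om i)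

/-- `v` is the topological solution of the principal hierarchy
`∂v^α/∂t^β_d = ∂_x (Ω^{α,0}_{β,d}(v))`, where `∂_x = A^μ ∂/∂t^μ_0`: the one with
`v^α = t^α_0` at `t^*_{≥1} = 0`. -/
structure IsTopologicalSolution {N : ℕ} (A : Fin N → ℂ)
    (Om : ℕ → Matrix (Fin N) (Fin N) (Fun N)) (v : Fin N → BigFun N) : Prop where
  initial : ∀ (α : Fin N) (m : Fin N × ℕ →₀ ℕ), (∀ i ∈ m.support, i.2 = 0) →
    coeff m (v α) = coeff m (X (α, 0) : BigFun N)
  flow : ∀ (α β : Fin N) (d : ℕ),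
    pderiv ℂ (β, d) (v α) = ∑ μ, A μ • pderiv ℂ (μ, 0) (subst v (biOm Om 0 d α β))

/-- The shifted variable `q^β_b = t^β_b - A^β δ_{b,1}`. -/
def qVar {N : ℕ} (A : Fin N → ℂ) (β : Fin N) (b : ℕ) : BigFun N :=
  X (β, b) - if b = 1 then C (A β) else 0

/-- The descendant vector potentials
`𝓕^{α,a} = ∑_{β,b} Ω^{α,a}_{β,b}(v) q^β_b`, the infinite sum being taken coefficientwise
(every coefficient is a finite sum). -/
def descendantPotential {N : ℕ} (A : Fin N → ℂ)
    (Om : ℕ → Matrix (Fin N) (Fin N) (Fun N)) (v : Fin N → BigFun N) (a : ℕ) (α : Fin N) :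
    BigFun N :=
  fun m => ∑ᶠ i : Fin N × ℕ, coeff m (subst v (biOm Om a i.2 α i.1) * qVar A i.1 i.2)

/-- `𝓕^{α,a} = Fa a α` are the ancestor vector potentials of the flat F-manifold with vector
potential `F` and unit `A`: they are the descendant vector potentials of some calibration, they
are based at the origin (that is `Ω^{α,0}_{β,0} A^β = t^α`, without constant term), and
`∂𝓕^{α,a}/∂t^β_b` vanishes at `t^*_* = 0`. -/
def IsAncestorPotentials {N : ℕ} (A : Fin N → ℂ) (F : Fin N → Fun N)
    (Fa : ℕ → Fin N → BigFun N) : Prop :=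
  ∃ (Om : ℕ → Matrix (Fin N) (Fin N) (Fun N)) (v : Fin N → BigFun N),
    IsCalibration F Om ∧
    (∀ α, constantCoeff (∑ β, A β • Om 1 α β) = 0) ∧
    IsTopologicalSolution A Om v ∧
    (∀ a α, Fa a α = descendantPotential A Om v a α) ∧
    ∀ a α β b, constantCoeff (pderiv ℂ (β, b) (Fa a α)) = 0

/-! ### Cones in the loop space and the action of the upper triangular group -/

/-- `S^N[[z, z⁻¹]]` for a coefficient ring `S`; `f k α` is the coefficient of `φ_α z^k`. -/
abbrev Loop (N : ℕ) (S : Type) : Type := ℤ → Fin N → S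

/-- `g` is the value of the power series `G` at the point `T`, as a coefficientwise finite sum. -/
def EvaluatesTo {σ τ : Type} (G : MvPowerSeries σ ℂ) (T : σ → MvPowerSeries τ ℂ)
    (g : MvPowerSeries τ ℂ) : Prop :=
  ∀ m : τ →₀ ℕ,
    {n : σ →₀ ℕ | coeff n G * coeff m (n.prod fun i k => T i ^ k) ≠ 0}.Finite ∧
    ∑ᶠ n : σ →₀ ℕ, coeff n G * coeff m (n.prod fun i k => T i ^ k) = coeff m g

/-- The graph `p^α_a = 𝓕^{α,a}(q)` in the loop space, as a formal germ. A formal germ is given by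
its points with values in the power series rings `ℂ[[τ]]`, for all sets of variables `τ`
(among these points is the generic one, where the `t^β_b` are the variables themselves). A
point `∑_a (-1)^{a+1} p^α_a φ_α z^{-a-1} + ∑_a q^α_a φ_α z^a` has `t^α_0` and `t^α_1` without
constant term, where `t^α_a = q^α_a + A^α δ_{a,1}`, whereas the `t^α_a` with `a ≥ 2` are arbitrary:
ancestor potentials are polynomial in these, so they are also formal functions around every
point `-A^α φ_α z + O(z²)`. -/
def cone {N : ℕ} (A : Fin N → ℂ) (Fa : ℕ → Fin N → BigFun N) (τ : Type) :
    Set (Loop N (MvPowerSeries τ ℂ)) :=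
  {f | (∀ α, constantCoeff (f 0 α) = 0) ∧
    (∀ α, constantCoeff (f 1 α) = -A α) ∧
    ∀ (a : ℕ) (α : Fin N),
      EvaluatesTo (Fa a α)
        (fun i => f (i.2 : ℤ) i.1 + if i.2 = 1 then C (A i.1) else 0)
        ((-1) ^ (a + 1) * f (-(a : ℤ) - 1) α)}

/-- `End(ℂᴺ)[[z]]`. -/
abbrev EndSeries (N : ℕ) : Type := PowerSeries (Matrix (Fin N) (Fin N) ℂ)

/-- The upper triangular group `G_+` of all `R(z) = Id + ∑_{i≥1} R_i z^i` in `End(ℂᴺ)[[z]]`. -/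
def upperTriangularGroup (N : ℕ) : Subgroup (EndSeries N)ˣ :=
  (Units.map (PowerSeries.constantCoeff :
    EndSeries N →+* Matrix (Fin N) (Fin N) ℂ).toMonoidHom).ker

/-- The `i`-th summand of the coefficient of `φ_α z^k m` in `R(z) f(z)`, for a monomial `m` in
the parameters. -/
def loopMulTerm {N : ℕ} {τ : Type} (R : EndSeries N) (f : Loop N (MvPowerSeries τ ℂ))
    (k : ℤ) (α : Fin N) (m : τ →₀ ℕ) (i : ℕ) : ℂ :=
  ∑ μ, PowerSeries.coeff i R α μ * coeff m (f (k - i) μ)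

/-- The product `R(z) f(z)`, computed coefficientwise. -/
def loopMul {N : ℕ} {τ : Type} (R : EndSeries N) (f : Loop N (MvPowerSeries τ ℂ)) :
    Loop N (MvPowerSeries τ ℂ) :=
  fun k α m => ∑ᶠ i : ℕ, loopMulTerm R f k α m i

/-- All sums occurring in the product `R(z) f(z)` are coefficientwise finite. -/
def LoopMulDefined {N : ℕ} {τ : Type} (R : EndSeries N) (f : Loop N (MvPowerSeries τ ℂ)) : Prop :=
  ∀ k α m, {i : ℕ | loopMulTerm R f k α m i ≠ 0}.Finite

/-- `𝒞' = R(z) 𝒞` for germs in the loop space: multiplication by `R(z)` is defined on `𝒞` and its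
image is exactly `𝒞'`. -/
def IsImageCone {N : ℕ} (R : EndSeries N)
    (Co Co' : (τ : Type) → Set (Loop N (MvPowerSeries τ ℂ))) : Prop :=
  ∀ τ : Type, (∀ f ∈ Co τ, LoopMulDefined R f) ∧ loopMul R '' Co τ = Co' τ

/-! ### Canonical coordinates, metric and R-matrices -/

/-- `dMat α M = ∂M/∂t^α`, entrywise. -/
def dMat {N : ℕ} (α : Fin N) (M : Matrix (Fin N) (Fin N) (Fun N)) :
    Matrix (Fin N) (Fin N) (Fun N) :=
  M.map fun x => pderiv ℂ α x

/-- The Jacobian matrix `(∂u^i/∂t^α)`. -/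
def jacobian {N : ℕ} (u : Fin N → Fun N) : Matrix (Fin N) (Fin N) (Fun N) :=
  Matrix.of fun i α => pderiv ℂ α (u i)

/-- `∂U/∂t^α` for `U = diag(u¹, …, uᴺ)`. -/
def dU {N : ℕ} (u : Fin N → Fun N) (α : Fin N) : Matrix (Fin N) (Fin N) (Fun N) :=
  dMat α (Matrix.diagonal u)

/-- `u¹, …, uᴺ` are canonical coordinates: `∂/∂u^k ∘ ∂/∂u^l = δ_{kl} ∂/∂u^k`, where
`∂/∂u^k = ∑_β (J⁻¹)^β_k ∂/∂t^β`, `J` the Jacobian matrix. -/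
structure IsCanonicalCoordinates {N : ℕ} (F : Fin N → Fun N) (u : Fin N → Fun N) : Prop where
  isUnit_det : IsUnit (jacobian u).det
  mul_eq : ∀ k l α,
    ∑ β, ∑ γ, structureConst F α β γ * (jacobian u)⁻¹ β k * (jacobian u)⁻¹ γ l =
      if k = l then (jacobian u)⁻¹ α k else 0

/-- The matrix `Ψ = H Ψ̃`, where `Ψ̃` is the Jacobian matrix and `H = diag(H_1, …, H_N)`. -/
def frameMatrix {N : ℕ} (u H : Fin N → Fun N) : Matrix (Fin N) (Fin N) (Fun N) :=
  Matrix.diagonal H * jacobian u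

/-- The matrix of rotation coefficients `Γ = H Γ̃ H⁻¹`. -/
def rotationMatrix {N : ℕ} (H : Fin N → Fun N) (Γt : Matrix (Fin N) (Fin N) (Fun N)) :
    Matrix (Fin N) (Fin N) (Fun N) :=
  Matrix.diagonal H * Γt * (Matrix.diagonal H)⁻¹

/-- Canonical coordinates `u`, a matrix `H = diag(H_1, …, H_N)` of metric coefficients and
matrices `R_0 = Id, R_1, R_2, …` associated with a flat F-manifold. Here `D α i` is the coefficient
of `dt^α` in the one-form `D̃_i`. -/
structure IsSemisimpleFrame {N : ℕ} (F : Fin N → Fun N) (u : Fin N → Fun N)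
    (D : Fin N → Fin N → Fun N) (Γt : Matrix (Fin N) (Fin N) (Fun N)) (H : Fin N → Fun N)
    (R : ℕ → Matrix (Fin N) (Fin N) (Fun N)) : Prop where
  canonical : IsCanonicalCoordinates F u
  /-- `Γ̃` has vanishing diagonal. -/
  diag_zero : ∀ i, Γt i i = 0
  /-- `dΨ̃ · Ψ̃⁻¹ = D̃ + [Γ̃, dU]` -/
  connection : ∀ α, dMat α (jacobian u) * (jacobian u)⁻¹ =
    Matrix.diagonal (D α) + (Γt * dU u α - dU u α * Γt)
  isUnit_H : ∀ i, IsUnit (H i)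
  /-- `dH · H⁻¹ = -D̃` -/
  deriv_H : ∀ α i, pderiv ℂ α (H i) = -(D α i * H i)
  R_zero : R 0 = 1
  /-- `dR_{k-1} + R_{k-1} [Γ, dU] = [R_k, dU]` -/
  R_succ : ∀ k α,
    dMat α (R k) +
        R k * (rotationMatrix H Γt * dU u α - dU u α * rotationMatrix H Γt) =
      R (k + 1) * dU u α - dU u α * R (k + 1)

/-- The value at the origin of a matrix of power series. -/
def atZero {N : ℕ} (M : Matrix (Fin N) (Fin N) (Fun N)) : Matrix (Fin N) (Fin N) ℂ :=
  M.map fun x => constantCoeff x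

/-- `R(-z, 0) = ∑_k R_k(0) (-z)^k`. -/
def seriesAtZero {N : ℕ} (R : ℕ → Matrix (Fin N) (Fin N) (Fun N)) : EndSeries N :=
  PowerSeries.mk fun k => (-1) ^ k * atZero (R k)

/-- `Ψ⁻¹(0) R⁻¹(-z, 0) Ψ(0)`. -/
def reconstructionSeries {N : ℕ} (u H : Fin N → Fun N)
    (R : ℕ → Matrix (Fin N) (Fin N) (Fun N)) : EndSeries N :=
  PowerSeries.C (atZero (frameMatrix u H))⁻¹ * PowerSeries.invOfUnit (seriesAtZero R) 1 *
    PowerSeries.C (atZero (frameMatrix u H))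

end FlatF

end

noncomputable section

namespace FlatF

/-! ### Order of vanishing of formal power series -/

section Order

variable {σ τ R S : Type*} [CommRing R] [CommRing S]

/-! Collect a calibration that vanishes at the origin into `T(t,z) = ∑_j (-1)^j Ω^{j-1}_0 z^{-j}`
(`fundSol`). Since `Ω^{j-1}_0` vanishes to order `j`, this is an invertible matrix over
`ℂ((z))[[t]]`, and it is the solution of `∂_γ T = -z⁻¹ T C_γ`, `T(0) = 1`, where `C_γ` is
multiplication by `∂_γ`.

The first half describes the cone by its rulings (`IsAncestorPotentials.exists_mem_cone_iff`): its
points are exactly the `z T(w) y`, where `w` has no constant term and `y` has only nonnegative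
powers of `z` and leading coefficient `-A` at the origin. The principal hierarchy is equivalent to
the hodograph equation `v = ∑_b Ω^0_{b-1}(v) t_b` (`hodograph_eq_of_flow`, `flow_of_hodograph_eq`).
In the variables `q` this equation says that the coefficient of `z^0` in `T(w)⁻¹ q(z)` vanishes, and
then `∑_b Ω^a_b(w) q_b` is, up to sign, the coefficient of `z^{-a-1}` in `T(w)` applied to the
nonnegative part of `T(w)⁻¹ q(z)`. The ancestor condition is what forces the calibration to vanish
at the origin (`isBased_of_ancestor`). Giving `t_b` the weight `b - 1` shows that the potentials can
be evaluated at points with arbitrary `t_2, t_3, …`.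

The second half compares two fundamental solutions. By the recursion for the `R_k`, `Q = R(-z,t)Ψ`
satisfies `z dQ = dU Q - Q C`, so that formally `e^{-U/z} Q` solves the equation of `T`. The
exponential is supplied by the constant part: with `φ = J(0)⁻¹(u - u(0))` (`flatMap`), the pullback
`T_const(φ)` plays the role of `Ψ(0)⁻¹ e^{-(U-U(0))/z} Ψ(0)`. Hence `T_const(φ) M` with `M = Ψ(0)⁻¹
R(-z,t) Ψ` solves the same linear system as `T`, and comparison at `t = 0` gives `T = G · T_const(φ)
· M`, with `G` the reconstruction series (`IsSemisimpleFrame.fundSol_eq`). Thus `z T(v) y = G · z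
T_const(φ(v)) · M(v) y`. Since `φ` is formally invertible and `M(v)` is an invertible power series
in `z` preserving the conditions on `y`, rulings go onto rulings (`IsSemisimpleFrame.isImageCone`).

The existence statements rest on the Poincaré lemma (calibrations, canonical coordinates, `H`,
diagonals of the `R_k`), on a contraction principle (the hodograph equation, inversion of `φ`), and
on Newton's method for lifting idempotents from the origin. Solvability of the recursion for the
`R_k` comes from the flatness of `dΨ Ψ⁻¹`. -/

/-- All coefficients of `f` of total degree less than `k` vanish. -/
def OrdGE (k : ℕ) (f : MvPowerSeries σ R) : Prop :=
  ∀ n : σ →₀ ℕ, n.degree < k → coeff n f = 0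

theorem ordGE_iff {k : ℕ} {f : MvPowerSeries σ R} : OrdGE k f ↔ (k : ℕ∞) ≤ f.order := by
  refine ⟨fun h => nat_le_order h, fun h n hn => coeff_of_lt_order ?_⟩
  exact lt_of_lt_of_le (by exact_mod_cast hn) h

theorem OrdGE.zero_left (f : MvPowerSeries σ R) : OrdGE 0 f := fun _ h => absurd h (by simp)

theorem OrdGE.zero (k : ℕ) : OrdGE k (0 : MvPowerSeries σ R) := fun _ _ => by simp

theorem OrdGE.mono {k l : ℕ} {f : MvPowerSeries σ R} (h : OrdGE l f) (hk : k ≤ l) : OrdGE k f :=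
  fun n hn => h n (lt_of_lt_of_le hn hk)

theorem OrdGE.add {k : ℕ} {f g : MvPowerSeries σ R} (hf : OrdGE k f) (hg : OrdGE k g) :
    OrdGE k (f + g) := fun n hn => by rw [map_add, hf n hn, hg n hn, add_zero]

theorem OrdGE.neg {k : ℕ} {f : MvPowerSeries σ R} (hf : OrdGE k f) : OrdGE k (-f) :=
  fun n hn => by rw [map_neg, hf n hn, neg_zero]

theorem OrdGE.sub {k : ℕ} {f g : MvPowerSeries σ R} (hf : OrdGE k f) (hg : OrdGE k g) :
    OrdGE k (f - g) := fun n hn => by rw [map_sub, hf n hn, hg n hn, sub_zero]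

theorem OrdGE.sum {ι : Type*} {k : ℕ} {s : Finset ι} {f : ι → MvPowerSeries σ R}
    (hf : ∀ i ∈ s, OrdGE k (f i)) : OrdGE k (∑ i ∈ s, f i) :=
  fun n hn => by rw [map_sum, Finset.sum_eq_zero fun i hi => hf i hi n hn]

theorem OrdGE.mul {k l : ℕ} {f g : MvPowerSeries σ R} (hf : OrdGE k f) (hg : OrdGE l g) :
    OrdGE (k + l) (f * g) := by
  rw [ordGE_iff] at *
  exact le_trans (by push_cast; exact add_le_add hf hg) le_order_mul

theorem OrdGE.mul_left {k : ℕ} {g : MvPowerSeries σ R} (f : MvPowerSeries σ R) (hg : OrdGE k g) :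
    OrdGE k (f * g) := by simpa using (OrdGE.zero_left f).mul hg

theorem OrdGE.mul_right {k : ℕ} {f : MvPowerSeries σ R} (hf : OrdGE k f) (g : MvPowerSeries σ R) :
    OrdGE k (f * g) := by simpa using hf.mul (OrdGE.zero_left g)

theorem OrdGE.pow {k : ℕ} {f : MvPowerSeries σ R} (hf : OrdGE k f) (n : ℕ) :
    OrdGE (n * k) (f ^ n) := by
  induction n with
  | zero => simpa using OrdGE.zero_left _
  | succ n ih => rw [pow_succ, Nat.succ_mul]; exact ih.mul hf

theorem OrdGE.smul {k : ℕ} {f : MvPowerSeries σ R} (hf : OrdGE k f) (c : R) :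
    OrdGE k (c • f) := fun n hn => by simp [hf n hn]

theorem ordGE_one_iff {f : MvPowerSeries σ R} : OrdGE 1 f ↔ constantCoeff f = 0 := by
  rw [← coeff_zero_eq_constantCoeff_apply]
  refine ⟨fun h => h 0 (by simp), fun h n hn => ?_⟩
  rw [Nat.lt_one_iff, Finsupp.degree_eq_zero_iff] at hn
  rw [hn, h]

theorem eq_of_ordGE_sub {f g : MvPowerSeries σ R} (h : ∀ k, OrdGE k (f - g)) : f = g := by
  ext n
  exact sub_eq_zero.mp (by simpa using h (n.degree + 1) n (Nat.lt_succ_self _))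

theorem OrdGE.prod {a : σ → MvPowerSeries τ R} (ha : ∀ i, OrdGE 1 (a i)) (n : σ →₀ ℕ) :
    OrdGE n.degree (n.prod fun i k => a i ^ k) := by
  classical
  rw [Finsupp.prod, Finsupp.degree_apply]
  induction n.support using Finset.induction_on with
  | empty => simpa using OrdGE.zero_left _
  | insert i s hi ih =>
    rw [Finset.prod_insert hi, Finset.sum_insert hi]
    exact OrdGE.mul (by simpa using (ha i).pow (n i)) ih

theorem OrdGE.pderiv {k : ℕ} {f : MvPowerSeries σ R} (hf : OrdGE (k + 1) f) (i : σ) :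
    OrdGE k (MvPowerSeries.pderiv R i f) := fun n hn => by
  rw [coeff_pderiv, hf, zero_mul]
  rw [map_add, Finsupp.degree_single]; omega

theorem exists_add_single {n : σ →₀ ℕ} (hn : n ≠ 0) : ∃ i m, n = m + Finsupp.single i 1 := by
  classical
  obtain ⟨i, hi⟩ := Finsupp.ne_iff.mp hn
  refine ⟨i, n - Finsupp.single i 1, (tsub_add_cancel_of_le ?_).symm⟩
  exact Finsupp.single_le_iff.mpr (Nat.one_le_iff_ne_zero.mpr hi)

/-- In characteristic zero every nonconstant coefficient of `f` can be read off from a partial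
derivative. -/
theorem ordGE_succ_of_pderiv [NoZeroDivisors R] [CharZero R] {k : ℕ} {f : MvPowerSeries σ R}
    (h0 : constantCoeff f = 0)
    (hf : ∀ i, OrdGE k (MvPowerSeries.pderiv R i f)) : OrdGE (k + 1) f := fun n hn => by
  by_cases h : n = 0
  · rw [h, coeff_zero_eq_constantCoeff_apply, h0]
  obtain ⟨i, m, rfl⟩ := exists_add_single h
  rw [map_add, Finsupp.degree_single] at hn
  have := hf i m (by omega)
  rw [coeff_pderiv] at this
  exact (mul_eq_zero.mp this).resolve_right (Nat.cast_add_one_ne_zero _)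

theorem OrdGE.map {k : ℕ} {f : MvPowerSeries σ R} (hf : OrdGE k f) (φ : R →+* S) :
    OrdGE k (MvPowerSeries.map φ f) := fun n hn => by rw [coeff_map, hf n hn, map_zero]

variable [Algebra R S]

theorem OrdGE.subst {k : ℕ} {f : MvPowerSeries σ R} (hf : OrdGE k f) {a : σ → MvPowerSeries τ S}
    (ha : HasSubst a) (ha0 : ∀ i, OrdGE 1 (a i)) : OrdGE k (MvPowerSeries.subst a f) :=
  fun m hm => by
  rw [coeff_subst ha]
  refine finsum_eq_zero_of_forall_eq_zero fun n => ?_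
  by_cases hn : n.degree < k
  · rw [hf n hn, zero_smul]
  · rw [OrdGE.prod ha0 n m (by omega), smul_zero]

/-- Exchange the factors one at a time: each exchange produces a difference of order `k` next to
`n.degree - 1` factors of order one. For `n = 0` both products are `1`, so the truncated subtraction
is harmless. -/
theorem OrdGE.prod_sub_prod {k : ℕ} {a b : σ → MvPowerSeries τ S}
    (ha : ∀ i, OrdGE 1 (a i)) (hb : ∀ i, OrdGE 1 (b i)) (hab : ∀ i, OrdGE k (a i - b i))
    (n : σ →₀ ℕ) :
    OrdGE (k + n.degree - 1) ((n.prod fun i k => a i ^ k) - n.prod fun i k => b i ^ k) := by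
  classical
  induction hd : n.degree generalizing n with
  | zero =>
    rw [Finsupp.degree_eq_zero_iff] at hd
    subst hd; simpa using OrdGE.zero _
  | succ d ih =>
    obtain ⟨i, m, rfl⟩ := exists_add_single (n := n) (by rintro rfl; simp at hd)
    rw [map_add, Finsupp.degree_single] at hd
    have hm : m.degree = d := by omega
    rw [Finsupp.prod_add_index' (by simp) (by simp [pow_add]),
      Finsupp.prod_add_index' (by simp) (by simp [pow_add]),
      Finsupp.prod_single_index (by simp), Finsupp.prod_single_index (by simp), pow_one, pow_one]
    have e : (m.prod fun i k => a i ^ k) * a i - (m.prod fun i k => b i ^ k) * b i =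
      (a i - b i) * (m.prod fun i k => a i ^ k) +
        b i * ((m.prod fun i k => a i ^ k) - m.prod fun i k => b i ^ k) := by ring
    rw [e]
    refine (((hab i).mul (OrdGE.prod ha m)).mono (by omega)).add
      (((hb i).mul (ih m hm)).mono (by omega))

/-- If `a` and `b` agree up to order `k` and `f - f(0)` vanishes to order `c + 1`, then
`f(a)` and `f(b)` agree up to order `k + c`. -/
theorem OrdGE.subst_sub_subst {k c : ℕ} {f : MvPowerSeries σ R} {a b : σ → MvPowerSeries τ S}
    (ha : HasSubst a) (hb : HasSubst b) (ha0 : ∀ i, OrdGE 1 (a i)) (hb0 : ∀ i, OrdGE 1 (b i))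
    (hab : ∀ i, OrdGE k (a i - b i)) (hf : ∀ n ≠ 0, n.degree ≤ c → coeff n f = 0) :
    OrdGE (k + c) (MvPowerSeries.subst a f - MvPowerSeries.subst b f) := fun m hm => by
  rw [map_sub, coeff_subst ha, coeff_subst hb,
    ← finsum_sub_distrib (coeff_subst_finite ha f m) (coeff_subst_finite hb f m)]
  refine finsum_eq_zero_of_forall_eq_zero fun n => ?_
  rw [← smul_sub, ← map_sub]
  by_cases h0 : n = 0
  · subst h0; simp
  by_cases hn : n.degree ≤ c
  · rw [hf n h0 hn, zero_smul]
  · rw [OrdGE.prod_sub_prod ha0 hb0 hab n m (by omega), smul_zero]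

end Order

/-! ### Chain rule, Poincaré lemma, fixed points -/

section Calculus

variable {σ τ R S : Type*} [CommRing R] [CommRing S] [Algebra R S]

theorem hasSubst_of_ordGE [Finite σ] {a : σ → MvPowerSeries τ S} (ha : ∀ i, OrdGE 1 (a i)) :
    HasSubst a := hasSubst_of_constantCoeff_zero fun i => ordGE_one_iff.mp (ha i)

theorem subst_zero_right {a : σ → MvPowerSeries τ S} (ha : HasSubst a) :
    subst a (0 : MvPowerSeries σ R) = 0 := by rw [← substAlgHom_apply ha, map_zero]

theorem subst_one_right {a : σ → MvPowerSeries τ S} (ha : HasSubst a) :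
    subst a (1 : MvPowerSeries σ R) = 1 := by rw [← substAlgHom_apply ha, map_one]

theorem subst_neg_right {a : σ → MvPowerSeries τ S} (ha : HasSubst a) (f : MvPowerSeries σ R) :
    subst a (-f) = -subst a f := by simp only [← substAlgHom_apply ha, map_neg]

theorem subst_sum_right {ι : Type*} {a : σ → MvPowerSeries τ S} (ha : HasSubst a) (s : Finset ι)
    (f : ι → MvPowerSeries σ R) : subst a (∑ i ∈ s, f i) = ∑ i ∈ s, subst a (f i) := by
  simp only [← substAlgHom_apply ha, map_sum]

theorem exists_polynomial_ordGE_sub [Finite σ] (f : MvPowerSeries σ R) (k : ℕ) :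
    ∃ p : MvPolynomial σ R, OrdGE k (f - (p : MvPowerSeries σ R)) := by
  refine ⟨truncTotal k f, fun n hn => ?_⟩
  rw [map_sub, MvPolynomial.coeff_coe, coeff_truncTotal _ hn, sub_self]

/-- Both sides are additive in `f` and continuous for the order filtration, so polynomials suffice.
The polynomial approximates `f` one order better than needed because differentiation loses one
order. -/
theorem pderiv_subst [Fintype σ] {a : σ → MvPowerSeries τ S} (ha : ∀ i, OrdGE 1 (a i))
    (f : MvPowerSeries σ R) (j : τ) :
    pderiv S j (subst a f) = ∑ i, subst a (pderiv R i f) * pderiv S j (a i) := by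
  classical
  have hs := hasSubst_of_ordGE ha
  have hpoly : ∀ p : MvPolynomial σ R, pderiv S j (subst a (p : MvPowerSeries σ R)) =
      ∑ i, subst a (pderiv R i (p : MvPowerSeries σ R)) * pderiv S j (a i) := by
    intro p
    induction p using MvPolynomial.induction_on with
    | C r =>
      rw [MvPolynomial.coe_C, show (C r : MvPowerSeries σ R) = monomial 0 r from rfl,
        subst_monomial hs, show (monomial 0 r : MvPowerSeries σ R) = C r from rfl]
      simp [MvPowerSeries.algebraMap_apply, subst_zero_right hs]
    | add p q hp hq =>
      simp only [MvPolynomial.coe_add, subst_add hs, map_add, hp, hq, add_mul,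
        Finset.sum_add_distrib]
    | mul_X p i hp =>
      simp only [MvPolynomial.coe_mul, MvPolynomial.coe_X, subst_mul hs, subst_X hs,
        Derivation.leibniz, smul_eq_mul, subst_add hs, hp, add_mul, Finset.sum_add_distrib,
        pderiv_X]
      congr 1
      · rw [Finset.sum_eq_single i]
        · simp [subst_one_right hs]
        · intro b _ hb; simp [hb, subst_zero_right hs]
        · simp
      · rw [Finset.mul_sum]; exact Finset.sum_congr rfl fun _ _ => by ring
  refine eq_of_ordGE_sub fun k => ?_
  obtain ⟨p, hp⟩ := exists_polynomial_ordGE_sub f (k + 1)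
  have e : pderiv S j (subst a f) - ∑ i, subst a (pderiv R i f) * pderiv S j (a i) =
      pderiv S j (subst a (f - (p : MvPowerSeries σ R))) -
        ∑ i, subst a (pderiv R i (f - (p : MvPowerSeries σ R))) * pderiv S j (a i) := by
    simp only [subst_sub hs, map_sub, hpoly, sub_mul, Finset.sum_sub_distrib]
    ring
  rw [e]
  exact ((hp.subst hs ha).pderiv j).sub
    (OrdGE.sum fun i _ => ((hp.pderiv i).subst hs ha).mul_right _)

/-- Poincaré lemma. -/
theorem exists_pderiv_eq {K : Type*} [Field K] [CharZero K] (ω : σ → MvPowerSeries σ K)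
    (h : ∀ i j, pderiv K i (ω j) = pderiv K j (ω i)) :
    ∃ φ : MvPowerSeries σ K, constantCoeff φ = 0 ∧ ∀ i, pderiv K i φ = ω i := by
  classical
  -- Closedness makes the candidate coefficient `ω_i[m] / (m_i + 1)` independent of the variable
  -- split off from the monomial, so the arbitrary choice in `φ` does no harm.
  have key : ∀ (m m' : σ →₀ ℕ) (i j : σ), m + Finsupp.single i 1 = m' + Finsupp.single j 1 →
      coeff m (ω i) * (m' j + 1) = coeff m' (ω j) * (m i + 1) := by
    intro m m' i j e
    by_cases hij : i = j
    · subst hij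
      rw [add_right_cancel e]
    have hm : Finsupp.single j 1 ≤ m := by
      rw [Finsupp.single_le_iff]
      have := DFunLike.congr_fun e j
      simp [hij] at this
      omega
    obtain ⟨d, rfl⟩ : ∃ d, m = d + Finsupp.single j 1 := ⟨_, (tsub_add_cancel_of_le hm).symm⟩
    have hd : m' = d + Finsupp.single i 1 := by
      rw [add_right_comm] at e; exact (add_right_cancel e).symm
    subst hd
    have := congrArg (coeff d) (h i j)
    rw [coeff_pderiv, coeff_pderiv] at this
    simp only [Finsupp.add_apply, Finsupp.single_apply, hij, Ne.symm hij, if_false, add_zero]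
    simpa using this.symm
  let φ : MvPowerSeries σ K := fun n =>
    if hn : n = 0 then 0 else
      coeff (exists_add_single hn).choose_spec.choose (ω (exists_add_single hn).choose) /
        ((exists_add_single hn).choose_spec.choose (exists_add_single hn).choose + 1)
  refine ⟨φ, ?_, fun i => ?_⟩
  · rw [← coeff_zero_eq_constantCoeff_apply]
    change φ 0 = 0
    simp [φ]
  · ext m
    rw [coeff_pderiv]
    have hn : m + Finsupp.single i 1 ≠ 0 := by
      intro e
      have := DFunLike.congr_fun e i
      simp at this
    change φ (m + Finsupp.single i 1) * _ = _
    simp only [φ, dif_neg hn]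
    have e := (exists_add_single hn).choose_spec.choose_spec
    have := key _ _ _ _ e
    rw [div_mul_eq_mul_div, div_eq_iff (Nat.cast_add_one_ne_zero _), this]

variable {ι : Type*}

/-- The contraction principle for the order filtration: each iteration fixes one more degree, so the
coefficients of degree `d` are those of the iterate `d + 1`. The closed condition `P` is carried
along because contraction is only required on it, and it also transports extra information to the
limit. -/
theorem exists_fixedPoint (Φ : (ι → MvPowerSeries σ R) → ι → MvPowerSeries σ R)
    (P : (ι → MvPowerSeries σ R) → Prop) (x₀ : ι → MvPowerSeries σ R) (h0 : P x₀)
    (hP : ∀ x, P x → P (Φ x))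
    (hcl : ∀ x, (∀ k, ∃ y, P y ∧ ∀ i, OrdGE k (x i - y i)) → P x)
    (hc : ∀ x y k, P x → P y → (∀ i, OrdGE k (x i - y i)) →
      ∀ i, OrdGE (k + 1) (Φ x i - Φ y i)) :
    ∃ x, P x ∧ Φ x = x := by
  let s : ℕ → ι → MvPowerSeries σ R := fun n => Φ^[n] x₀
  have hsucc : ∀ n, s (n + 1) = Φ (s n) := fun n => Function.iterate_succ_apply' Φ n x₀
  have hsP : ∀ n, P (s n) := fun n => by
    induction n with
    | zero => exact h0
    | succ n ih => rw [hsucc]; exact hP _ ih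
  have h1 : ∀ n i, OrdGE n (s (n + 1) i - s n i) := fun n => by
    induction n with
    | zero => exact fun i => OrdGE.zero_left _
    | succ n ih => intro i; rw [hsucc (n + 1)]; nth_rw 2 [hsucc n]; exact hc _ _ _ (hsP _) (hsP _) ih i
  have h2 : ∀ n d i, OrdGE n (s (n + d) i - s n i) := fun n d i => by
    induction d with
    | zero => simpa using OrdGE.zero n
    | succ d ih =>
      have := ((h1 (n + d) i).mono (Nat.le_add_right n d)).add ih
      rwa [sub_add_sub_cancel] at this
  let x : ι → MvPowerSeries σ R := fun i m => coeff m (s (m.degree + 1) i)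
  have hx : ∀ n i, OrdGE n (x i - s n i) := fun n i m hm => by
    rw [map_sub]
    change coeff m (s (m.degree + 1) i) - _ = 0
    obtain ⟨d, rfl⟩ := Nat.exists_eq_add_of_le (Nat.succ_le_of_lt hm)
    have := h2 (m.degree + 1) d i m (Nat.lt_succ_self _)
    rw [map_sub] at this
    rw [← neg_sub, neg_eq_zero]; exact this
  have hPx : P x := hcl x fun k => ⟨s k, hsP k, hx k⟩
  refine ⟨x, hPx, funext fun i => eq_of_ordGE_sub fun k => ?_⟩
  have a := hc x (s k) k hPx (hsP k) (hx k) i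
  have b := hx (k + 1) i
  rw [hsucc] at b
  have := (a.sub b).mono (Nat.le_succ k)
  rwa [sub_sub_sub_cancel_right] at this

theorem fixedPoint_unique (Φ : (ι → MvPowerSeries σ R) → ι → MvPowerSeries σ R)
    (P : (ι → MvPowerSeries σ R) → Prop)
    (hc : ∀ x y k, P x → P y → (∀ i, OrdGE k (x i - y i)) →
      ∀ i, OrdGE (k + 1) (Φ x i - Φ y i))
    {x y : ι → MvPowerSeries σ R} (hx : P x) (hy : P y) (hfx : Φ x = x) (hfy : Φ y = y) :
    x = y := by
  have : ∀ k i, OrdGE k (x i - y i) := fun k => by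
    induction k with
    | zero => exact fun i => OrdGE.zero_left _
    | succ k ih =>
      intro i
      have := hc x y k hx hy ih i
      rwa [hfx, hfy] at this
  exact funext fun i => eq_of_ordGE_sub fun k => this k i

end Calculus

/-! ### Power series with Laurent series coefficients -/

/-- The field `ℂ((z))`. -/
def LaurentZ : Type := LaurentSeries ℂ

namespace LaurentZ

instance : CommRing LaurentZ := inferInstanceAs (CommRing (LaurentSeries ℂ))

instance : NoZeroDivisors LaurentZ := inferInstanceAs (NoZeroDivisors (LaurentSeries ℂ))

/-- The coefficient of `z^k`. -/
def zc (k : ℤ) : LaurentZ →+ ℂ := HahnSeries.coeff.addMonoidHom (R := ℂ) k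

/-- The monomial `r z^k`. -/
def single (k : ℤ) (r : ℂ) : LaurentZ := (HahnSeries.single k r : LaurentSeries ℂ)

/-- The inclusion of constants. -/
def const : ℂ →+* LaurentZ := (HahnSeries.C : ℂ →+* LaurentSeries ℂ)

/-- The inclusion of power series. -/
def ofPS : PowerSeries ℂ →+* LaurentZ := HahnSeries.ofPowerSeries ℤ ℂ

theorem ext {x y : LaurentZ} (h : ∀ k, zc k x = zc k y) : x = y :=
  HahnSeries.ext (funext h)

theorem zc_single_mul (j k : ℤ) (r : ℂ) (x : LaurentZ) :
    zc k (single j r * x) = r * zc (k - j) x := HahnSeries.coeff_single_mul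

theorem zc_single_same (k : ℤ) (r : ℂ) : zc k (single k r) = r := HahnSeries.coeff_single_same k r

theorem zc_single_of_ne {j k : ℤ} (h : k ≠ j) (r : ℂ) : zc k (single j r) = 0 :=
  HahnSeries.coeff_single_of_ne h

theorem single_mul_single (j k : ℤ) (r s : ℂ) :
    single j r * single k s = single (j + k) (r * s) := HahnSeries.single_mul_single

theorem const_eq_single (r : ℂ) : const r = single 0 r := rfl

theorem zc_mul_const (k : ℤ) (x : LaurentZ) (r : ℂ) : zc k (x * const r) = zc k x * r :=
  HahnSeries.coeff_mul_single_zero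

theorem zc_ofPS (k : ℤ) (f : PowerSeries ℂ) :
    zc k (ofPS f) = if k < 0 then 0 else PowerSeries.coeff k.natAbs f :=
  PowerSeries.coeff_coe f k

theorem zc_ofPS_natCast (k : ℕ) (f : PowerSeries ℂ) : zc k (ofPS f) = PowerSeries.coeff k f :=
  HahnSeries.ofPowerSeries_apply_coeff f k

instance : CharZero LaurentZ where
  cast_injective m n h := by
    have e : ∀ m : ℕ, zc 0 (m : LaurentZ) = m := fun m => by
      rw [← map_natCast const m, const_eq_single, zc_single_same]
    have := congrArg (zc 0) h
    rw [e, e] at this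
    exact_mod_cast this

theorem exists_eq_single_mul (x : LaurentZ) : ∃ (n : ℤ) (f : PowerSeries ℂ),
    x = single n 1 * ofPS f :=
  ⟨_, _, (LaurentSeries.single_order_mul_powerSeriesPart (show LaurentSeries ℂ from x)).symm⟩

/-- A Laurent series has finitely many negative powers of `z`, so convolution with a power series is
a finite sum. -/
theorem zc_ofPS_mul (k : ℤ) (g : PowerSeries ℂ) (x : LaurentZ) :
    {i : ℕ | PowerSeries.coeff i g * zc (k - i) x ≠ 0}.Finite ∧
      zc k (ofPS g * x) = ∑ᶠ i : ℕ, PowerSeries.coeff i g * zc (k - i) x := by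
  obtain ⟨n, f, rfl⟩ := exists_eq_single_mul x
  have h0 : ∀ i : ℕ, k - n < i →
      PowerSeries.coeff i g * zc (k - i) (single n 1 * ofPS f) = 0 := fun i hi => by
    rw [zc_single_mul, zc_ofPS, if_pos (by omega), mul_zero, mul_zero]
  refine ⟨(Set.finite_le_nat (k - n).toNat).subset fun i hi => ?_, ?_⟩
  · by_contra hc
    simp only [Set.mem_ofPred_eq, not_le] at hc
    exact hi (h0 i (by omega))
  rw [mul_left_comm, ← map_mul, zc_single_mul, one_mul]
  rcases lt_or_ge (k - n) 0 with hk | hk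
  · rw [zc_ofPS, if_pos hk, finsum_eq_zero_of_forall_eq_zero fun i => h0 i (by omega)]
  · obtain ⟨p, hp⟩ := Int.eq_ofNat_of_zero_le hk
    rw [hp, zc_ofPS_natCast, PowerSeries.coeff_mul,
      Finset.Nat.sum_antidiagonal_eq_sum_range_succ_mk,
      finsum_eq_sum_of_support_subset (s := Finset.range p.succ)]
    · refine Finset.sum_congr rfl fun i hi => ?_
      have hi : i < p + 1 := by simpa using hi
      rw [zc_single_mul, show k - i - n = ((p - i : ℕ) : ℤ) by omega, zc_ofPS_natCast, one_mul]
    · intro i hi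
      by_contra hc
      simp only [Finset.coe_range, Set.mem_Iio, not_lt] at hc
      exact hi (h0 i (by omega))

end LaurentZ

open LaurentZ

section Laurent

variable {σ τ : Type*}

/-- The ring `ℂ((z))[[σ]]`. -/
abbrev LSer (σ : Type*) : Type _ := MvPowerSeries σ LaurentZ

/-- The coefficient of `z^k`. -/
def zcoeff (k : ℤ) : LSer σ →+ MvPowerSeries σ ℂ where
  toFun F := fun m => zc k (coeff m F)
  map_zero' := by ext m; change zc k (coeff m (0 : LSer σ)) = 0; simp
  map_add' F G := by
    ext m; change zc k (coeff m (F + G)) = zc k (coeff m F) + zc k (coeff m G); simp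

theorem coeff_zcoeff (k : ℤ) (F : LSer σ) (m : σ →₀ ℕ) :
    coeff m (zcoeff k F) = zc k (coeff m F) := rfl

theorem zcoeff_ext {F G : LSer σ} (h : ∀ k, zcoeff k F = zcoeff k G) : F = G := by
  refine MvPowerSeries.ext fun m => LaurentZ.ext fun k => ?_
  rw [← coeff_zcoeff, h, coeff_zcoeff]

/-- The inclusion `ℂ[[σ]] → ℂ((z))[[σ]]`. -/
def lift : MvPowerSeries σ ℂ →+* LSer σ := MvPowerSeries.map const

theorem coeff_lift (m : σ →₀ ℕ) (f : MvPowerSeries σ ℂ) :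
    coeff m (lift f) = const (coeff m f) := rfl

/-- The element `z^k`. -/
def zpow (k : ℤ) : LSer σ := C (single k 1)

theorem zpow_mul_zpow (j k : ℤ) : (zpow j : LSer σ) * zpow k = zpow (j + k) := by
  rw [zpow, zpow, zpow, ← map_mul, single_mul_single, one_mul]

theorem zpow_zero : (zpow 0 : LSer σ) = 1 := map_one C

theorem zcoeff_zpow_mul (j k : ℤ) (F : LSer σ) : zcoeff k (zpow j * F) = zcoeff (k - j) F := by
  ext m
  rw [coeff_zcoeff, zpow, coeff_C_mul, zc_single_mul, one_mul, coeff_zcoeff]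

theorem zcoeff_mul_lift (k : ℤ) (F : LSer σ) (c : MvPowerSeries σ ℂ) :
    zcoeff k (F * lift c) = zcoeff k F * c := by
  classical
  ext m
  rw [coeff_zcoeff, coeff_mul, coeff_mul, map_sum]
  refine Finset.sum_congr rfl fun x _ => ?_
  rw [coeff_lift, zc_mul_const, coeff_zcoeff]

theorem zcoeff_lift_mul (k : ℤ) (F : LSer σ) (c : MvPowerSeries σ ℂ) :
    zcoeff k (lift c * F) = c * zcoeff k F := by
  rw [mul_comm, zcoeff_mul_lift, mul_comm]

theorem zcoeff_lift (k : ℤ) (c : MvPowerSeries σ ℂ) :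
    zcoeff k (lift c) = if k = 0 then c else 0 := by
  ext m
  rw [coeff_zcoeff, coeff_lift, const_eq_single]
  split_ifs with h
  · rw [h, zc_single_same]
  · rw [zc_single_of_ne h, map_zero]

theorem zcoeff_pderiv (k : ℤ) (i : σ) (F : LSer σ) :
    zcoeff k (pderiv LaurentZ i F) = pderiv ℂ i (zcoeff k F) := by
  ext m
  rw [coeff_zcoeff, coeff_pderiv, coeff_pderiv, coeff_zcoeff]
  have : ((m i : LaurentZ) + 1) = const ((m i : ℂ) + 1) := by
    rw [map_add, map_one, map_natCast]
  rw [this, zc_mul_const]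

theorem pderiv_lift (i : σ) (f : MvPowerSeries σ ℂ) :
    pderiv LaurentZ i (lift f) = lift (pderiv ℂ i f) := by
  refine zcoeff_ext fun k => ?_
  rw [zcoeff_pderiv, zcoeff_lift, zcoeff_lift]
  split_ifs <;> simp

theorem ordGE_lift {k : ℕ} {f : MvPowerSeries σ ℂ} (h : OrdGE k f) : OrdGE k (lift f) := h.map _

theorem lift_subst {a : σ → MvPowerSeries τ ℂ} (ha : HasSubst a) (f : MvPowerSeries σ ℂ) :
    lift (subst a f) = subst (fun i => lift (a i)) (lift f) :=
  map_subst ha f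

/-- The substituted series do not involve `z`, so their products do not mix the powers of `z`. -/
theorem zcoeff_subst {a : σ → MvPowerSeries τ ℂ} (ha : HasSubst a) (k : ℤ) (F : LSer σ) :
    zcoeff k (subst (fun i => lift (a i)) F) = subst a (zcoeff k F) := by
  ext m
  have hl : HasSubst fun i => lift (a i) := ha.map _
  rw [coeff_zcoeff, coeff_subst hl, coeff_subst ha,
    AddMonoidHom.map_finsum _ (coeff_subst_finite hl F m)]
  refine finsum_congr fun d => ?_
  have : (d.prod fun i e => lift (a i) ^ e) = lift (d.prod fun i e => a i ^ e) := by
    simp only [Finsupp.prod, map_prod, map_pow]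
  rw [this, coeff_lift, smul_eq_mul, zc_mul_const, coeff_zcoeff, smul_eq_mul]

theorem subst_zpow_mul {a : σ → LSer τ} (ha : HasSubst a) (k : ℤ) (F : LSer σ) :
    subst a (zpow k * F) = zpow k * subst a F := by
  rw [subst_mul ha, zpow, subst_C, zpow]

/-- The series `∑_{b ≥ 0} a_b z^b`. -/
def ofSeq (a : ℕ → MvPowerSeries σ ℂ) : LSer σ :=
  fun m => ofPS (PowerSeries.mk fun b => coeff m (a b))

theorem coeff_ofSeq (a : ℕ → MvPowerSeries σ ℂ) (m : σ →₀ ℕ) :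
    coeff m (ofSeq a) = ofPS (PowerSeries.mk fun b => coeff m (a b)) := rfl

theorem zcoeff_ofSeq (a : ℕ → MvPowerSeries σ ℂ) (b : ℕ) : zcoeff (b : ℤ) (ofSeq a) = a b := by
  ext m
  rw [coeff_zcoeff, coeff_ofSeq, zc_ofPS_natCast, PowerSeries.coeff_mk]

theorem zcoeff_ofSeq_neg (a : ℕ → MvPowerSeries σ ℂ) {k : ℤ} (hk : k < 0) :
    zcoeff k (ofSeq a) = 0 := by
  ext m
  rw [coeff_zcoeff, coeff_ofSeq, zc_ofPS, if_pos hk, map_zero]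

/-- There are no negative powers of `z`. -/
def IsNonneg (F : LSer σ) : Prop := ∀ k < 0, zcoeff k F = 0

/-- There are only negative powers of `z`. -/
def IsNeg (F : LSer σ) : Prop := ∀ k : ℤ, 0 ≤ k → zcoeff k F = 0

theorem isNonneg_ofSeq (a : ℕ → MvPowerSeries σ ℂ) : IsNonneg (ofSeq a) :=
  fun _ hk => zcoeff_ofSeq_neg a hk

/-- The part of `F` with nonnegative powers of `z`. -/
def nonnegPart (F : LSer σ) : LSer σ := ofSeq fun b => zcoeff (b : ℤ) F

theorem zcoeff_nonnegPart (F : LSer σ) {k : ℤ} (hk : 0 ≤ k) :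
    zcoeff k (nonnegPart F) = zcoeff k F := by
  lift k to ℕ using hk
  exact zcoeff_ofSeq _ _

theorem isNonneg_nonnegPart (F : LSer σ) : IsNonneg (nonnegPart F) := isNonneg_ofSeq _

theorem isNeg_sub_nonnegPart (F : LSer σ) : IsNeg (F - nonnegPart F) := fun k hk => by
  rw [map_sub, zcoeff_nonnegPart F hk, sub_self]

theorem IsNonneg.eq_ofSeq {F : LSer σ} (h : IsNonneg F) : F = ofSeq fun b => zcoeff (b : ℤ) F := by
  refine zcoeff_ext fun k => ?_
  rcases lt_or_ge k 0 with hk | hk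
  · rw [h k hk, zcoeff_ofSeq_neg _ hk]
  · lift k to ℕ using hk
    rw [zcoeff_ofSeq]

theorem ofSeq_mul (a b : ℕ → MvPowerSeries σ ℂ) :
    ofSeq a * ofSeq b = ofSeq fun k => ∑ x ∈ Finset.HasAntidiagonal.antidiagonal k, a x.1 * b x.2 := by
  classical
  refine MvPowerSeries.ext fun m => ?_
  rw [coeff_mul, coeff_ofSeq]
  simp_rw [coeff_ofSeq, ← map_mul]
  rw [← map_sum]
  congr 1
  ext k
  rw [map_sum, PowerSeries.coeff_mk, map_sum]
  simp_rw [PowerSeries.coeff_mul, PowerSeries.coeff_mk, coeff_mul]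
  exact Finset.sum_comm

theorem IsNonneg.mul {F G : LSer σ} (hF : IsNonneg F) (hG : IsNonneg G) : IsNonneg (F * G) := by
  rw [hF.eq_ofSeq, hG.eq_ofSeq, ofSeq_mul]
  exact isNonneg_ofSeq _

theorem IsNonneg.zcoeff_zero_mul {F G : LSer σ} (hF : IsNonneg F) (hG : IsNonneg G) :
    zcoeff 0 (F * G) = zcoeff 0 F * zcoeff 0 G := by
  rw [hF.eq_ofSeq, hG.eq_ofSeq, ofSeq_mul]
  rw [show (0 : ℤ) = ((0 : ℕ) : ℤ) from rfl, zcoeff_ofSeq, zcoeff_ofSeq, zcoeff_ofSeq]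
  simp

theorem IsNonneg.sum {ι : Type*} {s : Finset ι} {F : ι → LSer σ} (h : ∀ i ∈ s, IsNonneg (F i)) :
    IsNonneg (∑ i ∈ s, F i) := fun k hk => by
  rw [map_sum, Finset.sum_eq_zero fun i hi => h i hi k hk]

theorem IsNonneg.subst {a : σ → MvPowerSeries τ ℂ} (ha : HasSubst a) {F : LSer σ}
    (hF : IsNonneg F) : IsNonneg (MvPowerSeries.subst (fun i => lift (a i)) F) := fun k hk => by
  rw [zcoeff_subst ha, hF k hk, subst_zero_right ha]

/-- The series `∑_{j ≥ 0} a_j z^{-j}`, for `a_j` vanishing to order `j`. -/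
def descSeq (a : ℕ → MvPowerSeries σ ℂ) : LSer σ :=
  fun m => ∑ j ∈ Finset.range (m.degree + 1), single (-(j : ℤ)) (coeff m (a j))

theorem coeff_descSeq (a : ℕ → MvPowerSeries σ ℂ) (m : σ →₀ ℕ) : coeff m (descSeq a) =
    ∑ j ∈ Finset.range (m.degree + 1), single (-(j : ℤ)) (coeff m (a j)) := rfl

theorem zcoeff_descSeq_neg {a : ℕ → MvPowerSeries σ ℂ} (ha : ∀ j, OrdGE j (a j)) (j : ℕ) :
    zcoeff (-(j : ℤ)) (descSeq a) = a j := by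
  ext m
  rw [coeff_zcoeff, coeff_descSeq, map_sum, Finset.sum_eq_single j]
  · rw [zc_single_same]
  · intro i _ hi
    rw [zc_single_of_ne]
    omega
  · intro hj
    rw [zc_single_same, ha j m]
    simpa using hj

theorem zcoeff_descSeq_pos (a : ℕ → MvPowerSeries σ ℂ) {k : ℤ} (hk : 0 < k) :
    zcoeff k (descSeq a) = 0 := by
  ext m
  rw [coeff_zcoeff, coeff_descSeq, map_sum, Finset.sum_eq_zero, map_zero]
  intro i _
  rw [zc_single_of_ne]
  omega

/-- As `a_j` starts in degree `j`, only the `j ≤ D` are visible in degrees up to `D`. Leaving `D`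
free allows several such sums to run over a common range. -/
theorem coeff_zcoeff_descSeq_mul {a : ℕ → MvPowerSeries σ ℂ} (ha : ∀ j, OrdGE j (a j)) (k : ℤ)
    (F : LSer σ) (m : σ →₀ ℕ) {D : ℕ} (hD : m.degree ≤ D) :
    coeff m (zcoeff k (descSeq a * F)) =
      ∑ j ∈ Finset.range (D + 1), coeff m (a j * zcoeff (k + j) F) := by
  classical
  simp_rw [coeff_mul]
  rw [Finset.sum_comm, coeff_zcoeff, coeff_mul, map_sum]
  refine Finset.sum_congr rfl fun x hx => ?_
  rw [coeff_descSeq, Finset.sum_mul, map_sum]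
  have hxm : x.1.degree ≤ m.degree := by
    rw [← Finset.HasAntidiagonal.mem_antidiagonal.mp hx, map_add]; omega
  have : ∀ j ∈ Finset.range (x.1.degree + 1),
      zc k (single (-(j : ℤ)) (coeff x.1 (a j)) * coeff x.2 F) =
        coeff x.1 (a j) * coeff x.2 (zcoeff (k + j) F) := fun j _ => by
    rw [zc_single_mul, coeff_zcoeff, sub_neg_eq_add]
  rw [Finset.sum_congr rfl this]
  refine Finset.sum_subset (Finset.range_mono (by omega)) fun j _ hj => ?_
  rw [ha j x.1 (by simpa using hj), zero_mul]

theorem IsNeg.descSeq_mul {a : ℕ → MvPowerSeries σ ℂ} (ha : ∀ j, OrdGE j (a j)) {F : LSer σ}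
    (hF : IsNeg F) : IsNeg (descSeq a * F) := fun k hk => by
  ext m
  rw [coeff_zcoeff_descSeq_mul ha k F m le_rfl]
  refine Finset.sum_eq_zero fun j _ => ?_
  rw [hF _ (by omega), mul_zero, map_zero]

theorem descSeq_subst {a : ℕ → MvPowerSeries σ ℂ} (ha : ∀ j, OrdGE j (a j))
    {w : σ → MvPowerSeries τ ℂ} (hw : HasSubst w) (hw0 : ∀ i, OrdGE 1 (w i)) :
    subst (fun i => lift (w i)) (descSeq a) = descSeq fun j => subst w (a j) := by
  refine zcoeff_ext fun k => ?_
  rw [zcoeff_subst hw]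
  rcases lt_or_ge 0 k with hk | hk
  · rw [zcoeff_descSeq_pos _ hk, zcoeff_descSeq_pos _ hk, subst_zero_right hw]
  · obtain ⟨j, rfl⟩ : ∃ j : ℕ, k = -(j : ℤ) := ⟨k.natAbs, by omega⟩
    rw [zcoeff_descSeq_neg ha, zcoeff_descSeq_neg fun j => (ha j).subst hw hw0]

end Laurent

/-! ### Derivatives of matrices of power series -/

section PdMat

variable {σ τ R S : Type*} [CommRing R] [CommRing S] [Algebra R S] {l m n : Type*}

theorem pderiv_comm (i j : σ) (f : MvPowerSeries σ R) :
    pderiv R i (pderiv R j f) = pderiv R j (pderiv R i f) := by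
  classical
  ext n
  simp only [coeff_pderiv, Finsupp.add_apply, Finsupp.single_apply]
  rw [add_right_comm]
  by_cases h : i = j
  · subst h; rfl
  · simp only [h, Ne.symm h, if_false, add_zero]; ring

/-- Entrywise partial derivative. -/
def pdMat (i : σ) (M : Matrix m n (MvPowerSeries σ R)) : Matrix m n (MvPowerSeries σ R) :=
  M.map fun x => pderiv R i x

@[simp]
theorem pdMat_apply (i : σ) (M : Matrix m n (MvPowerSeries σ R)) (a : m) (b : n) :
    pdMat i M a b = pderiv R i (M a b) := rfl

theorem dMat_eq_pdMat {N : ℕ} (α : Fin N) (M : Matrix (Fin N) (Fin N) (Fun N)) :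
    dMat α M = pdMat α M := rfl

theorem pdMat_mul [Fintype m] (i : σ) (M : Matrix l m (MvPowerSeries σ R))
    (M' : Matrix m n (MvPowerSeries σ R)) :
    pdMat i (M * M') = pdMat i M * M' + M * pdMat i M' := by
  ext1 a b
  simp only [pdMat_apply, Matrix.mul_apply, Matrix.add_apply, map_sum, Derivation.leibniz,
    smul_eq_mul, Finset.sum_add_distrib]
  rw [add_comm]
  exact congrArg₂ _ (Finset.sum_congr rfl fun _ _ => mul_comm _ _) rfl

theorem pdMat_add (i : σ) (M M' : Matrix m n (MvPowerSeries σ R)) :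
    pdMat i (M + M') = pdMat i M + pdMat i M' := by ext1 a b; simp

theorem pdMat_sub (i : σ) (M M' : Matrix m n (MvPowerSeries σ R)) :
    pdMat i (M - M') = pdMat i M - pdMat i M' := by ext1 a b; simp

theorem pdMat_one [DecidableEq n] (i : σ) : pdMat i (1 : Matrix n n (MvPowerSeries σ R)) = 0 := by
  ext1 a b
  simp only [pdMat_apply, Matrix.one_apply, Matrix.zero_apply]
  split_ifs <;> simp

theorem pdMat_zero (i : σ) : pdMat i (0 : Matrix m n (MvPowerSeries σ R)) = 0 := by
  ext1 a b; simp

theorem pdMat_comm (i j : σ) (M : Matrix m n (MvPowerSeries σ R)) :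
    pdMat i (pdMat j M) = pdMat j (pdMat i M) := by
  ext1 a b; simp [pderiv_comm i j]

/-- Multiplication of all entries by `z^k`. -/
def zMul (k : ℤ) (M : Matrix m n (LSer σ)) : Matrix m n (LSer σ) := M.map fun x => zpow k * x

@[simp]
theorem zMul_apply (k : ℤ) (M : Matrix m n (LSer σ)) (a : m) (b : n) :
    zMul k M a b = zpow k * M a b := rfl

theorem zMul_mul [Fintype m] (k : ℤ) (M : Matrix l m (LSer σ)) (M' : Matrix m n (LSer σ)) :
    zMul k (M * M') = zMul k M * M' := by
  ext1 a b
  simp only [zMul_apply, Matrix.mul_apply, Finset.mul_sum, mul_assoc]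

theorem mul_zMul [Fintype m] (k : ℤ) (M : Matrix l m (LSer σ)) (M' : Matrix m n (LSer σ)) :
    M * zMul k M' = zMul k (M * M') := by
  ext1 a b
  simp only [zMul_apply, Matrix.mul_apply, Finset.mul_sum, mul_left_comm]

theorem zMul_neg (k : ℤ) (M : Matrix m n (LSer σ)) : zMul k (-M) = -zMul k M := by
  ext1 a b
  exact mul_neg _ _

theorem zMul_sub (k : ℤ) (M M' : Matrix m n (LSer σ)) : zMul k (M - M') = zMul k M - zMul k M' := by
  ext1 a b
  exact mul_sub _ _ _

theorem pdMat_map_lift (i : σ) (M : Matrix m n (MvPowerSeries σ ℂ)) :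
    pdMat i (M.map lift) = (pdMat i M).map lift := by
  ext1 a b; simp [pderiv_lift]

/-- A solution of a linear system `∂_i Y = Y B_i` is determined by its constant term. -/
theorem linear_system_unique {R : Type*} [CommRing R] [NoZeroDivisors R] [CharZero R] [Fintype n]
    (B : σ → Matrix n n (MvPowerSeries σ R)) (Y : Matrix n n (MvPowerSeries σ R))
    (hY : ∀ i, pdMat i Y = Y * B i) (h0 : ∀ a b, constantCoeff (Y a b) = 0) : Y = 0 := by
  have : ∀ k a b, OrdGE k (Y a b) := fun k => by
    induction k with
    | zero => exact fun a b => OrdGE.zero_left _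
    | succ k ih =>
      refine fun a b => ordGE_succ_of_pderiv (h0 a b) fun i => ?_
      have := congrFun (congrFun (hY i) a) b
      rw [pdMat_apply, Matrix.mul_apply] at this
      rw [this]
      exact OrdGE.sum fun c _ => (ih a c).mul_right _
  ext1 a b
  exact eq_of_ordGE_sub fun k => by simpa using this k a b

/-- Substitution in all entries of a matrix. -/
def substMat (a : σ → MvPowerSeries τ S) (M : Matrix m n (MvPowerSeries σ R)) :
    Matrix m n (MvPowerSeries τ S) := M.map fun x => subst a x

@[simp]
theorem substMat_apply (w : σ → MvPowerSeries τ S) (M : Matrix m n (MvPowerSeries σ R)) (a : m)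
    (b : n) : substMat w M a b = subst w (M a b) := rfl

theorem substMat_mul [Fintype m] {w : σ → MvPowerSeries τ S} (hw : HasSubst w)
    (M : Matrix l m (MvPowerSeries σ R)) (M' : Matrix m n (MvPowerSeries σ R)) :
    substMat w (M * M') = substMat w M * substMat w M' := by
  ext1 a b
  simp only [substMat_apply, Matrix.mul_apply, subst_sum_right hw, subst_mul hw]

theorem substMat_one [DecidableEq n] {w : σ → MvPowerSeries τ S} (hw : HasSubst w) :
    substMat w (1 : Matrix n n (MvPowerSeries σ R)) = 1 := by
  ext1 a b
  simp only [substMat_apply, Matrix.one_apply]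
  split_ifs
  · exact subst_one_right hw
  · exact subst_zero_right hw

end PdMat

/-! ### The multiplication matrices of a flat F-manifold -/

section Potential

variable {N : ℕ} {A : Fin N → ℂ} {F : Fin N → Fun N}

/-- The matrix `(c^μ_{γβ})_{μ,β}` of multiplication by `∂/∂t^γ`. -/
def mulMat (F : Fin N → Fun N) (γ : Fin N) : Matrix (Fin N) (Fin N) (Fun N) :=
  Matrix.of fun μ β => structureConst F μ γ β

@[simp]
theorem mulMat_apply (F : Fin N → Fun N) (γ μ β : Fin N) :
    mulMat F γ μ β = structureConst F μ γ β := rfl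

theorem structureConst_comm (F : Fin N → Fun N) (α β γ : Fin N) :
    structureConst F α β γ = structureConst F α γ β := pderiv_comm _ _ _

theorem pdMat_mulMat (F : Fin N → Fun N) (δ γ : Fin N) :
    pdMat δ (mulMat F γ) = pdMat γ (mulMat F δ) := by
  ext1 μ β
  exact pderiv_comm _ _ _

theorem IsVectorPotential.mulMat_comm (hF : IsVectorPotential A F) (β γ : Fin N) :
    mulMat F β * mulMat F γ = mulMat F γ * mulMat F β := by
  ext1 α δ
  simp only [Matrix.mul_apply, mulMat_apply]
  exact hF.assoc α β γ δ

theorem IsVectorPotential.sum_mulMat (hF : IsVectorPotential A F) :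
    ∑ γ, A γ • mulMat F γ = 1 := by
  ext1 α β
  rw [Matrix.sum_apply, Matrix.one_apply]
  exact hF.unit α β

/-! ### Calibrations -/

variable {Om : ℕ → Matrix (Fin N) (Fin N) (Fun N)}

theorem IsCalibration.pdMat_succ (h : IsCalibration F Om) (k : ℕ) (γ : Fin N) :
    pdMat γ (Om (k + 1)) = Om k * mulMat F γ := by
  ext1 α β
  rw [pdMat_apply, h.deriv, Matrix.mul_apply]
  exact Finset.sum_congr rfl fun _ _ => mul_comm _ _

/-- The calibration is based at the origin. -/
def IsBased (Om : ℕ → Matrix (Fin N) (Fin N) (Fun N)) : Prop :=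
  ∀ k α β, constantCoeff (Om (k + 1) α β) = 0

/-- Each matrix has no constant term and its derivatives are linear in the previous matrix, so the
order of vanishing grows by one per step. This growth is what makes `fundSol` a matrix over
`ℂ((z))[[t]]`. -/
theorem IsCalibration.ordGE (h : IsCalibration F Om) (hb : IsBased Om) (k : ℕ) (α β : Fin N) :
    OrdGE k (Om k α β) := by
  induction k generalizing α β with
  | zero => exact OrdGE.zero_left _
  | succ k ih =>
    refine ordGE_succ_of_pderiv (hb k α β) fun γ => ?_
    rw [h.deriv]
    exact OrdGE.sum fun μ _ => (ih α μ).mul_left _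

/-- Repeated integration by the Poincaré lemma. The form `M C_γ dt^γ` is closed because `∂_γ C_δ` is
symmetric in the two indices and the `C_γ` commute, provided `∂_γ M` is itself of the form `M' C_γ`;
this proviso is therefore part of the recursion. All integration constants are taken to be zero. -/
theorem IsVectorPotential.exists_calibration (hF : IsVectorPotential A F) :
    ∃ Om, IsCalibration F Om ∧ IsBased Om := by
  have step : ∀ M : Matrix (Fin N) (Fin N) (Fun N),
      (∃ M', ∀ γ, pdMat γ M = M' * mulMat F γ) →
      ∃ M₁ : Matrix (Fin N) (Fin N) (Fun N), (∀ α β, constantCoeff (M₁ α β) = 0) ∧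
        ∀ γ, pdMat γ M₁ = M * mulMat F γ := by
    rintro M ⟨M', hM⟩
    have hc : ∀ γ δ, pdMat γ (M * mulMat F δ) = pdMat δ (M * mulMat F γ) := fun γ δ => by
      rw [pdMat_mul, pdMat_mul, hM, hM, pdMat_mulMat F γ δ, Matrix.mul_assoc, Matrix.mul_assoc,
        hF.mulMat_comm]
    have : ∀ α β, ∃ φ : Fun N, constantCoeff φ = 0 ∧
        ∀ γ, pderiv ℂ γ φ = (M * mulMat F γ) α β := fun α β =>
      exists_pderiv_eq _ fun γ δ => congrFun (congrFun (hc γ δ) α) β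
    choose φ hφ0 hφ using this
    exact ⟨Matrix.of φ, hφ0, fun γ => by ext1 α β; exact hφ α β γ⟩
  choose f hf0 hf using step
  let s : ℕ → {M : Matrix (Fin N) (Fin N) (Fun N) // ∃ M', ∀ γ, pdMat γ M = M' * mulMat F γ} :=
    fun k => Nat.rec ⟨1, 0, fun γ => by rw [pdMat_one, Matrix.zero_mul]⟩
      (fun _ M => ⟨f M.1 M.2, M.1, hf M.1 M.2⟩) k
  refine ⟨fun k => (s k).1, ⟨rfl, fun k α β γ => ?_⟩, fun k α β => hf0 (s k).1 (s k).2 α β⟩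
  have := congrFun (congrFun (hf (s k).1 (s k).2 γ) α) β
  rw [pdMat_apply, Matrix.mul_apply] at this
  exact this.trans (Finset.sum_congr rfl fun _ _ => mul_comm _ _)

/-- The gradient of the left side is given by the unit axiom. This identity later cancels the
dilaton shift in the hodograph equation. -/
theorem IsCalibration.one_mulVec (hF : IsVectorPotential A F) (h : IsCalibration F Om)
    (h0 : ∀ α, constantCoeff (∑ β, A β • Om 1 α β) = 0) (α : Fin N) :
    ∑ β, A β • Om 1 α β = X α := by
  refine pderiv.ext (fun γ => ?_) (by rw [h0, constantCoeff_X])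
  rw [map_sum]
  simp only [Derivation.map_smul, h.deriv 0, h.zero, Matrix.one_apply, mul_ite, mul_one, mul_zero,
    Finset.sum_ite_eq, Finset.mem_univ, if_true]
  simp_rw [structureConst_comm F α γ, hF.unit α γ]
  rw [pderiv_X]
  simp [Pi.single_apply]

theorem IsCalibration.sum_antidiagonal (h : IsCalibration F Om) (n : ℕ) :
    ∑ x ∈ Finset.HasAntidiagonal.antidiagonal n, (-1) ^ x.2 * (Om x.1 * lowerOm Om x.2) =
      if n = 0 then 1 else 0 := by
  have e := PowerSeries.mul_invOfUnit (PowerSeries.mk Om) 1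
    (by rw [← PowerSeries.coeff_zero_eq_constantCoeff_apply, PowerSeries.coeff_mk, h.zero]; rfl)
  have e := congrArg (PowerSeries.coeff n) e
  rw [PowerSeries.coeff_mul, PowerSeries.coeff_one] at e
  rw [← e]
  refine Finset.sum_congr rfl fun x _ => ?_
  have hc : ∀ M : Matrix (Fin N) (Fin N) (Fun N), Commute ((-1) ^ x.2) M :=
    fun M => (Commute.neg_one_left M).pow_left _
  rw [PowerSeries.coeff_mk, lowerOm, ← mul_assoc, ← mul_assoc, mul_assoc _ (Om x.1),
    ← ((hc (Om x.1)).eq), ← mul_assoc, ← pow_add, ← two_mul, pow_mul, neg_one_sq, one_pow, one_mul]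

theorem IsCalibration.lowerOm_zero (h : IsCalibration F Om) : lowerOm Om 0 = 1 := by
  have := h.sum_antidiagonal 0
  simpa [h.zero] using this

/-- The recursion for the inverse series, read in degree `d + 1`: the two meanings of `Ω^0_d` agree.
-/
theorem IsCalibration.lowerOm_succ (h : IsCalibration F Om) (d : ℕ) :
    lowerOm Om (d + 1) = biOm Om 0 d := by
  have : ∑ i ∈ Finset.range (d + 2), (-1) ^ i * (Om (d + 1 - i) * lowerOm Om i) = 0 := by
    have := h.sum_antidiagonal (d + 1)
    rwa [if_neg d.succ_ne_zero, Finset.Nat.antidiagonal_eq_map', Finset.sum_map] at this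
  rw [Finset.sum_range_succ, Nat.sub_self, h.zero, one_mul] at this
  have h2 := congrArg (fun M => (-1) ^ (d + 1) * M) (eq_neg_of_add_eq_zero_right this)
  rw [← mul_assoc, ← pow_add, ← two_mul, pow_mul, neg_one_sq, one_pow, one_mul] at h2
  rw [h2, biOm, ← Finset.sum_neg_distrib, Finset.mul_sum]
  refine Finset.sum_congr rfl fun i hi => ?_
  have hi : i ≤ d := by simpa [Nat.lt_succ_iff] using hi
  obtain ⟨e, rfl⟩ := Nat.exists_eq_add_of_le hi
  rw [show i + e - i = e by omega, show i + e + 1 - i = 0 + (i + e) - i + 1 by omega, mul_neg,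
    ← mul_assoc, ← pow_add, show i + e + 1 + i = e + 1 + 2 * i by omega, pow_add, pow_mul]
  simp [pow_succ]

theorem IsCalibration.lowerOm_one (h : IsCalibration F Om) : lowerOm Om 1 = Om 1 := by
  rw [h.lowerOm_succ 0, biOm]
  simp [h.lowerOm_zero]

theorem ordGE_neg_one_pow_mul {k : ℕ} (e : ℕ) {M : Matrix (Fin N) (Fin N) (Fun N)}
    (hM : ∀ α β, OrdGE k (M α β)) (α β : Fin N) : OrdGE k (((-1) ^ e * M) α β) := by
  rcases neg_one_pow_eq_or (Matrix (Fin N) (Fin N) (Fun N)) e with h | h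
  · simpa [h] using hM α β
  · simpa [h] using (hM α β).neg

theorem ordGE_matrix_mul {k l : ℕ} {M M' : Matrix (Fin N) (Fin N) (Fun N)}
    (hM : ∀ α β, OrdGE k (M α β)) (hM' : ∀ α β, OrdGE l (M' α β)) (α β : Fin N) :
    OrdGE (k + l) ((M * M') α β) := by
  rw [Matrix.mul_apply]
  exact OrdGE.sum fun μ _ => (hM α μ).mul (hM' μ β)

theorem IsCalibration.ordGE_lowerOm (h : IsCalibration F Om) (hb : IsBased Om) (k : ℕ)
    (α β : Fin N) : OrdGE k (lowerOm Om k α β) := by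
  induction k using Nat.strong_induction_on generalizing α β with
  | _ k ih =>
    cases k with
    | zero => exact OrdGE.zero_left _
    | succ d =>
      rw [h.lowerOm_succ, biOm, Matrix.sum_apply]
      refine OrdGE.sum fun i hi => ?_
      have hi : i < d + 1 := by simpa using hi
      refine ordGE_neg_one_pow_mul _ (fun α β => ?_) α β
      exact (ordGE_matrix_mul (h.ordGE hb _) (fun α β => ih i hi α β) α β).mono (by omega)

theorem IsCalibration.ordGE_biOm (h : IsCalibration F Om) (hb : IsBased Om) (p q : ℕ)
    (α β : Fin N) : OrdGE (p + q + 1) (biOm Om p q α β) := by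
  rw [biOm, Matrix.sum_apply]
  refine OrdGE.sum fun i hi => ?_
  have hi : i < q + 1 := by simpa using hi
  refine ordGE_neg_one_pow_mul _ (fun α β => ?_) α β
  exact (ordGE_matrix_mul (h.ordGE hb _) (h.ordGE_lowerOm hb i) α β).mono (by omega)

/-! ### The fundamental solution -/

/-- The matrix `∑_j (-1)^j Ω^{j-1}_0 z^{-j}`. -/
def fundSol (Om : ℕ → Matrix (Fin N) (Fin N) (Fun N)) : Matrix (Fin N) (Fin N) (LSer (Fin N)) :=
  Matrix.of fun α β => descSeq fun j => (-1) ^ j * Om j α β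

/-- The matrix `∑_j Ω^0_{j-1} z^{-j}`, the inverse of the fundamental solution. -/
def fundInv (Om : ℕ → Matrix (Fin N) (Fin N) (Fun N)) : Matrix (Fin N) (Fin N) (LSer (Fin N)) :=
  Matrix.of fun α β => descSeq fun j => lowerOm Om j α β

theorem OrdGE.neg_one_pow_mul {σ R : Type*} [CommRing R] {k : ℕ} {f : MvPowerSeries σ R}
    (hf : OrdGE k f) (e : ℕ) :
    OrdGE k ((-1) ^ e * f) := hf.mul_left _

theorem IsCalibration.ordGE_signed (h : IsCalibration F Om) (hb : IsBased Om) (α β : Fin N)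
    (j : ℕ) : OrdGE j ((-1) ^ j * Om j α β) := (h.ordGE hb j α β).neg_one_pow_mul j

theorem IsCalibration.constantCoeff_fundSol (h : IsCalibration F Om) (α β : Fin N) :
    constantCoeff (fundSol Om α β) = if α = β then 1 else 0 := by
  rw [← coeff_zero_eq_constantCoeff_apply, fundSol, Matrix.of_apply, coeff_descSeq]
  rw [map_zero, zero_add, Finset.sum_range_one, h.zero, Matrix.one_apply, Nat.cast_zero,
    neg_zero, ← LaurentZ.const_eq_single]
  split_ifs <;> simp

/-- All the calibration equations at once, one for each negative power of `z`; at `z^0` both sides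
vanish since the leading term is the constant identity. -/
theorem IsCalibration.pdMat_fundSol (h : IsCalibration F Om) (hb : IsBased Om) (γ : Fin N) :
    pdMat γ (fundSol Om) = -zMul (-1) (fundSol Om * (mulMat F γ).map lift) := by
  ext1 α β
  rw [pdMat_apply, Matrix.neg_apply, zMul_apply, Matrix.mul_apply]
  refine zcoeff_ext fun k => ?_
  rw [zcoeff_pderiv, map_neg, zcoeff_zpow_mul, map_sum]
  simp only [Matrix.map_apply, zcoeff_mul_lift, fundSol, Matrix.of_apply, sub_neg_eq_add]
  rcases lt_trichotomy k 0 with hk | rfl | hk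
  · obtain ⟨j, rfl⟩ : ∃ j : ℕ, k = -((j + 1 : ℕ) : ℤ) := ⟨k.natAbs - 1, by omega⟩
    rw [show -((j + 1 : ℕ) : ℤ) + 1 = -(j : ℤ) by push_cast; ring]
    simp only [zcoeff_descSeq_neg (h.ordGE_signed hb _ _)]
    have e : ((-1) ^ (j + 1) : Fun N) = C ((-1) ^ (j + 1)) := by simp
    rw [e, Derivation.leibniz, pderiv_C, smul_zero, add_zero, h.deriv, ← e, smul_eq_mul,
      Finset.mul_sum, ← Finset.sum_neg_distrib]
    exact Finset.sum_congr rfl fun μ _ => by rw [mulMat_apply]; ring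
  · have := zcoeff_descSeq_neg (h.ordGE_signed hb α β) 0
    rw [Nat.cast_zero, neg_zero] at this
    rw [this, Finset.sum_eq_zero]
    · rw [h.zero, Matrix.one_apply]; split_ifs <;> simp
    · intro μ _; rw [zcoeff_descSeq_pos _ (by omega), zero_mul]
  · rw [zcoeff_descSeq_pos _ hk, Finset.sum_eq_zero]
    · simp
    · intro μ _; rw [zcoeff_descSeq_pos _ (by omega), zero_mul]

/-- The coefficient of `z^{-p}` is, up to the sign `(-1)^p`, the degree `p` part of the relation
defining the matrices `Ω^0_{k-1}`. -/
theorem IsCalibration.fundSol_mul_fundInv (h : IsCalibration F Om) (hb : IsBased Om) :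
    fundSol Om * fundInv Om = 1 := by
  ext1 α β
  rw [Matrix.mul_apply]
  refine zcoeff_ext fun k => ?_
  ext m
  have h1 : zcoeff k ((1 : Matrix (Fin N) (Fin N) (LSer (Fin N))) α β) =
      if k = 0 then (1 : Matrix (Fin N) (Fin N) (Fun N)) α β else 0 := by
    rw [← zcoeff_lift, Matrix.one_apply, Matrix.one_apply]; split_ifs <;> simp
  rw [h1, map_sum, map_sum]
  simp only [fundSol, fundInv, Matrix.of_apply]
  have hL : ∀ μ (j : ℕ), OrdGE j (lowerOm Om j μ β) := fun μ j => h.ordGE_lowerOm hb j μ β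
  -- The range has to contain all indices visible in the degree of `m` as well as the index `p =
  -- -k`.
  simp_rw [coeff_zcoeff_descSeq_mul (h.ordGE_signed hb α _) k _ m
    (le_max_left m.degree k.natAbs)]
  rcases lt_or_ge 0 k with hk | hk
  · rw [if_neg hk.ne', map_zero]
    refine Finset.sum_eq_zero fun μ _ => Finset.sum_eq_zero fun j _ => ?_
    rw [zcoeff_descSeq_pos _ (by omega), mul_zero, map_zero]
  · obtain ⟨p, rfl⟩ : ∃ p : ℕ, k = -(p : ℤ) := ⟨k.natAbs, by omega⟩
    have hs : ∀ μ, ∑ j ∈ Finset.range (max m.degree (-(p : ℤ)).natAbs + 1),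
        coeff m ((-1) ^ j * Om j α μ *
          zcoeff (-(p : ℤ) + j) (descSeq fun j => lowerOm Om j μ β)) =
        ∑ j ∈ Finset.range (p + 1), coeff m ((-1) ^ j * Om j α μ * lowerOm Om (p - j) μ β) := by
      intro μ
      symm
      have hsub : Finset.range (p + 1) ⊆ Finset.range (max m.degree (-(p : ℤ)).natAbs + 1) :=
        Finset.range_mono (by omega)
      rw [← Finset.sum_subset hsub]
      · refine Finset.sum_congr rfl fun j hj => ?_
        have hj : j < p + 1 := by simpa using hj
        rw [show -(p : ℤ) + j = -((p - j : ℕ) : ℤ) by omega, zcoeff_descSeq_neg (hL μ)]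
      · intro j _ hj
        have hj : p + 1 ≤ j := by simpa using hj
        rw [zcoeff_descSeq_pos _ (by omega), mul_zero, map_zero]
    rw [Finset.sum_congr rfl fun μ _ => hs μ, Finset.sum_comm]
    simp_rw [← map_sum]
    congr 1
    have hp : ∑ j ∈ Finset.range (p + 1), (-1) ^ (p - j) * (Om j * lowerOm Om (p - j)) =
        if p = 0 then 1 else 0 := by
      have := h.sum_antidiagonal p
      rwa [Finset.Nat.antidiagonal_eq_map, Finset.sum_map] at this
    have hp := congrArg (fun M : Matrix (Fin N) (Fin N) (Fun N) => (-1) ^ p * M) hp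
    have := congrFun (congrFun hp α) β
    rw [Finset.mul_sum, Matrix.sum_apply] at this
    have hr : ((-1) ^ p * (if p = 0 then 1 else 0) : Matrix (Fin N) (Fin N) (Fun N)) α β =
        if -(p : ℤ) = 0 then (1 : Matrix (Fin N) (Fin N) (Fun N)) α β else 0 := by
      by_cases hp : p = 0
      · simp [hp]
      · simp [hp]
    rw [hr] at this
    rw [← this]
    refine Finset.sum_congr rfl fun j hj => ?_
    have hj : j < p + 1 := by simpa using hj
    rw [← mul_assoc, ← pow_add, show p + (p - j) = j + 2 * (p - j) by omega, pow_add, pow_mul]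
    have hsgn : ∀ M : Matrix (Fin N) (Fin N) (Fun N),
        ((-1 : Matrix (Fin N) (Fin N) (Fun N)) ^ j * M) α β = (-1) ^ j * M α β := fun M => by
      rcases Nat.even_or_odd j with hj | hj <;> simp [hj.neg_one_pow]
    simp only [even_two, Even.neg_pow, one_pow, mul_one]
    rw [hsgn, Matrix.mul_apply, Finset.mul_sum]
    exact Finset.sum_congr rfl fun _ _ => mul_assoc _ _ _

theorem IsCalibration.fundInv_mul_fundSol (h : IsCalibration F Om) (hb : IsBased Om) :
    fundInv Om * fundSol Om = 1 := mul_eq_one_comm.mp (h.fundSol_mul_fundInv hb)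

theorem IsCalibration.pdMat_fundInv (h : IsCalibration F Om) (hb : IsBased Om) (γ : Fin N) :
    pdMat γ (fundInv Om) = zMul (-1) ((mulMat F γ).map lift * fundInv Om) := by
  have e := congrArg (pdMat γ) (h.fundSol_mul_fundInv hb)
  rw [pdMat_mul, pdMat_one, h.pdMat_fundSol hb, Matrix.neg_mul, neg_add_eq_zero] at e
  have e := congrArg (fun M => fundInv Om * M) e
  rw [← Matrix.mul_assoc (fundInv Om) (fundSol Om), h.fundInv_mul_fundSol hb, Matrix.one_mul,
    ← zMul_mul, mul_zMul, Matrix.mul_assoc (fundSol Om), ← Matrix.mul_assoc (fundInv Om),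
    h.fundInv_mul_fundSol hb, Matrix.one_mul] at e
  exact e.symm

/-- Multiplication is from the left here, unlike in the calibration equation: compare coefficients
in `d(T⁻¹) = z⁻¹ C T⁻¹`. -/
theorem IsCalibration.pdMat_lowerOm_succ (h : IsCalibration F Om) (hb : IsBased Om) (k : ℕ)
    (γ : Fin N) : pdMat γ (lowerOm Om (k + 1)) = mulMat F γ * lowerOm Om k := by
  ext1 α β
  have e := congrArg (zcoeff (-((k + 1 : ℕ) : ℤ))) (congrFun (congrFun (h.pdMat_fundInv hb γ) α) β)
  have hL : ∀ μ (j : ℕ), OrdGE j (lowerOm Om j μ β) := fun μ j => h.ordGE_lowerOm hb j μ β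
  rw [pdMat_apply, zcoeff_pderiv, zMul_apply, zcoeff_zpow_mul,
    Matrix.mul_apply, map_sum] at e
  simp only [fundInv, Matrix.of_apply, Matrix.map_apply, zcoeff_lift_mul] at e
  rw [zcoeff_descSeq_neg (hL α), show -((k + 1 : ℕ) : ℤ) - -1 = -(k : ℤ) by push_cast; ring] at e
  simp only [zcoeff_descSeq_neg (hL _)] at e
  rw [pdMat_apply, e, Matrix.mul_apply]

end Potential

/-! ### Infinite sums `∑ G_i X_i` -/

section XSum

variable {σ τ R : Type*} [CommRing R]

/-- The sum `∑_i G_i X_i`, computed coefficientwise. -/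
def xSum (G : σ → MvPowerSeries σ R) : MvPowerSeries σ R :=
  fun m => ∑ i ∈ m.support, coeff (m - Finsupp.single i 1) (G i)

theorem coeff_mul_X [DecidableEq σ] (f : MvPowerSeries σ R) (i : σ) (m : σ →₀ ℕ) :
    coeff m (f * X i) = if i ∈ m.support then coeff (m - Finsupp.single i 1) f else 0 := by
  rw [X, coeff_mul_monomial, mul_one]
  simp [Finsupp.single_le_iff, Nat.one_le_iff_ne_zero]

theorem coeff_xSum (G : σ → MvPowerSeries σ R) (m : σ →₀ ℕ) {s : Finset σ} (hs : m.support ⊆ s) :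
    coeff m (xSum G) = coeff m (∑ i ∈ s, G i * X i) := by
  classical
  rw [map_sum]
  simp_rw [coeff_mul_X]
  rw [← Finset.sum_filter, Finset.filter_mem_eq_inter, Finset.inter_eq_right.mpr hs]
  rfl

theorem xSum_sub (G G' : σ → MvPowerSeries σ R) :
    xSum (fun i => G i - G' i) = xSum G - xSum G' := by
  ext m
  simp only [map_sub, coeff_xSum _ m subset_rfl, sub_mul, Finset.sum_sub_distrib]

theorem xSum_finsetSum {ι : Type*} (s : Finset ι) (G : ι → σ → MvPowerSeries σ R) :
    xSum (fun i => ∑ k ∈ s, G k i) = ∑ k ∈ s, xSum (G k) := by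
  ext m
  rw [map_sum]
  simp only [coeff_xSum _ m subset_rfl, Finset.sum_mul]
  rw [Finset.sum_comm, map_sum]

theorem mul_xSum (g : MvPowerSeries σ R) (G : σ → MvPowerSeries σ R) :
    g * xSum G = xSum fun i => g * G i := by
  classical
  ext m
  rw [coeff_xSum _ m subset_rfl, coeff_mul]
  simp_rw [mul_assoc]
  rw [← Finset.mul_sum, coeff_mul]
  refine Finset.sum_congr rfl fun x hx => ?_
  rw [coeff_xSum]
  rw [← Finset.HasAntidiagonal.mem_antidiagonal.mp hx]
  exact Finsupp.support_mono (by simp)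

theorem pderiv_xSum (j : σ) (G : σ → MvPowerSeries σ R) :
    pderiv R j (xSum G) = G j + xSum fun i => pderiv R j (G i) := by
  classical
  ext m
  have hs : m.support ⊆ insert j m.support := Finset.subset_insert _ _
  have hs' : (m + Finsupp.single j 1).support ⊆ insert j m.support := fun i hi => by
    by_contra hc
    simp only [Finset.mem_insert, Finsupp.mem_support_iff, not_or, not_not] at hc
    simp [hc.2, Ne.symm hc.1] at hi
  rw [coeff_pderiv, coeff_xSum _ _ hs', ← coeff_pderiv, map_sum, map_add, coeff_xSum _ _ hs,
    ← map_add]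
  congr 1
  simp only [Derivation.leibniz, smul_eq_mul, Finset.sum_add_distrib]
  congr 1
  · rw [Finset.sum_eq_single j]
    · simp
    · intro i _ hi; rw [pderiv_X_of_ne hi, mul_zero]
    · simp
  · exact Finset.sum_congr rfl fun _ _ => mul_comm _ _

theorem OrdGE.xSum {k : ℕ} {G : σ → MvPowerSeries σ R} (hG : ∀ i, OrdGE k (G i)) :
    OrdGE (k + 1) (xSum G) := fun m hm => by
  rw [coeff_xSum _ m subset_rfl]
  exact OrdGE.sum (fun i _ => (hG i).mul (ordGE_one_iff.mpr (constantCoeff_X i))) m hm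

/-! ### Weights of monomials -/

/-- All monomials of `f` have weight at most `c`. -/
def WtLE (w : σ → ℤ) (c : ℤ) (f : MvPowerSeries σ R) : Prop :=
  ∀ n : σ →₀ ℕ, c < Finsupp.weight w n → coeff n f = 0

variable {w : σ → ℤ}

theorem WtLE.mono {c d : ℤ} {f : MvPowerSeries σ R} (h : WtLE w c f) (hcd : c ≤ d) : WtLE w d f :=
  fun n hn => h n (by omega)

theorem WtLE.add {c : ℤ} {f g : MvPowerSeries σ R} (hf : WtLE w c f) (hg : WtLE w c g) :
    WtLE w c (f + g) := fun n hn => by rw [map_add, hf n hn, hg n hn, add_zero]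

theorem WtLE.sub {c : ℤ} {f g : MvPowerSeries σ R} (hf : WtLE w c f) (hg : WtLE w c g) :
    WtLE w c (f - g) := fun n hn => by rw [map_sub, hf n hn, hg n hn, sub_zero]

theorem WtLE.sum {ι : Type*} {c : ℤ} {s : Finset ι} {f : ι → MvPowerSeries σ R}
    (hf : ∀ i ∈ s, WtLE w c (f i)) : WtLE w c (∑ i ∈ s, f i) :=
  fun n hn => by rw [map_sum, Finset.sum_eq_zero fun i hi => hf i hi n hn]

theorem WtLE.smul {c : ℤ} {f : MvPowerSeries σ R} (hf : WtLE w c f) (r : R) : WtLE w c (r • f) :=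
  fun n hn => by rw [coeff_smul, hf n hn, mul_zero]

theorem WtLE.mul {c d : ℤ} {f g : MvPowerSeries σ R} (hf : WtLE w c f) (hg : WtLE w d g) :
    WtLE w (c + d) (f * g) := fun n hn => by
  classical
  rw [coeff_mul]
  refine Finset.sum_eq_zero fun x hx => ?_
  rw [← Finset.HasAntidiagonal.mem_antidiagonal.mp hx, map_add] at hn
  by_cases h : c < Finsupp.weight w x.1
  · rw [hf _ h, zero_mul]
  · rw [hg _ (by omega), mul_zero]

theorem WtLE.one : WtLE w 0 (1 : MvPowerSeries σ R) := fun n hn => by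
  classical
  rw [coeff_one, if_neg]
  rintro rfl
  simp at hn

theorem WtLE.X (i : σ) : WtLE w (w i) (X i : MvPowerSeries σ R) := fun n hn => by
  classical
  rw [coeff_X, if_neg]
  rintro rfl
  rw [Finsupp.weight_apply, Finsupp.sum_single_index (by simp), one_smul] at hn
  exact lt_irrefl _ hn

theorem WtLE.pow {c : ℤ} {f : MvPowerSeries σ R} (hf : WtLE w c f) (n : ℕ) :
    WtLE w (n * c) (f ^ n) := by
  induction n with
  | zero => simpa using WtLE.one
  | succ n ih => rw [pow_succ]; push_cast; rw [add_mul, one_mul]; exact ih.mul hf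

theorem WtLE.prod {c : ℤ} {a : τ → MvPowerSeries σ R} (ha : ∀ i, WtLE w c (a i)) (n : τ →₀ ℕ) :
    WtLE w (n.degree * c) (n.prod fun i k => a i ^ k) := by
  classical
  rw [Finsupp.prod, Finsupp.degree_apply]
  induction n.support using Finset.induction_on with
  | empty => simpa using WtLE.one
  | insert i s hi ih =>
    rw [Finset.prod_insert hi, Finset.sum_insert hi]
    push_cast at ih ⊢
    rw [add_mul]
    exact ((ha i).pow (n i)).mul ih

theorem WtLE.xSum {c : ℤ} {G : σ → MvPowerSeries σ R} (hG : ∀ i, WtLE w (c - w i) (G i)) :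
    WtLE w c (xSum G) := fun m hm => by
  rw [coeff_xSum _ m subset_rfl]
  refine WtLE.sum (fun i _ => ?_) m hm
  simpa using (hG i).mul (WtLE.X i)

/-- A product of at least `k` series of weight at most `-1` has weight at most `-k`. -/
theorem WtLE.subst {k : ℕ} {f : MvPowerSeries τ R} (hf : OrdGE k f) {a : τ → MvPowerSeries σ R}
    (ha : HasSubst a) (haw : ∀ i, WtLE w (-1) (a i)) :
    WtLE w (-k) (MvPowerSeries.subst a f) := fun m hm => by
  rw [coeff_subst ha]
  refine finsum_eq_zero_of_forall_eq_zero fun n => ?_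
  by_cases hn : n.degree < k
  · rw [hf n hn, zero_smul]
  · rw [WtLE.prod haw n m (by omega), smul_zero]

end XSum

/-! ### Commutative multiplications -/

section Mult

variable {n S : Type*} [Fintype n] [DecidableEq n] [CommRing S]

/-- Matrices `C_γ` of multiplication by basis vectors in a commutative associative algebra with
unit `a`. -/
structure IsCommMult (a : n → S) (Cm : n → Matrix n n S) : Prop where
  symm : ∀ γ μ β, Cm γ μ β = Cm β μ γ
  comm : ∀ γ δ, Cm γ * Cm δ = Cm δ * Cm γ
  unit : ∑ γ, a γ • Cm γ = 1

/-- The matrix of multiplication by the vector `x`. -/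
def multBy (Cm : n → Matrix n n S) (x : n → S) : Matrix n n S := ∑ γ, x γ • Cm γ

variable {a : n → S} {Cm : n → Matrix n n S}

omit [Fintype n] [DecidableEq n] in
theorem multBy_apply [Fintype n] (Cm : n → Matrix n n S) (x : n → S) (α β : n) :
    multBy Cm x α β = ∑ γ, x γ * Cm γ α β := by
  simp [multBy, Matrix.sum_apply]

omit [DecidableEq n] in
theorem multBy_add (x y : n → S) : multBy Cm (x + y) = multBy Cm x + multBy Cm y := by
  simp [multBy, add_smul, Finset.sum_add_distrib]

theorem IsCommMult.multBy_mulVec_comm (h : IsCommMult a Cm) (x y : n → S) :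
    (multBy Cm x).mulVec y = (multBy Cm y).mulVec x := by
  ext α
  simp only [Matrix.mulVec, dotProduct, multBy_apply, Finset.sum_mul]
  rw [Finset.sum_comm]
  refine Finset.sum_congr rfl fun γ _ => Finset.sum_congr rfl fun δ _ => ?_
  rw [h.symm δ α γ]; ring

/-- Associativity of the product. For a basis vector on the left it follows from the symmetry of the
structure constants and the commutation of the multiplication matrices; the general case is linear.
-/
theorem IsCommMult.multBy_mulVec (h : IsCommMult a Cm) (x y : n → S) :
    multBy Cm ((multBy Cm x).mulVec y) = multBy Cm x * multBy Cm y := by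
  have key : ∀ γ, multBy Cm ((Cm γ).mulVec y) = Cm γ * multBy Cm y := fun γ => by
    ext α δ
    simp only [multBy_apply, Matrix.mul_apply, Matrix.mulVec, dotProduct, Finset.mul_sum,
      Finset.sum_mul]
    rw [Finset.sum_comm]
    conv_rhs => rw [Finset.sum_comm]
    refine Finset.sum_congr rfl fun β _ => ?_
    have e := congrFun (congrFun (h.comm δ γ) α) β
    simp only [Matrix.mul_apply] at e
    calc ∑ μ, Cm γ μ β * y β * Cm μ α δ = y β * ∑ μ, Cm δ α μ * Cm γ μ β := by
          rw [Finset.mul_sum]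
          exact Finset.sum_congr rfl fun μ _ => by rw [h.symm μ α δ]; ring
      _ = _ := by
          rw [e, Finset.mul_sum]
          exact Finset.sum_congr rfl fun μ _ => by rw [h.symm δ μ β]; ring
  have e : (multBy Cm x).mulVec y = ∑ γ, x γ • (Cm γ).mulVec y := by
    rw [multBy, Matrix.sum_mulVec]
    simp only [Matrix.smul_mulVec]
  have lin : ∀ z : n → n → S, multBy Cm (∑ γ, x γ • z γ) = ∑ γ, x γ • multBy Cm (z γ) := fun z => by
    ext α β
    simp only [multBy_apply, Matrix.sum_apply, Matrix.smul_apply, Finset.sum_apply, Pi.smul_apply,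
      smul_eq_mul, Finset.mul_sum, Finset.sum_mul]
    rw [Finset.sum_comm]
    exact Finset.sum_congr rfl fun _ _ => Finset.sum_congr rfl fun _ _ => by ring
  rw [e, lin]
  simp only [key]
  change _ = (∑ γ, x γ • Cm γ) * multBy Cm y
  rw [Finset.sum_mul]
  simp only [Matrix.smul_mul]

theorem IsCommMult.multBy_unit (h : IsCommMult a Cm) : multBy Cm a = 1 := h.unit

theorem IsCommMult.multBy_mulVec_unit (h : IsCommMult a Cm) (x : n → S) :
    (multBy Cm x).mulVec a = x := by
  rw [h.multBy_mulVec_comm, h.multBy_unit, Matrix.one_mulVec]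

theorem IsVectorPotential.isCommMult {N : ℕ} {A : Fin N → ℂ} {F : Fin N → Fun N}
    (hF : IsVectorPotential A F) : IsCommMult (fun α => C (A α)) (mulMat F) where
  symm γ μ β := structureConst_comm F μ γ β
  comm := hF.mulMat_comm
  unit := by
    rw [← hF.sum_mulMat]
    refine Finset.sum_congr rfl fun γ _ => ?_
    ext1 α β
    simp [MvPowerSeries.smul_eq_C_mul]

theorem IsCommMult.subst {N : ℕ} {τ : Type*} {A : Fin N → ℂ} {Cm : Fin N → Matrix (Fin N) (Fin N) (Fun N)}
    (h : IsCommMult (fun α => C (A α)) Cm) {v : Fin N → MvPowerSeries τ ℂ} (hv : HasSubst v) :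
    IsCommMult (fun α => C (A α)) fun γ => substMat v (Cm γ) where
  symm γ μ β := congrArg (MvPowerSeries.subst v) (h.symm γ μ β)
  comm γ δ := by rw [← substMat_mul hv, ← substMat_mul hv, h.comm γ δ]
  unit := by
    rw [← substMat_one (R := ℂ) hv, ← h.unit]
    ext1 α β
    simp only [Matrix.sum_apply, Matrix.smul_apply, substMat_apply, smul_eq_mul,
      subst_sum_right hv, subst_mul hv, subst_C]

end Mult

/-! ### The principal hierarchy -/

section Hierarchy

variable {N : ℕ} {A : Fin N → ℂ} {F : Fin N → Fun N}
  {Om : ℕ → Matrix (Fin N) (Fin N) (Fun N)} {v : Fin N → BigFun N}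

theorem constantCoeff_subst_of_ordGE {σ τ R S : Type*} [Finite σ] [CommRing R] [CommRing S]
    [Algebra R S] {a : σ → MvPowerSeries τ S} (ha : ∀ i, OrdGE 1 (a i)) (f : MvPowerSeries σ R) :
    constantCoeff (subst a f) = algebraMap R S (constantCoeff f) := by
  have hs := hasSubst_of_ordGE ha
  have h1 : OrdGE 1 (subst a (f - C (constantCoeff f))) :=
    OrdGE.subst (ordGE_one_iff.mpr (by simp)) hs ha
  have h2 : subst a (C (constantCoeff f) : MvPowerSeries σ R) =
      C (algebraMap R S (constantCoeff f)) := by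
    rw [← substAlgHom_apply hs]
    have := (substAlgHom hs).commutes (constantCoeff f)
    simpa [MvPowerSeries.algebraMap_apply] using this
  rw [ordGE_one_iff, subst_sub hs, map_sub, sub_eq_zero, h2, constantCoeff_C] at h1
  exact h1

/-- Separates the infinite sum over the variables from the dilaton shift, which only affects `b =
1`. -/
theorem descendantPotential_eq (a : ℕ) (α : Fin N) :
    descendantPotential A Om v a α =
      xSum (fun i : Fin N × ℕ => subst v (biOm Om a i.2 α i.1)) -
        ∑ β, A β • subst v (biOm Om a 1 α β) := by
  classical
  ext m
  change ∑ᶠ i : Fin N × ℕ, _ = _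
  have e : ∀ i : Fin N × ℕ, coeff m (subst v (biOm Om a i.2 α i.1) * qVar A i.1 i.2) =
      coeff m (subst v (biOm Om a i.2 α i.1) * X i) -
        if i.2 = 1 then A i.1 * coeff m (subst v (biOm Om a 1 α i.1)) else 0 := fun i => by
    rw [qVar, mul_sub, map_sub]
    congr 1
    split_ifs with h
    · rw [h, mul_comm, coeff_C_mul]
    · simp
  simp_rw [e]
  have hs1 : (Function.support fun i : Fin N × ℕ =>
      coeff m (subst v (biOm Om a i.2 α i.1) * X i)) ⊆ m.support := fun i hi => by
    by_contra hc
    exact hi ((coeff_mul_X _ i m).trans (if_neg hc))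
  have hs2 : (Function.support fun i : Fin N × ℕ =>
      if i.2 = 1 then A i.1 * coeff m (subst v (biOm Om a 1 α i.1)) else 0) ⊆
      (Finset.univ ×ˢ {1} : Finset (Fin N × ℕ)) := fun i hi => by
    by_contra hc
    exact hi (if_neg fun h => hc (Finset.mem_coe.mpr
      (Finset.mem_product.mpr ⟨Finset.mem_univ _, Finset.mem_singleton.mpr h⟩)))
  rw [finsum_sub_distrib (m.support.finite_toSet.subset hs1)
    ((Finset.finite_toSet _).subset hs2), finsum_eq_sum_of_support_subset _ hs1,
    finsum_eq_sum_of_support_subset _ hs2, map_sub, coeff_xSum _ m subset_rfl, map_sum, map_sum,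
    Finset.sum_product]
  congr 1
  exact Finset.sum_congr rfl fun β _ => by simp

/-- `∑_b L_b(v) t_b`, where `L_b = Ω^0_{b-1}`. -/
def hodograph (Om : ℕ → Matrix (Fin N) (Fin N) (Fun N)) (v : Fin N → BigFun N) (α : Fin N) :
    BigFun N :=
  xSum fun i : Fin N × ℕ => subst v (lowerOm Om i.2 α i.1)

/-- `∑_{b ≥ 1} L_{b-1}(v) q_b`. -/
def hodographShift (A : Fin N → ℂ) (Om : ℕ → Matrix (Fin N) (Fin N) (Fun N))
    (v : Fin N → BigFun N) (α : Fin N) : BigFun N :=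
  xSum (fun i : Fin N × ℕ => if i.2 = 0 then 0 else subst v (lowerOm Om (i.2 - 1) α i.1)) - C (A α)

/-- Write `L_b = Ω^0_{b-1}`. The explicit variables contribute `L_j`, and by `∂_γ L_b = C_γ L_{b-1}`
the dependence through `v` contributes a product with `∂_j v`. The subtracted `∂_j v` is absorbed by
the shift `-A` in `hodographShift`. -/
theorem pderiv_hodograph_sub (hF : IsVectorPotential A F) (h : IsCalibration F Om)
    (hb : IsBased Om) (hv : ∀ α, OrdGE 1 (v α)) (j : Fin N × ℕ) (α : Fin N) :
    pderiv ℂ j (hodograph Om v α - v α) = subst v (lowerOm Om j.2 α j.1) +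
      (multBy (fun γ => substMat v (mulMat F γ)) (hodographShift A Om v)).mulVec
        (fun γ => pderiv ℂ j (v γ)) α := by
  have hs := hasSubst_of_ordGE hv
  have hC := hF.isCommMult.subst hs
  have e1 : ∀ i : Fin N × ℕ, pderiv ℂ j (subst v (lowerOm Om i.2 α i.1)) =
      ∑ γ, ∑ μ, (pderiv ℂ j (v γ) * substMat v (mulMat F γ) α μ) *
        if i.2 = 0 then 0 else subst v (lowerOm Om (i.2 - 1) μ i.1) := by
    rintro ⟨β, b⟩
    rw [pderiv_subst hv]
    refine Finset.sum_congr rfl fun γ _ => ?_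
    cases b with
    | zero =>
      simp only [h.lowerOm_zero, Matrix.one_apply, if_true, mul_zero, Finset.sum_const_zero]
      split_ifs <;> simp [subst_zero_right hs]
    | succ b =>
      rw [← pdMat_apply, h.pdMat_lowerOm_succ hb, Matrix.mul_apply, subst_sum_right hs,
        Finset.sum_mul]
      refine Finset.sum_congr rfl fun μ _ => ?_
      rw [subst_mul hs, if_neg (Nat.succ_ne_zero b), Nat.add_sub_cancel]
      simp only [substMat_apply]; ring
  rw [map_sub, hodograph, pderiv_xSum, add_sub_assoc]
  congr 1
  simp only [e1, xSum_finsetSum, ← mul_xSum]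
  -- The term `∂_j v` is written as its product with the unit so that it can be merged into the
  -- shifted sum.
  have hu : pderiv ℂ j (v α) = ((multBy (fun γ => substMat v (mulMat F γ)) fun γ =>
      pderiv ℂ j (v γ)).mulVec fun α => C (A α)) α := by
    rw [hC.multBy_mulVec_unit]
  rw [hC.multBy_mulVec_comm, hu, Finset.sum_comm]
  simp only [Matrix.mulVec, dotProduct, multBy_apply]
  rw [← Finset.sum_sub_distrib]
  refine Finset.sum_congr rfl fun μ _ => ?_
  rw [← Finset.sum_mul, ← mul_sub]
  rfl

theorem pderiv_subst_lowerOm (h : IsCalibration F Om) (hb : IsBased Om)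
    (hv : ∀ α, OrdGE 1 (v α)) (d : ℕ) (α β : Fin N) (x : Fin N × ℕ) :
    pderiv ℂ x (subst v (lowerOm Om (d + 1) α β)) =
      ∑ γ, pderiv ℂ x (v γ) *
        (substMat v (mulMat F γ) * substMat v (lowerOm Om d)) α β := by
  have hs := hasSubst_of_ordGE hv
  rw [pderiv_subst hv]
  refine Finset.sum_congr rfl fun γ _ => ?_
  rw [← pdMat_apply, h.pdMat_lowerOm_succ hb, ← substMat_mul hs, substMat_apply, mul_comm]

/-- The `x`-derivative `A^μ ∂/∂t^μ_0` of the vector `v`. -/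
def xDeriv (A : Fin N → ℂ) (v : Fin N → BigFun N) (γ : Fin N) : BigFun N :=
  ∑ μ, A μ • pderiv ℂ (μ, 0) (v γ)

/-- Puts the hierarchy into the algebraic form `v_{t_d} = v_x ∘ L_d`. -/
theorem flow_iff (h : IsCalibration F Om) (hb : IsBased Om) (hv : ∀ α, OrdGE 1 (v α))
    (d : ℕ) (α β : Fin N) :
    ∑ μ, A μ • pderiv ℂ (μ, 0) (subst v (biOm Om 0 d α β)) =
      (multBy (fun γ => substMat v (mulMat F γ)) (xDeriv A v) * substMat v (lowerOm Om d)) α β := by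
  rw [← h.lowerOm_succ]
  simp only [pderiv_subst_lowerOm h hb hv, xDeriv, multBy, Finset.smul_sum]
  rw [Finset.sum_comm, Finset.sum_mul, Matrix.sum_apply]
  refine Finset.sum_congr rfl fun γ _ => ?_
  rw [Matrix.smul_mul, Matrix.smul_apply, smul_eq_mul, Finset.sum_mul]
  exact Finset.sum_congr rfl fun μ _ => (smul_mul_assoc _ _ _).symm

theorem coeff_hodograph_initial (h : IsCalibration F Om) (hs : HasSubst v) (α : Fin N)
    {m : Fin N × ℕ →₀ ℕ} (hm : ∀ i ∈ m.support, i.2 = 0) :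
    coeff m (hodograph Om v α) = coeff m (X (α, 0) : BigFun N) := by
  classical
  rw [hodograph, coeff_xSum _ m (Finset.subset_insert (α, 0) _), map_sum,
    Finset.sum_eq_single (α, 0)]
  · rw [h.lowerOm_zero, Matrix.one_apply_eq, subst_one_right hs, one_mul]
  · rintro ⟨β, b⟩ hi hne
    have hb : b = 0 := by
      rcases Finset.mem_insert.mp hi with hi | hi
      · exact absurd hi hne
      · exact hm _ hi
    subst hb
    have : α ≠ β := fun e => hne (by rw [e])
    rw [h.lowerOm_zero, Matrix.one_apply_ne this, subst_zero_right hs, zero_mul, map_zero]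
  · intro hi; exact absurd (Finset.mem_insert_self _ _) hi

/-- The number of variables `t^β_b` with `b ≥ 1` in a monomial. -/
def higherCount (N : ℕ) : (Fin N × ℕ →₀ ℕ) →+ ℕ :=
  Finsupp.weight fun i : Fin N × ℕ => if i.2 = 0 then 0 else 1

theorem higherCount_single (i : Fin N × ℕ) :
    higherCount N (Finsupp.single i 1) = if i.2 = 0 then 0 else 1 := by
  rw [higherCount, Finsupp.weight_apply, Finsupp.sum_single_index (by simp), one_smul]

theorem exists_higher_of_ne_zero {m : Fin N × ℕ →₀ ℕ}
    (hm : ¬∀ i ∈ m.support, i.2 = 0) : ∃ i m', i.2 ≠ 0 ∧ m = m' + Finsupp.single i 1 := by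
  push Not at hm
  obtain ⟨i, hi, h2⟩ := hm
  refine ⟨i, m - Finsupp.single i 1, h2, (tsub_add_cancel_of_le ?_).symm⟩
  exact Finsupp.single_le_iff.mpr (Nat.one_le_iff_ne_zero.mpr (Finsupp.mem_support_iff.mp hi))

/-- Let `E` be the defect of the hodograph equation. Along the flows it obeys the homogeneous
equation `∂_j E = (∂_x E) ∘ L_j`, and it vanishes when all higher times are zero; hence it vanishes
identically. -/
theorem hodograph_eq_of_flow (hF : IsVectorPotential A F) (h : IsCalibration F Om)
    (hb : IsBased Om) (hv : ∀ α, OrdGE 1 (v α)) (ht : IsTopologicalSolution A Om v) :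
    hodograph Om v = v := by
  classical
  have hs := hasSubst_of_ordGE hv
  have hC := hF.isCommMult.subst hs
  set Cv := fun γ => substMat v (mulMat F γ) with hCv
  set H := hodographShift A Om v
  set E : Fin N → BigFun N := fun α => hodograph Om v α - v α with hE
  have hflow : ∀ j : Fin N × ℕ, (fun γ => pderiv ℂ j (v γ)) =
      (multBy Cv (xDeriv A v)).mulVec fun γ => substMat v (lowerOm Om j.2) γ j.1 := by
    rintro ⟨β, d⟩
    ext1 γ
    rw [ht.flow, flow_iff h hb hv, Matrix.mul_apply]; rfl
  have hdE : ∀ j α, pderiv ℂ j (E α) =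
      (((1 + multBy Cv H * multBy Cv (xDeriv A v))).mulVec
        fun γ => substMat v (lowerOm Om j.2) γ j.1) α := by
    intro j α
    rw [hE, pderiv_hodograph_sub hF h hb hv, hflow, Matrix.add_mulVec, Matrix.one_mulVec,
      Matrix.mulVec_mulVec]
    rfl
  have hxE : xDeriv A E = (fun α => C (A α)) + (multBy Cv H).mulVec (xDeriv A v) := by
    ext1 α
    have e : ∀ M : Matrix (Fin N) (Fin N) (BigFun N),
        ∑ μ, A μ • (M.mulVec fun γ => substMat v (lowerOm Om 0) γ μ) α =
          (M.mulVec fun α => C (A α)) α := fun M => by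
      rw [h.lowerOm_zero, substMat_one hs]
      simp only [Matrix.mulVec, dotProduct, Matrix.one_apply, mul_ite, mul_one, mul_zero,
        Finset.sum_ite_eq', Finset.mem_univ, if_true]
      exact Finset.sum_congr rfl fun μ _ => by rw [smul_eq_C_mul, mul_comm]
    rw [xDeriv]
    simp only [hdE]
    rw [e, Matrix.add_mulVec, Matrix.one_mulVec, ← Matrix.mulVec_mulVec, hC.multBy_mulVec_unit]
  have hdE' : ∀ j α, pderiv ℂ j (E α) =
      ((multBy Cv (xDeriv A E)).mulVec fun γ => substMat v (lowerOm Om j.2) γ j.1) α := by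
    intro j α
    rw [hdE, hxE, multBy_add, hC.multBy_unit, hC.multBy_mulVec]
  -- Induction on the number of higher times in the monomial: stripping off one of them expresses
  -- the coefficient through `∂_x E`, and `∂_x` involves only variables of level zero, so it does
  -- not increase this number.
  have hzero : ∀ k m, higherCount N m = k → ∀ α, coeff m (E α) = 0 := by
    intro k
    induction k using Nat.strong_induction_on with
    | _ k ih =>
      intro m hk α
      by_cases hm : ∀ i ∈ m.support, i.2 = 0
      · rw [hE, map_sub, coeff_hodograph_initial h hs α hm, ht.initial α m hm, sub_self]
      obtain ⟨i, m', hi, rfl⟩ := exists_higher_of_ne_zero hm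
      rw [map_add, higherCount_single, if_neg hi] at hk
      have e : coeff m' (pderiv ℂ i (E α)) = 0 := by
        rw [hdE']
        simp only [Matrix.mulVec, dotProduct, multBy_apply, xDeriv]
        rw [map_sum]
        refine Finset.sum_eq_zero fun γ _ => ?_
        rw [coeff_mul]
        refine Finset.sum_eq_zero fun x hx => ?_
        rw [map_sum, Finset.sum_eq_zero, zero_mul]
        intro δ _
        rw [coeff_mul]
        refine Finset.sum_eq_zero fun y hy => ?_
        rw [map_sum, Finset.sum_eq_zero, zero_mul]
        intro μ _
        rw [coeff_smul, coeff_pderiv, ih _ _ _ rfl, zero_mul, mul_zero]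
        rw [map_add, higherCount_single, if_pos rfl]
        have h1 := congrArg (higherCount N) (Finset.HasAntidiagonal.mem_antidiagonal.mp hx)
        have h2 := congrArg (higherCount N) (Finset.HasAntidiagonal.mem_antidiagonal.mp hy)
        rw [map_add] at h1 h2
        omega
      rw [coeff_pderiv] at e
      exact (mul_eq_zero.mp e).resolve_right (Nat.cast_add_one_ne_zero _)
  ext1 α
  refine sub_eq_zero.mp (MvPowerSeries.ext fun m => ?_)
  rw [map_zero]
  exact hzero _ m rfl α

/-- Differentiating the hodograph equation gives `H ∘ v_{t_j} = -L_j`, with `H` the shifted sum.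
Contracting the level zero equations with `A` gives `H ∘ v_x = -A`, minus the unit, so `-v_x` is
inverse to `H` and `v_{t_j} = v_x ∘ L_j`. -/
theorem flow_of_hodograph_eq (hF : IsVectorPotential A F) (h : IsCalibration F Om)
    (hb : IsBased Om) (hv : ∀ α, OrdGE 1 (v α)) (he : hodograph Om v = v) :
    IsTopologicalSolution A Om v := by
  classical
  have hs := hasSubst_of_ordGE hv
  have hC := hF.isCommMult.subst hs
  refine ⟨fun α m hm => ?_, fun α β d => ?_⟩
  · rw [← coeff_hodograph_initial h hs α hm, he]
  set Cv := fun γ => substMat v (mulMat F γ) with hCv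
  set H := hodographShift A Om v
  have hd : ∀ j : Fin N × ℕ, (multBy Cv H).mulVec (fun γ => pderiv ℂ j (v γ)) =
      fun γ => -substMat v (lowerOm Om j.2) γ j.1 := by
    intro j
    ext1 α
    have := pderiv_hodograph_sub hF h hb hv j α
    rw [he, sub_self, map_zero] at this
    exact (neg_eq_of_add_eq_zero_right this.symm).symm
  have hx : (multBy Cv H).mulVec (xDeriv A v) = fun α => -C (A α) := by
    have e : xDeriv A v = ∑ μ, A μ • fun γ => pderiv ℂ (μ, 0) (v γ) := by
      ext1 γ; simp [xDeriv]
    rw [e, Matrix.mulVec_sum]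
    simp only [Matrix.mulVec_smul, hd, h.lowerOm_zero, substMat_one hs]
    ext1 α
    simp only [Finset.sum_apply, Pi.smul_apply, Matrix.one_apply]
    rw [Finset.sum_eq_single α]
    · simp [smul_eq_C_mul]
    · intro b _ hb; simp [Ne.symm hb]
    · simp
  have hinv : multBy Cv (xDeriv A v) * multBy Cv H = -1 := by
    rw [← hC.multBy_mulVec, hC.multBy_mulVec_comm, hx]
    rw [← hC.multBy_unit]
    ext1 α β
    simp [multBy_apply]
  have h3 := congrArg (multBy Cv (xDeriv A v)).mulVec (hd (β, d))
  rw [Matrix.mulVec_mulVec, hinv, Matrix.neg_mulVec, Matrix.one_mulVec] at h3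
  have h3 := congrFun h3 α
  rw [flow_iff h hb hv, Matrix.mul_apply]
  simp only [Pi.neg_apply, Matrix.mulVec, dotProduct, mul_neg, Finset.sum_neg_distrib] at h3
  exact neg_injective h3

/-- The weight `b - 1` of the variable `t^β_b`. -/
def dimWeight (N : ℕ) (i : Fin N × ℕ) : ℤ := (i.2 : ℤ) - 1

theorem ordGE_subst_sub_subst {τ : Type*} {k : ℕ} (f : Fun N) {x y : Fin N → MvPowerSeries τ ℂ}
    (hx : ∀ α, OrdGE 1 (x α)) (hy : ∀ α, OrdGE 1 (y α)) (hxy : ∀ α, OrdGE k (x α - y α)) :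
    OrdGE k (subst x f - subst y f) :=
  OrdGE.subst_sub_subst (c := 0) (hasSubst_of_ordGE hx) (hasSubst_of_ordGE hy) hx hy hxy
    fun n h0 h1 => absurd ((Finsupp.degree_eq_zero_iff n).mp (Nat.le_zero.mp h1)) h0

/-- The explicit variable in every summand gains one order. -/
theorem hodograph_contracting (x y : Fin N → BigFun N) (k : ℕ)
    (hx : ∀ α, OrdGE 1 (x α)) (hy : ∀ α, OrdGE 1 (y α)) (hxy : ∀ α, OrdGE k (x α - y α))
    (α : Fin N) : OrdGE (k + 1) (hodograph Om x α - hodograph Om y α) := by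
  rw [hodograph, hodograph, ← xSum_sub]
  exact OrdGE.xSum fun i => ordGE_subst_sub_subst _ hx hy hxy

/-- The weight bound survives the iteration: `L_b(v)` has weight at most `-b` and `t_b` has weight
`b - 1`, so every summand has weight at most `-1`. -/
theorem exists_hodograph_eq (h : IsCalibration F Om) (hb : IsBased Om) :
    ∃ v : Fin N → BigFun N, ((∀ α, OrdGE 1 (v α)) ∧ ∀ α, WtLE (dimWeight N) (-1) (v α)) ∧
      hodograph Om v = v := by
  refine exists_fixedPoint (hodograph Om)
    (fun v => (∀ α, OrdGE 1 (v α)) ∧ ∀ α, WtLE (dimWeight N) (-1) (v α)) 0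
    ⟨fun α => OrdGE.zero _, fun α n _ => map_zero _⟩ ?_ ?_ ?_
  · rintro x ⟨hx, hw⟩
    refine ⟨fun α => OrdGE.xSum fun i => OrdGE.zero_left _, fun α => WtLE.xSum fun i => ?_⟩
    refine (WtLE.subst (h.ordGE_lowerOm hb i.2 α i.1) (hasSubst_of_ordGE hx) hw).mono ?_
    rw [dimWeight]; omega
  · intro x hx
    constructor
    · intro α
      obtain ⟨y, hy, hxy⟩ := hx 1
      simpa using (hxy α).add (hy.1 α)
    · intro α n hn
      obtain ⟨y, hy, hxy⟩ := hx (n.degree + 1)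
      have := hxy α n (Nat.lt_succ_self _)
      rw [map_sub, hy.2 α n hn, sub_zero] at this
      exact this
  · exact fun x y k hx hy hxy => hodograph_contracting x y k hx.1 hy.1 hxy

theorem IsTopologicalSolution.ordGE (ht : IsTopologicalSolution A Om v) (α : Fin N) :
    OrdGE 1 (v α) := by
  rw [ordGE_one_iff, ← coeff_zero_eq_constantCoeff_apply, ht.initial α 0 (by simp)]
  simp

/-- The topological solution solves the hodograph equation, and is polynomial in the variables
`t_{≥2}` up to the variables `t_0`. -/
theorem IsTopologicalSolution.hodograph_eq (hF : IsVectorPotential A F) (h : IsCalibration F Om)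
    (hb : IsBased Om) (ht : IsTopologicalSolution A Om v) :
    hodograph Om v = v ∧ ∀ α, WtLE (dimWeight N) (-1) (v α) := by
  have he := hodograph_eq_of_flow hF h hb ht.ordGE ht
  obtain ⟨v', ⟨hv', hw⟩, he'⟩ := exists_hodograph_eq h hb
  have : v = v' := fixedPoint_unique (R := ℂ) (hodograph Om) (fun v => ∀ α, OrdGE 1 (v α))
    (fun x y k hx hy hxy => hodograph_contracting x y k hx hy hxy) ht.ordGE hv' he he'
  exact ⟨he, this ▸ hw⟩

/-- For a calibration vanishing at the origin, `Ω^a_b` starts in degree at least `a + b + 1`; the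
potentials therefore start in degree at least two and their first derivatives vanish at zero. -/
theorem IsVectorPotential.exists_ancestorPotentials (hF : IsVectorPotential A F) :
    ∃ Fa, IsAncestorPotentials A F Fa := by
  obtain ⟨Om, h, hb⟩ := hF.exists_calibration
  obtain ⟨v, ⟨hv, -⟩, he⟩ := exists_hodograph_eq h hb
  have hs := hasSubst_of_ordGE hv
  refine ⟨fun a α => descendantPotential A Om v a α, Om, v, h, fun α => ?_,
    flow_of_hodograph_eq hF h hb hv he, fun _ _ => rfl, fun a α β b => ?_⟩
  · rw [← coeff_zero_eq_constantCoeff_apply, map_sum]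
    exact Finset.sum_eq_zero fun β _ => by
      rw [coeff_smul, coeff_zero_eq_constantCoeff_apply, hb, mul_zero]
  · rw [← ordGE_one_iff]
    change OrdGE 1 (pderiv ℂ _ (descendantPotential A Om v a α))
    rw [descendantPotential_eq]
    refine OrdGE.pderiv (OrdGE.sub ?_ ?_) _
    · exact OrdGE.xSum fun i => ((h.ordGE_biOm hb a i.2 α i.1).subst hs hv).mono (by omega)
    · exact OrdGE.sum fun β _ =>
        ((((h.ordGE_biOm hb a 1 α β).subst hs hv).mono (by omega)).smul _)

theorem biOm_zero_right (h : IsCalibration F Om) (a : ℕ) : biOm Om a 0 = Om (a + 1) := by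
  rw [biOm, Finset.sum_range_one, h.lowerOm_zero]
  simp

theorem biOm_one_right (h : IsCalibration F Om) (a : ℕ) :
    biOm Om a 1 = Om (a + 1) * Om 1 - Om (a + 2) := by
  rw [biOm, Finset.sum_range_succ, Finset.sum_range_one, h.lowerOm_zero, h.lowerOm_one]
  simp only [Nat.sub_zero, pow_one, mul_one, Nat.sub_self, pow_zero, one_mul, neg_mul,
    Nat.add_sub_cancel]
  rw [neg_add_eq_sub]

/-- At the origin the derivative of `𝓕^{α,a}` by `t^β_0` is `Ω^{α,a}_{β,0}(0)` minus the
contribution of the dilaton shift. The latter is the value at zero of `Ω^{a-1}_0 C_β Ω^0_0 A`, which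
vanishes because `Ω^0_0 A` does. -/
theorem isBased_of_ancestor (h : IsCalibration F Om)
    (h0 : ∀ α, constantCoeff (∑ β, A β • Om 1 α β) = 0) (ht : IsTopologicalSolution A Om v)
    (hd : ∀ a α β b, constantCoeff (pderiv ℂ (β, b) (descendantPotential A Om v a α)) = 0) :
    IsBased Om := by
  classical
  intro a α β
  have hv := ht.ordGE
  have hs := hasSubst_of_ordGE hv
  have e := hd a α β 0
  rw [descendantPotential_eq, map_sub, pderiv_xSum, map_sub, map_add] at e
  have h1 : constantCoeff (xSum fun i : Fin N × ℕ =>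
      pderiv ℂ (β, 0) (subst v (biOm Om a i.2 α i.1))) = 0 :=
    ordGE_one_iff.mp (OrdGE.xSum fun _ => OrdGE.zero_left _)
  have hv1 : ∀ γ, constantCoeff (pderiv ℂ (β, 0) (v γ)) = if γ = β then 1 else 0 := fun γ => by
    rw [← coeff_zero_eq_constantCoeff_apply, coeff_pderiv, zero_add, ht.initial]
    · simp only [coeff_X, Finsupp.single_left_inj one_ne_zero, Prod.mk.injEq, and_true]
      by_cases hγ : γ = β
      · simp [hγ]
      · simp [hγ, Ne.symm hγ]
    · intro i hi
      rw [Finset.mem_singleton.mp (Finsupp.support_single_subset hi)]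
  have h2 : constantCoeff (pderiv ℂ (β, 0) (∑ β', A β' • subst v (biOm Om a 1 α β'))) = 0 := by
    have e1 : ∀ β', constantCoeff (pderiv ℂ (β, 0) (A β' • subst v (biOm Om a 1 α β'))) =
        constantCoeff (A β' • (Om a * mulMat F β * Om 1) α β') := fun β' => by
      rw [Derivation.map_smul, pderiv_subst hv, smul_eq_C_mul, map_mul, map_sum]
      simp only [map_mul, hv1, mul_ite, mul_one, mul_zero, Finset.sum_ite_eq', Finset.mem_univ,
        if_true]
      rw [constantCoeff_subst_of_ordGE hv, ← pdMat_apply, biOm_one_right h, pdMat_sub, pdMat_mul,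
        h.pdMat_succ, h.pdMat_succ, h.pdMat_succ, h.zero, Matrix.one_mul, add_sub_cancel_right,
        smul_eq_C_mul, map_mul]
      rfl
    rw [map_sum, map_sum, Finset.sum_congr rfl fun β' _ => e1 β', ← map_sum]
    have e2 : ∑ β', A β' • (Om a * mulMat F β * Om 1) α β' =
        ∑ γ, (Om a * mulMat F β) α γ * ∑ β', A β' • Om 1 γ β' := by
      simp only [Finset.mul_sum]
      rw [Finset.sum_comm]
      refine Finset.sum_congr rfl fun β' _ => ?_
      rw [Matrix.mul_apply, Finset.smul_sum]
      exact Finset.sum_congr rfl fun _ _ => (mul_smul_comm _ _ _).symm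
    rw [e2, map_sum]
    exact Finset.sum_eq_zero fun γ _ => by rw [map_mul, h0, mul_zero]
  rw [h1, h2, add_zero, sub_zero, biOm_zero_right h, constantCoeff_subst_of_ordGE hv] at e
  exact e

end Hierarchy

/-! ### Evaluation of tame power series -/

section Evaluation

variable {N : ℕ} {τ : Type}

/-- The number of variables `t^β_b` with `b ≤ 1` in a monomial. -/
def lowCount (N : ℕ) : (Fin N × ℕ →₀ ℕ) →+ ℕ :=
  Finsupp.weight fun i : Fin N × ℕ => if i.2 ≤ 1 then 1 else 0

theorem neg_weight_le_lowCount (n : Fin N × ℕ →₀ ℕ) :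
    -Finsupp.weight (dimWeight N) n ≤ lowCount N n := by
  rw [lowCount, Finsupp.weight_apply, Finsupp.weight_apply, Finsupp.sum, Finsupp.sum,
    ← Finset.sum_neg_distrib, Nat.cast_sum]
  refine Finset.sum_le_sum fun i _ => ?_
  simp only [dimWeight, nsmul_eq_mul, smul_eq_mul]
  push_cast
  rw [← mul_neg]
  refine mul_le_mul_of_nonneg_left ?_ (by positivity)
  split_ifs <;> omega

/-- Variable by variable this says `1 ≤ 2 + (b - 1)` for `b ≤ 1` and `1 ≤ b - 1` for `b ≥ 2`. -/
theorem degree_le_lowCount (n : Fin N × ℕ →₀ ℕ) :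
    (n.degree : ℤ) ≤ 2 * lowCount N n + Finsupp.weight (dimWeight N) n := by
  rw [lowCount, Finsupp.weight_apply, Finsupp.weight_apply, Finsupp.sum, Finsupp.sum,
    Finsupp.degree_apply, Nat.cast_sum, Nat.cast_sum, Finset.mul_sum, ← Finset.sum_add_distrib]
  refine Finset.sum_le_sum fun i _ => ?_
  simp only [dimWeight, nsmul_eq_mul, smul_eq_mul]
  push_cast
  rw [mul_left_comm, ← mul_add]
  nth_rw 1 [← mul_one (n i : ℤ)]
  refine mul_le_mul_of_nonneg_left ?_ (by positivity)
  split_ifs <;> omega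

theorem index_le_of_mem_support {n : Fin N × ℕ →₀ ℕ} {i : Fin N × ℕ} (hi : i ∈ n.support) :
    (i.2 : ℤ) - 1 ≤ lowCount N n + Finsupp.weight (dimWeight N) n := by
  rw [lowCount, Finsupp.weight_apply, Finsupp.weight_apply, Finsupp.sum, Finsupp.sum,
    Nat.cast_sum, ← Finset.sum_add_distrib]
  have hnn : ∀ j ∈ n.support, 0 ≤ (((n j • if j.2 ≤ 1 then 1 else 0 : ℕ) : ℤ) +
      n j • dimWeight N j) := fun j _ => by
    simp only [dimWeight, nsmul_eq_mul, smul_eq_mul]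
    push_cast
    rw [← mul_add]
    refine mul_nonneg (by positivity) ?_
    split_ifs <;> omega
  refine le_trans ?_ (Finset.single_le_sum hnn hi)
  simp only [dimWeight, nsmul_eq_mul, smul_eq_mul]
  push_cast
  rw [← mul_add]
  have h1 : (1 : ℤ) ≤ n i := by
    exact_mod_cast Nat.one_le_iff_ne_zero.mpr (Finsupp.mem_support_iff.mp hi)
  split_ifs <;> nlinarith

/-- The monomials which contribute to the evaluation up to degree `D` of a series of weight at
most `c`. -/
def evBox (N : ℕ) (c : ℤ) (D : ℕ) : Set (Fin N × ℕ →₀ ℕ) :=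
  {n | Finsupp.weight (dimWeight N) n ≤ c ∧ lowCount N n ≤ D}

/-- Bounded weight together with few variables of level at most one bounds both the total degree and
the largest level that occurs. This is the reason why `t_b` with `b ≥ 2` may take arbitrary values.
-/
theorem evBox_finite (N : ℕ) (c : ℤ) (D : ℕ) : (evBox N c D).Finite := by
  classical
  let s : Finset (Fin N × ℕ) := Finset.univ ×ˢ Finset.range (D + c + 2).toNat
  refine (Set.finite_Iic (Finsupp.indicator s fun _ _ => (2 * D + c).toNat)).subset ?_
  rintro n ⟨hn, hD⟩ i
  by_cases hi : i ∈ n.support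
  · have h1 := index_le_of_mem_support hi
    have h2 := degree_le_lowCount n
    have hs : i ∈ s := by
      refine Finset.mem_product.mpr ⟨Finset.mem_univ _, Finset.mem_range.mpr ?_⟩
      omega
    rw [Finsupp.indicator_of_mem hs]
    have h3 : n i ≤ n.degree := Finsupp.le_degree i n
    omega
  · rw [Finsupp.notMem_support_iff.mp hi]; exact Nat.zero_le _

/-- The value of `f` at the point `T`. -/
def evalAt (T : Fin N × ℕ → MvPowerSeries τ ℂ) (f : BigFun N) : MvPowerSeries τ ℂ :=
  fun m => ∑ᶠ n : Fin N × ℕ →₀ ℕ, coeff n f * coeff m (n.prod fun i k => T i ^ k)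

/-- The values of `t_0` and `t_1` have no constant term. -/
def IsGoodPoint (T : Fin N × ℕ → MvPowerSeries τ ℂ) : Prop :=
  ∀ β b, b ≤ 1 → OrdGE 1 (T (β, b))

variable {T : Fin N × ℕ → MvPowerSeries τ ℂ}

theorem IsGoodPoint.ordGE_prod (hT : IsGoodPoint T) (n : Fin N × ℕ →₀ ℕ) :
    OrdGE (lowCount N n) (n.prod fun i k => T i ^ k) := by
  classical
  rw [Finsupp.prod, lowCount, Finsupp.weight_apply, Finsupp.sum]
  induction n.support using Finset.induction_on with
  | empty => simpa using OrdGE.zero_left _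
  | insert i s hi ih =>
    rw [Finset.prod_insert hi, Finset.sum_insert hi]
    refine OrdGE.mul ?_ ih
    split_ifs with h
    · exact (hT i.1 i.2 h).pow _
    · simpa using OrdGE.zero_left _

theorem IsGoodPoint.support_subset (hT : IsGoodPoint T) {c : ℤ} {f : BigFun N}
    (hf : WtLE (dimWeight N) c f) (m : τ →₀ ℕ) {D : ℕ} (hD : m.degree ≤ D) :
    (Function.support fun n => coeff n f * coeff m (n.prod fun i k => T i ^ k)) ⊆
      (evBox_finite N c D).toFinset := fun n hn => by
  rw [Set.Finite.coe_toFinset]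
  constructor
  · by_contra hc
    exact hn (mul_eq_zero_of_left (hf n (not_le.mp hc)) _)
  · by_contra hc
    exact hn (mul_eq_zero_of_right _ (hT.ordGE_prod n m (by omega)))

theorem IsGoodPoint.coeff_evalAt (hT : IsGoodPoint T) {c : ℤ} {f : BigFun N}
    (hf : WtLE (dimWeight N) c f) (m : τ →₀ ℕ) {D : ℕ} (hD : m.degree ≤ D) :
    coeff m (evalAt T f) = ∑ n ∈ (evBox_finite N c D).toFinset,
      coeff n f * coeff m (n.prod fun i k => T i ^ k) :=
  finsum_eq_sum_of_support_subset _ (hT.support_subset hf m hD)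

theorem IsGoodPoint.evaluatesTo_iff (hT : IsGoodPoint T) {c : ℤ} {f : BigFun N}
    (hf : WtLE (dimWeight N) c f) (g : MvPowerSeries τ ℂ) : EvaluatesTo f T g ↔ evalAt T f = g :=
  ⟨fun h => MvPowerSeries.ext fun m => (h m).2, fun h m =>
    ⟨(Finset.finite_toSet _).subset (hT.support_subset hf m le_rfl), by rw [← h]; rfl⟩⟩

theorem IsGoodPoint.evalAt_add (hT : IsGoodPoint T) {c : ℤ} {f g : BigFun N}
    (hf : WtLE (dimWeight N) c f) (hg : WtLE (dimWeight N) c g) :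
    evalAt T (f + g) = evalAt T f + evalAt T g := by
  ext m
  rw [map_add, hT.coeff_evalAt hf m le_rfl, hT.coeff_evalAt hg m le_rfl,
    hT.coeff_evalAt (hf.add hg) m le_rfl, ← Finset.sum_add_distrib]
  exact Finset.sum_congr rfl fun n _ => by rw [map_add, add_mul]

theorem IsGoodPoint.evalAt_sub (hT : IsGoodPoint T) {c : ℤ} {f g : BigFun N}
    (hf : WtLE (dimWeight N) c f) (hg : WtLE (dimWeight N) c g) :
    evalAt T (f - g) = evalAt T f - evalAt T g := by
  ext m
  rw [map_sub, hT.coeff_evalAt hf m le_rfl, hT.coeff_evalAt hg m le_rfl,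
    hT.coeff_evalAt (hf.sub hg) m le_rfl, ← Finset.sum_sub_distrib]
  exact Finset.sum_congr rfl fun n _ => by rw [map_sub, sub_mul]

theorem evalAt_zero : evalAt T (0 : BigFun N) = 0 := by
  ext m
  exact finsum_eq_zero_of_forall_eq_zero fun n => by rw [map_zero, zero_mul]

theorem evalAt_smul (r : ℂ) (f : BigFun N) : evalAt T (r • f) = r • evalAt T f := by
  ext m
  rw [coeff_smul]
  change ∑ᶠ n, _ = r * ∑ᶠ n, _
  rw [← smul_eq_mul, smul_finsum]
  exact finsum_congr fun n => by rw [coeff_smul, smul_eq_mul, mul_assoc]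

theorem IsGoodPoint.evalAt_sum (hT : IsGoodPoint T) {ι : Type*} {c : ℤ} (s : Finset ι)
    {f : ι → BigFun N} (hf : ∀ i, WtLE (dimWeight N) c (f i)) :
    evalAt T (∑ i ∈ s, f i) = ∑ i ∈ s, evalAt T (f i) := by
  classical
  induction s using Finset.induction_on with
  | empty => simpa using evalAt_zero
  | insert i s hi ih =>
    rw [Finset.sum_insert hi, Finset.sum_insert hi, hT.evalAt_add (hf i)
      (WtLE.sum fun i _ => hf i), ih]

theorem evalAt_monomial (n : Fin N × ℕ →₀ ℕ) (r : ℂ) :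
    evalAt T (monomial n r) = r • n.prod fun i k => T i ^ k := by
  classical
  ext m
  change ∑ᶠ n', _ = _
  rw [finsum_eq_single _ n fun n' hn' => by rw [coeff_monomial_ne hn', zero_mul],
    coeff_monomial_same, coeff_smul]

theorem evalAt_C (r : ℂ) : evalAt T (C r) = C r := by
  rw [show (C r : BigFun N) = monomial 0 r from rfl, evalAt_monomial]
  simp [smul_eq_C_mul]

theorem evalAt_X (i : Fin N × ℕ) : evalAt T (X i) = T i := by
  rw [X, evalAt_monomial, one_smul, Finsupp.prod_single_index (by simp), pow_one]

theorem IsGoodPoint.evalAt_mul (hT : IsGoodPoint T) {c d : ℤ} {f g : BigFun N}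
    (hf : WtLE (dimWeight N) c f) (hg : WtLE (dimWeight N) d g) :
    evalAt T (f * g) = evalAt T f * evalAt T g := by
  classical
  ext m
  set s := (evBox_finite N c m.degree).toFinset with hs
  set t := (evBox_finite N d m.degree).toFinset with ht
  set P : (Fin N × ℕ →₀ ℕ) → MvPowerSeries τ ℂ := fun n => n.prod fun i k => T i ^ k with hP
  have hPadd : ∀ a b, P (a + b) = P a * P b := fun a b =>
    Finsupp.prod_add_index' (by simp) (by simp [pow_add])
  have hR : coeff m (evalAt T f * evalAt T g) =
      ∑ p ∈ s ×ˢ t, coeff p.1 f * coeff p.2 g * coeff m (P (p.1 + p.2)) := by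
    rw [coeff_mul, Finset.sum_product]
    have e : ∀ x ∈ Finset.HasAntidiagonal.antidiagonal m,
        coeff x.1 (evalAt T f) * coeff x.2 (evalAt T g) = ∑ a ∈ s, ∑ b ∈ t,
          coeff a f * coeff b g * (coeff x.1 (P a) * coeff x.2 (P b)) := fun x hx => by
      have hx := congrArg Finsupp.degree (Finset.HasAntidiagonal.mem_antidiagonal.mp hx)
      rw [map_add] at hx
      rw [hT.coeff_evalAt hf x.1 (D := m.degree) (by omega),
        hT.coeff_evalAt hg x.2 (D := m.degree) (by omega), Finset.sum_mul_sum]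
      exact Finset.sum_congr rfl fun a _ => Finset.sum_congr rfl fun b _ => by ring
    rw [Finset.sum_congr rfl e, Finset.sum_comm]
    refine Finset.sum_congr rfl fun a _ => ?_
    rw [Finset.sum_comm]
    refine Finset.sum_congr rfl fun b _ => ?_
    rw [← Finset.mul_sum, hPadd, coeff_mul]
  -- Sums of exponents from the two boxes may contain too many low variables for the box of the
  -- product, so both sides are summed over a union.
  set S := (evBox_finite N (c + d) m.degree).toFinset ∪ (s ×ˢ t).image
    fun p : (Fin N × ℕ →₀ ℕ) × (Fin N × ℕ →₀ ℕ) => p.1 + p.2 with hS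
  have hL : coeff m (evalAt T (f * g)) = ∑ n ∈ S, coeff n (f * g) * coeff m (P n) :=
    finsum_eq_sum_of_support_subset _ ((hT.support_subset (hf.mul hg) m le_rfl).trans
      (Finset.coe_subset.mpr Finset.subset_union_left))
  rw [hL, hR, ← Finset.sum_fiberwise_of_maps_to (t := S)
    (g := fun p : (Fin N × ℕ →₀ ℕ) × (Fin N × ℕ →₀ ℕ) => p.1 + p.2)
    fun p hp => Finset.mem_union_right _ (Finset.mem_image_of_mem _ hp)]
  refine Finset.sum_congr rfl fun n _ => ?_
  rw [coeff_mul, Finset.sum_mul]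
  symm
  have e : ∀ p ∈ (s ×ˢ t).filter fun p => p.1 + p.2 = n,
      coeff p.1 f * coeff p.2 g * coeff m (P (p.1 + p.2)) =
        coeff p.1 f * coeff p.2 g * coeff m (P n) := fun p hp => by
    rw [(Finset.mem_filter.mp hp).2]
  rw [Finset.sum_congr rfl e]
  refine Finset.sum_subset (fun p hp => Finset.HasAntidiagonal.mem_antidiagonal.mpr
    (Finset.mem_filter.mp hp).2) fun p hp hp' => ?_
  have hpn := Finset.HasAntidiagonal.mem_antidiagonal.mp hp
  by_contra hne
  have h1 : coeff p.1 f ≠ 0 := fun h => hne (by rw [h, zero_mul, zero_mul])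
  have h2 : coeff p.2 g ≠ 0 := fun h => hne (by rw [h, mul_zero, zero_mul])
  have h3 : lowCount N n ≤ m.degree := by
    by_contra hc
    exact hne (mul_eq_zero_of_right _ (hT.ordGE_prod n m (not_le.mp hc)))
  rw [← hpn, map_add] at h3
  refine hp' (Finset.mem_filter.mpr ⟨Finset.mem_product.mpr ⟨?_, ?_⟩, hpn⟩)
  · rw [hs, Set.Finite.mem_toFinset]
    exact ⟨not_lt.mp fun h => h1 (hf _ h), by omega⟩
  · rw [ht, Set.Finite.mem_toFinset]
    exact ⟨not_lt.mp fun h => h2 (hg _ h), by omega⟩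

/-- Only the variables of level zero have negative weight, so a monomial of weight at most `-k`
contains at least `k` of them, and their values have no constant term. -/
theorem IsGoodPoint.ordGE_evalAt (hT : IsGoodPoint T) {k : ℕ} {f : BigFun N}
    (hf : WtLE (dimWeight N) (-k) f) : OrdGE k (evalAt T f) := fun m hm =>
  finsum_eq_zero_of_forall_eq_zero fun n => by
    by_cases h : -(k : ℤ) < Finsupp.weight (dimWeight N) n
    · rw [hf n h, zero_mul]
    · have := neg_weight_le_lowCount n
      rw [hT.ordGE_prod n m (by omega), mul_zero]

/-- Clear for polynomials by additivity and multiplicativity; the remainder of order `k` has weight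
at most `-k` after substitution, hence order `k` after evaluation. -/
theorem IsGoodPoint.evalAt_subst (hT : IsGoodPoint T) {v : Fin N → BigFun N}
    (hv : ∀ α, OrdGE 1 (v α)) (hw : ∀ α, WtLE (dimWeight N) (-1) (v α)) (f : Fun N) :
    evalAt T (subst v f) = subst (fun α => evalAt T (v α)) f := by
  have hs := hasSubst_of_ordGE hv
  have he : ∀ α, OrdGE 1 (evalAt T (v α)) := fun α => hT.ordGE_evalAt (by simpa using hw α)
  have hes := hasSubst_of_ordGE he
  have hwt : ∀ f : Fun N, WtLE (dimWeight N) 0 (subst v f) := fun f => by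
    simpa using WtLE.subst (OrdGE.zero_left f) hs hw
  have hp : ∀ p : MvPolynomial (Fin N) ℂ, evalAt T (subst v (p : Fun N)) =
      subst (fun α => evalAt T (v α)) (p : Fun N) := fun p => by
    induction p using MvPolynomial.induction_on with
    | C r => rw [MvPolynomial.coe_C, subst_C, subst_C, evalAt_C]
    | add p q hp hq =>
      rw [MvPolynomial.coe_add, subst_add hs, subst_add hes, hT.evalAt_add (hwt _) (hwt _), hp, hq]
    | mul_X p i hp =>
      rw [MvPolynomial.coe_mul, MvPolynomial.coe_X, subst_mul hs, subst_mul hes, subst_X hs,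
        subst_X hes, hT.evalAt_mul (hwt _) (hw i), hp]
  refine eq_of_ordGE_sub fun k => ?_
  obtain ⟨p, hpk⟩ := exists_polynomial_ordGE_sub f k
  have e : evalAt T (subst v f) - subst (fun α => evalAt T (v α)) f =
      evalAt T (subst v (f - (p : Fun N))) -
        subst (fun α => evalAt T (v α)) (f - (p : Fun N)) := by
    rw [subst_sub hs, subst_sub hes, hT.evalAt_sub (hwt _) (hwt _), hp]
    ring
  rw [e]
  exact (hT.ordGE_evalAt (WtLE.subst hpk hs hw)).sub (hpk.subst hes he)

/-- The weight bound and the degree of `m` together bound the levels `b` that can contribute. -/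
theorem IsGoodPoint.coeff_evalAt_xSum (hT : IsGoodPoint T) {c : ℤ} {G : Fin N × ℕ → BigFun N}
    (hG : ∀ i, WtLE (dimWeight N) (c - dimWeight N i) (G i)) (m : τ →₀ ℕ) {B : ℕ}
    (hB : c + m.degree + 2 ≤ B) :
    coeff m (evalAt T (xSum G)) =
      ∑ β, ∑ b ∈ Finset.range B, coeff m (evalAt T (G (β, b)) * T (β, b)) := by
  have hGX : ∀ i, WtLE (dimWeight N) c (G i * X i) := fun i => by
    simpa using (hG i).mul (WtLE.X i)
  have hsum : WtLE (dimWeight N) c (∑ i ∈ Finset.univ ×ˢ Finset.range B, G i * X i) :=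
    WtLE.sum fun i _ => hGX i
  have h1 : coeff m (evalAt T (xSum G)) =
      coeff m (evalAt T (∑ i ∈ Finset.univ ×ˢ Finset.range B, G i * X i)) := by
    rw [hT.coeff_evalAt (WtLE.xSum hG) m le_rfl, hT.coeff_evalAt hsum m le_rfl]
    refine Finset.sum_congr rfl fun n hn => ?_
    rw [Set.Finite.mem_toFinset] at hn
    rw [coeff_xSum]
    intro i hi
    have := index_le_of_mem_support hi
    have h1 := hn.1
    have h2 := hn.2
    exact Finset.mem_product.mpr ⟨Finset.mem_univ _, Finset.mem_range.mpr (by omega)⟩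
  rw [h1, hT.evalAt_sum _ hGX, map_sum, Finset.sum_product]
  exact Finset.sum_congr rfl fun β _ => Finset.sum_congr rfl fun b _ => by
    rw [hT.evalAt_mul (hG _) (WtLE.X _), evalAt_X]

variable {A : Fin N → ℂ} {F : Fin N → Fun N} {Om : ℕ → Matrix (Fin N) (Fin N) (Fun N)}
  {v : Fin N → BigFun N}

/-- Passage from `t` to `q = t - A z`; the bound on `B` ensures that the shifted level `b = 1` lies
in the range. -/
theorem sum_range_mul_shift {B : ℕ} (hB : 2 ≤ B) (m : τ →₀ ℕ) (G : Fin N → ℕ → MvPowerSeries τ ℂ)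
    (q : ℕ → Fin N → MvPowerSeries τ ℂ) :
    ∑ β, ∑ b ∈ Finset.range B, coeff m (G β b * (q b β + if b = 1 then C (A β) else 0)) =
      ∑ β, ∑ b ∈ Finset.range B, coeff m (G β b * q b β) + coeff m (∑ β, A β • G β 1) := by
  rw [map_sum, ← Finset.sum_add_distrib]
  refine Finset.sum_congr rfl fun β _ => ?_
  simp only [mul_add, map_add, Finset.sum_add_distrib]
  congr 1
  rw [Finset.sum_eq_single 1]
  · rw [if_pos rfl, mul_comm, smul_eq_C_mul]
  · intro b _ hb; rw [if_neg hb, mul_zero, map_zero]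
  · intro h; exact absurd (Finset.mem_range.mpr (by omega)) h

/-- Evaluation of ancestor potentials at a point of the loop space. -/
theorem exists_value (hF : IsVectorPotential A F) (h : IsCalibration F Om) (hb : IsBased Om)
    (ht : IsTopologicalSolution A Om v) (q : ℕ → Fin N → MvPowerSeries τ ℂ)
    (hT : IsGoodPoint fun i : Fin N × ℕ => q i.2 i.1 + if i.2 = 1 then C (A i.1) else 0) :
    ∃ w : Fin N → MvPowerSeries τ ℂ, (∀ α, OrdGE 1 (w α)) ∧
      (∀ α m B, m.degree + 2 ≤ B →
        ∑ β, ∑ b ∈ Finset.range B, coeff m (subst w (lowerOm Om b α β) * q b β) = 0) ∧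
      ∀ a α g, EvaluatesTo (descendantPotential A Om v a α)
          (fun i : Fin N × ℕ => q i.2 i.1 + if i.2 = 1 then C (A i.1) else 0) g ↔
        ∀ m B, m.degree + 2 ≤ B → coeff m g =
          ∑ β, ∑ b ∈ Finset.range B, coeff m (subst w (biOm Om a b α β) * q b β) := by
  obtain ⟨he, hw⟩ := ht.hodograph_eq hF h hb
  have hv := ht.ordGE
  have hs := hasSubst_of_ordGE hv
  set T : Fin N × ℕ → MvPowerSeries τ ℂ :=
    fun i => q i.2 i.1 + if i.2 = 1 then C (A i.1) else 0 with hTdef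
  have hw1 : ∀ α, OrdGE 1 (evalAt T (v α)) := fun α => hT.ordGE_evalAt (by simpa using hw α)
  have hws := hasSubst_of_ordGE hw1
  have h0 : ∀ α, constantCoeff (∑ β, A β • Om 1 α β) = 0 := fun α => by
    rw [← coeff_zero_eq_constantCoeff_apply, map_sum]
    exact Finset.sum_eq_zero fun β _ => by
      rw [coeff_smul, coeff_zero_eq_constantCoeff_apply, hb, mul_zero]
  refine ⟨fun α => evalAt T (v α), hw1, fun α m B hB => ?_, fun a α g => ?_⟩
  · have e : coeff m (evalAt T (hodograph Om v α)) =
        ∑ β, ∑ b ∈ Finset.range B,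
          coeff m (evalAt T (subst v (lowerOm Om b α β)) * T (β, b)) := by
      refine hT.coeff_evalAt_xSum (c := -1) (fun i => ?_) m (by omega)
      refine (WtLE.subst (h.ordGE_lowerOm hb i.2 α i.1) hs hw).mono ?_
      rw [dimWeight]; omega
    simp only [hT.evalAt_subst hv hw] at e
    simp only [hTdef] at e
    rw [sum_range_mul_shift (by omega), he] at e
    -- The dilaton term `A^β Ω^0_{β,0}(w)` is `w` itself, so in the variables `q` the hodograph
    -- equation becomes homogeneous.
    have e1 : ∑ β, A β • subst (fun α => evalAt T (v α)) (lowerOm Om 1 α β) = evalAt T (v α) := by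
      rw [h.lowerOm_one]
      have := congrArg (subst fun α => evalAt T (v α)) (h.one_mulVec hF h0 α)
      rw [subst_X hws, subst_sum_right hws] at this
      rw [← this]
      exact Finset.sum_congr rfl fun β _ => (subst_smul hws _ _).symm
    rw [← hTdef] at e
    rw [e1] at e
    exact (left_eq_add.mp (by rw [add_comm]; exact e))
  · have hW : ∀ b β, WtLE (dimWeight N) (-((a + b + 1 : ℕ) : ℤ)) (subst v (biOm Om a b α β)) :=
      fun b β => WtLE.subst (h.ordGE_biOm hb a b α β) hs hw
    have hxw : WtLE (dimWeight N) (-(a + 2 : ℤ))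
        (xSum fun i : Fin N × ℕ => subst v (biOm Om a i.2 α i.1)) := by
      refine WtLE.xSum fun i => (hW i.2 i.1).mono ?_
      rw [dimWeight]; push_cast; omega
    have hcw : ∀ β, WtLE (dimWeight N) (-(a + 2 : ℤ)) (A β • subst v (biOm Om a 1 α β)) :=
      fun β => ((hW 1 β).mono (by push_cast; omega)).smul _
    have hval : ∀ m B, m.degree + 2 ≤ B → coeff m (evalAt T (descendantPotential A Om v a α)) =
        ∑ β, ∑ b ∈ Finset.range B,
          coeff m (subst (fun α => evalAt T (v α)) (biOm Om a b α β) * q b β) := fun m B hB => by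
      have e := hT.coeff_evalAt_xSum (c := -(a + 2 : ℤ))
        (G := fun i : Fin N × ℕ => subst v (biOm Om a i.2 α i.1))
        (fun i => (hW i.2 i.1).mono (by rw [dimWeight]; push_cast; omega)) m (B := B) (by omega)
      simp only [hT.evalAt_subst hv hw] at e
      simp only [hTdef] at e
      rw [sum_range_mul_shift (by omega), ← hTdef] at e
      rw [descendantPotential_eq, hT.evalAt_sub hxw (WtLE.sum fun β _ => hcw β), map_sub, e,
        hT.evalAt_sum _ hcw]
      simp only [evalAt_smul, hT.evalAt_subst hv hw]
      rw [add_sub_cancel_right]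
    rw [descendantPotential_eq, hT.evaluatesTo_iff (hxw.sub (WtLE.sum fun β _ => hcw β)),
      ← descendantPotential_eq]
    refine ⟨fun hg m B hB => by rw [← hg, hval m B hB], fun hg => MvPowerSeries.ext fun m => ?_⟩
    rw [hval m _ le_rfl, hg m _ le_rfl]

end Evaluation

/-! ### The ancestor cone in terms of the fundamental solution -/

section ConePoints

variable {N : ℕ} {τ : Type} {A : Fin N → ℂ} {F : Fin N → Fun N}
  {Om : ℕ → Matrix (Fin N) (Fin N) (Fun N)}

/-- The loop with coefficient vectors `[z^k] f`. -/
def toLoop (f : Fin N → LSer τ) : Loop N (MvPowerSeries τ ℂ) := fun k α => zcoeff k (f α)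

/-- The value of a matrix at `w`. -/
def matAt (w : Fin N → MvPowerSeries τ ℂ) (M : Matrix (Fin N) (Fin N) (LSer (Fin N))) :
    Matrix (Fin N) (Fin N) (LSer τ) := substMat (fun i => lift (w i)) M

theorem matAt_mul {w : Fin N → MvPowerSeries τ ℂ} (hw : HasSubst w)
    (M M' : Matrix (Fin N) (Fin N) (LSer (Fin N))) :
    matAt w (M * M') = matAt w M * matAt w M' := substMat_mul (hw.map LaurentZ.const) M M'

theorem matAt_one {w : Fin N → MvPowerSeries τ ℂ} (hw : HasSubst w) :
    matAt w (1 : Matrix (Fin N) (Fin N) (LSer (Fin N))) = 1 := substMat_one (hw.map LaurentZ.const)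

variable {w : Fin N → MvPowerSeries τ ℂ}

theorem IsCalibration.matAt_fundSol (h : IsCalibration F Om) (hb : IsBased Om)
    (hw : ∀ α, OrdGE 1 (w α)) (α β : Fin N) :
    matAt w (fundSol Om) α β = descSeq fun j => (-1) ^ j * subst w (Om j α β) := by
  have hs := hasSubst_of_ordGE hw
  rw [matAt, substMat_apply, fundSol, Matrix.of_apply,
    descSeq_subst (h.ordGE_signed hb α β) hs hw]
  congr 1
  funext j
  rw [subst_mul hs]
  congr 1
  rw [← substAlgHom_apply hs, map_pow, map_neg, map_one]

theorem IsCalibration.matAt_fundInv (h : IsCalibration F Om) (hb : IsBased Om)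
    (hw : ∀ α, OrdGE 1 (w α)) (α β : Fin N) :
    matAt w (fundInv Om) α β = descSeq fun j => subst w (lowerOm Om j α β) := by
  have hs := hasSubst_of_ordGE hw
  rw [matAt, substMat_apply, fundInv, Matrix.of_apply,
    descSeq_subst (fun j => h.ordGE_lowerOm hb j α β) hs hw]

theorem IsCalibration.ordGE_signed_subst (h : IsCalibration F Om) (hb : IsBased Om)
    (hw : ∀ α, OrdGE 1 (w α)) (α β : Fin N) (j : ℕ) :
    OrdGE j ((-1) ^ j * subst w (Om j α β)) :=
  ((h.ordGE hb j α β).subst (hasSubst_of_ordGE hw) hw).mul_left _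

theorem IsCalibration.ordGE_lowerOm_subst (h : IsCalibration F Om) (hb : IsBased Om)
    (hw : ∀ α, OrdGE 1 (w α)) (α β : Fin N) (j : ℕ) :
    OrdGE j (subst w (lowerOm Om j α β)) :=
  (h.ordGE_lowerOm hb j α β).subst (hasSubst_of_ordGE hw) hw

theorem IsNeg.sum {ι : Type*} {s : Finset ι} {F : ι → LSer τ} (h : ∀ i ∈ s, IsNeg (F i)) :
    IsNeg (∑ i ∈ s, F i) := fun k hk => by
  rw [map_sum, Finset.sum_eq_zero fun i hi => h i hi k hk]

theorem coeff_mul_zcoeff_descSeq_mul {a : ℕ → MvPowerSeries τ ℂ} (ha : ∀ j, OrdGE j (a j)) (k : ℤ)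
    (f : MvPowerSeries τ ℂ) (F : LSer τ) (m : τ →₀ ℕ) {D : ℕ} (hD : m.degree ≤ D) :
    coeff m (f * zcoeff k (descSeq a * F)) =
      ∑ j ∈ Finset.range (D + 1), coeff m (f * (a j * zcoeff (k + j) F)) := by
  classical
  simp_rw [coeff_mul (n := m) (φ := f)]
  rw [Finset.sum_comm]
  refine Finset.sum_congr rfl fun x hx => ?_
  have hxm : x.2.degree ≤ D := by
    refine le_trans ?_ hD
    rw [← Finset.HasAntidiagonal.mem_antidiagonal.mp hx, map_add]; omega
  rw [coeff_zcoeff_descSeq_mul ha k F x.2 hxm, Finset.mul_sum]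

theorem coeff_neg_one_pow_mul (e : ℕ) (m : τ →₀ ℕ) (g : MvPowerSeries τ ℂ) :
    coeff m ((-1) ^ e * g) = (-1) ^ e * coeff m g := by
  have : ((-1) ^ e : MvPowerSeries τ ℂ) = C ((-1) ^ e) := by simp
  rw [this, coeff_C_mul]

/-- The hodograph equation `∑_b Ω^0_{b-1}(w) q_b = 0`. -/
def SolvesHodograph (Om : ℕ → Matrix (Fin N) (Fin N) (Fun N)) (q : ℕ → Fin N → MvPowerSeries τ ℂ)
    (w : Fin N → MvPowerSeries τ ℂ) : Prop :=
  ∀ α m B, m.degree + 2 ≤ B →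
    ∑ β, ∑ b ∈ Finset.range B, coeff m (subst w (lowerOm Om b α β) * q b β) = 0

/-- The vector `∑_b q_b z^b`. -/
def seqVec (q : ℕ → Fin N → MvPowerSeries τ ℂ) (β : Fin N) : LSer τ := ofSeq fun b => q b β

/-- The coefficient of `z^0` in `T(w)⁻¹ ∑_b q_b z^b` pairs `Ω^0_{b-1}(w)` with `q_b`. -/
theorem IsCalibration.solvesHodograph_iff (h : IsCalibration F Om) (hb : IsBased Om)
    (hw : ∀ α, OrdGE 1 (w α)) (q : ℕ → Fin N → MvPowerSeries τ ℂ) :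
    SolvesHodograph Om q w ↔
      ∀ α, zcoeff 0 ((matAt w (fundInv Om)).mulVec (seqVec q) α) = 0 := by
  have e : ∀ α m D, m.degree ≤ D →
      coeff m (zcoeff 0 ((matAt w (fundInv Om)).mulVec (seqVec q) α)) =
        ∑ β, ∑ b ∈ Finset.range (D + 1), coeff m (subst w (lowerOm Om b α β) * q b β) :=
      fun α m D hD => by
    rw [Matrix.mulVec, dotProduct, map_sum, map_sum]
    refine Finset.sum_congr rfl fun β _ => ?_
    rw [h.matAt_fundInv hb hw, coeff_zcoeff_descSeq_mul (h.ordGE_lowerOm_subst hb hw α β) 0 _ m hD]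
    simp only [zero_add, seqVec, zcoeff_ofSeq]
  constructor
  · intro hE α
    ext m
    rw [e α m (m.degree + 1) (by omega), hE α m _ le_rfl, map_zero]
  · intro hE α m B hB
    obtain ⟨D, rfl⟩ : ∃ D, B = D + 1 := ⟨B - 1, by omega⟩
    rw [← e α m D (by omega), hE, map_zero]

theorem IsCalibration.isNeg_mulVec_fundSol (h : IsCalibration F Om) (hb : IsBased Om)
    (hw : ∀ α, OrdGE 1 (w α)) {x : Fin N → LSer τ} (hx : ∀ α, IsNeg (x α)) (α : Fin N) :
    IsNeg ((matAt w (fundSol Om)).mulVec x α) := IsNeg.sum fun β _ => by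
  change IsNeg (matAt w (fundSol Om) α β * x β)
  rw [h.matAt_fundSol hb hw]
  exact (hx β).descSeq_mul (h.ordGE_signed_subst hb hw α β)

theorem IsCalibration.isNeg_mulVec_fundInv (h : IsCalibration F Om) (hb : IsBased Om)
    (hw : ∀ α, OrdGE 1 (w α)) {x : Fin N → LSer τ} (hx : ∀ α, IsNeg (x α)) (α : Fin N) :
    IsNeg ((matAt w (fundInv Om)).mulVec x α) := IsNeg.sum fun β _ => by
  change IsNeg (matAt w (fundInv Om) α β * x β)
  rw [h.matAt_fundInv hb hw]
  exact (hx β).descSeq_mul (h.ordGE_lowerOm_subst hb hw α β)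

theorem IsCalibration.matAt_fundSol_mul_fundInv (h : IsCalibration F Om) (hb : IsBased Om)
    (hw : ∀ α, OrdGE 1 (w α)) : matAt w (fundSol Om) * matAt w (fundInv Om) = 1 := by
  have hs := hasSubst_of_ordGE hw
  rw [← matAt_mul hs, h.fundSol_mul_fundInv hb, matAt_one hs]

theorem IsCalibration.matAt_fundInv_mul_fundSol (h : IsCalibration F Om) (hb : IsBased Om)
    (hw : ∀ α, OrdGE 1 (w α)) : matAt w (fundInv Om) * matAt w (fundSol Om) = 1 :=
  mul_eq_one_comm.mp (h.matAt_fundSol_mul_fundInv hb hw)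

/-- The nonnegative part of `∑_{j,b} Ω^0_{j-1}(w) q_b z^{b-j}`. -/
def positivePart (Om : ℕ → Matrix (Fin N) (Fin N) (Fun N)) (q : ℕ → Fin N → MvPowerSeries τ ℂ)
    (w : Fin N → MvPowerSeries τ ℂ) (β : Fin N) : LSer τ :=
  nonnegPart ((matAt w (fundInv Om)).mulVec (seqVec q) β)

/-- Cutting `T(w)⁻¹ q` down to its nonnegative part discards negative powers of `z` only, and
`T(w)`, which has no positive powers, keeps them negative. -/
theorem IsCalibration.zcoeff_positivePart (h : IsCalibration F Om) (hb : IsBased Om)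
    (hw : ∀ α, OrdGE 1 (w α)) (q : ℕ → Fin N → MvPowerSeries τ ℂ) (b : ℕ) (α : Fin N) :
    zcoeff (b : ℤ) ((matAt w (fundSol Om)).mulVec (positivePart Om q w) α) = q b α := by
  set y := (matAt w (fundInv Om)).mulVec (seqVec q) with hy
  have e : (matAt w (fundSol Om)).mulVec (positivePart Om q w) =
      seqVec q - (matAt w (fundSol Om)).mulVec (fun β => y β - nonnegPart (y β)) := by
    have : (fun β => y β - nonnegPart (y β)) = y - positivePart Om q w := rfl
    rw [this, Matrix.mulVec_sub, hy, Matrix.mulVec_mulVec, h.matAt_fundSol_mul_fundInv hb hw,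
      Matrix.one_mulVec, sub_sub_cancel]
  rw [e, Pi.sub_apply, map_sub, h.isNeg_mulVec_fundSol hb hw
    (fun β => isNeg_sub_nonnegPart (y β)) α b (by omega), sub_zero, seqVec, zcoeff_ofSeq]

/-- The coefficient of `z^{-a-1}` collects the products `(-1)^{a+1+i} Ω^{a+i}_0 Ω^0_{l-1} q_{i+l}`
with `i, l ≥ 0`. Grouping them by `b = i + l` gives the definition of `Ω^a_b`. -/
theorem IsCalibration.coeff_zcoeff_positivePart (h : IsCalibration F Om) (hb : IsBased Om)
    (hw : ∀ α, OrdGE 1 (w α)) (q : ℕ → Fin N → MvPowerSeries τ ℂ) (a : ℕ) (α : Fin N)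
    (m : τ →₀ ℕ) {B : ℕ} (hB : m.degree + 1 ≤ B) :
    coeff m (zcoeff (-(a : ℤ) - 1) ((matAt w (fundSol Om)).mulVec (positivePart Om q w) α)) =
      ∑ γ, ∑ b ∈ Finset.range B,
        coeff m ((-1) ^ (a + 1) * (subst w (biOm Om a b α γ) * q b γ)) := by
  have hs := hasSubst_of_ordGE hw
  rw [Matrix.mulVec, dotProduct, map_sum, map_sum]
  let P : ℕ → Fin N → Fin N → MvPowerSeries τ ℂ := fun j α β => subst w (Om j α β)
  let L : ℕ → Fin N → Fin N → MvPowerSeries τ ℂ := fun j α β => subst w (lowerOm Om j α β)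
  have e1 : ∀ β, coeff m (zcoeff (-(a : ℤ) - 1)
      (matAt w (fundSol Om) α β * positivePart Om q w β)) =
      ∑ i ∈ Finset.range B, ∑ γ, ∑ l ∈ Finset.range B, coeff m
        ((-1) ^ (a + 1 + i) * P (a + 1 + i) α β * (L l β γ * q (i + l) γ)) := fun β => by
    rw [h.matAt_fundSol hb hw, coeff_zcoeff_descSeq_mul (h.ordGE_signed_subst hb hw α β) _ _ m
      (D := a + B) (by omega), show a + B + 1 = a + 1 + B by omega, Finset.sum_range_add,
      Finset.sum_eq_zero, zero_add]
    · refine Finset.sum_congr rfl fun i _ => ?_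
      rw [show -(a : ℤ) - 1 + ((a + 1 + i : ℕ) : ℤ) = (i : ℤ) by push_cast; ring, positivePart,
        zcoeff_nonnegPart _ (by omega), Matrix.mulVec, dotProduct, map_sum, Finset.mul_sum, map_sum]
      refine Finset.sum_congr rfl fun γ _ => ?_
      obtain ⟨D, rfl⟩ : ∃ D, B = D + 1 := ⟨B - 1, by omega⟩
      rw [h.matAt_fundInv hb hw, coeff_mul_zcoeff_descSeq_mul (h.ordGE_lowerOm_subst hb hw β γ)
        _ _ _ m (D := D) (by omega)]
      refine Finset.sum_congr rfl fun l _ => ?_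
      rw [seqVec, ← Nat.cast_add, zcoeff_ofSeq]
    · intro j hj
      have hj : j < a + 1 := Finset.mem_range.mp hj
      rw [positivePart, isNonneg_nonnegPart _ _ (by omega), mul_zero, map_zero]
  rw [Finset.sum_congr rfl fun β _ => e1 β]
  have e2 : ∑ β, ∑ i ∈ Finset.range B, ∑ γ, ∑ l ∈ Finset.range B, coeff m
        ((-1) ^ (a + 1 + i) * P (a + 1 + i) α β * (L l β γ * q (i + l) γ)) =
      ∑ γ, ∑ l ∈ Finset.range B, ∑ i ∈ Finset.range B, ∑ β, coeff m
        ((-1) ^ (a + 1 + i) * P (a + 1 + i) α β * (L l β γ * q (i + l) γ)) := by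
    rw [Finset.sum_comm]
    simp_rw [Finset.sum_comm (s := Finset.univ) (t := Finset.range B)]
    rw [Finset.sum_comm]
    refine Finset.sum_congr rfl fun l _ => Finset.sum_congr rfl fun i _ => ?_
    rw [Finset.sum_comm]
  rw [e2]
  refine Finset.sum_congr rfl fun γ _ => ?_
  let f : ℕ → ℕ → ℂ := fun l i => ∑ β, coeff m
    ((-1) ^ (a + 1 + i) * P (a + 1 + i) α β * (L l β γ * q (i + l) γ))
  -- Products with `i + l ≥ B` vanish to an order above the degree of `m`, so the square of
  -- summation shrinks to a triangle.
  have e3 : ∀ l ∈ Finset.range B, ∑ i ∈ Finset.range B, f l i =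
      ∑ i ∈ Finset.range (B - l), f l i := fun l _ => by
    symm
    refine Finset.sum_subset (Finset.range_mono (by omega)) fun i _ hi => ?_
    have hi : B - l ≤ i := by simpa using hi
    refine Finset.sum_eq_zero fun β _ => ?_
    refine (OrdGE.mul (k := a + 1 + i) (l := l) (h.ordGE_signed_subst hb hw α β _)
      ((h.ordGE_lowerOm_subst hb hw β γ l).mul_right _)) m (by omega)
  rw [Finset.sum_congr rfl e3, ← Finset.sum_range_diag_flip]
  refine Finset.sum_congr rfl fun b _ => ?_
  rw [biOm, Matrix.sum_apply, subst_sum_right hs, Finset.sum_mul, Finset.mul_sum, map_sum]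
  refine Finset.sum_congr rfl fun l hl => ?_
  have hl : l ≤ b := by simpa [Nat.lt_succ_iff] using hl
  obtain ⟨i, rfl⟩ := Nat.exists_eq_add_of_le hl
  rw [show l + i - l = i by omega, show a + (l + i) - l + 1 = a + 1 + i by omega]
  change ∑ β, coeff m _ = _
  rw [← map_sum]
  congr 1
  have e4 : subst w (((-1) ^ i * (Om (a + 1 + i) * lowerOm Om l)) α γ) =
      (-1) ^ i * ∑ β, P (a + 1 + i) α β * L l β γ := by
    have : ((-1) ^ i * (Om (a + 1 + i) * lowerOm Om l)) α γ =
        (-1) ^ i * ∑ β, Om (a + 1 + i) α β * lowerOm Om l β γ := by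
      rcases neg_one_pow_eq_or (Matrix (Fin N) (Fin N) (Fun N)) i with h1 | h1 <;>
      rcases Nat.even_or_odd i with h2 | h2
      · rw [h2.neg_one_pow, h2.neg_one_pow, one_mul, one_mul, Matrix.mul_apply]
      · rw [h2.neg_one_pow, h2.neg_one_pow, Matrix.neg_mul, Matrix.neg_apply, one_mul,
          Matrix.mul_apply, neg_one_mul]
      · rw [h2.neg_one_pow, h2.neg_one_pow, one_mul, one_mul, Matrix.mul_apply]
      · rw [h2.neg_one_pow, h2.neg_one_pow, Matrix.neg_mul, Matrix.neg_apply, one_mul,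
          Matrix.mul_apply, neg_one_mul]
    rw [this, subst_mul hs, subst_sum_right hs]
    simp_rw [subst_mul hs]
    congr 1
    rw [← substAlgHom_apply hs, map_pow, map_neg, map_one]
  rw [e4, Finset.mul_sum, Finset.sum_mul, Finset.mul_sum]
  refine Finset.sum_congr rfl fun β _ => ?_
  rw [pow_add _ (a + 1) i, add_comm i l]
  ring

/-- The hodograph equation determines the solution. -/
theorem SolvesHodograph.unique (hF : IsVectorPotential A F) (h : IsCalibration F Om)
    (hb : IsBased Om) {q : ℕ → Fin N → MvPowerSeries τ ℂ}
    (hT : IsGoodPoint fun i : Fin N × ℕ => q i.2 i.1 + if i.2 = 1 then C (A i.1) else 0)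
    {w w' : Fin N → MvPowerSeries τ ℂ} (hw : ∀ α, OrdGE 1 (w α)) (hw' : ∀ α, OrdGE 1 (w' α))
    (he : SolvesHodograph Om q w) (he' : SolvesHodograph Om q w') : w = w' := by
  have h0 : ∀ α, constantCoeff (∑ β, A β • Om 1 α β) = 0 := fun α => by
    rw [← coeff_zero_eq_constantCoeff_apply, map_sum]
    exact Finset.sum_eq_zero fun β _ => by
      rw [coeff_smul, coeff_zero_eq_constantCoeff_apply, hb, mul_zero]
  have key : ∀ {w : Fin N → MvPowerSeries τ ℂ}, (∀ α, OrdGE 1 (w α)) → SolvesHodograph Om q w →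
      ∀ α m, coeff m (w α) = ∑ β, ∑ b ∈ Finset.range (m.degree + 2),
        coeff m (subst w (lowerOm Om b α β) * (q b β + if b = 1 then C (A β) else 0)) := by
    intro w hw he α m
    have hs := hasSubst_of_ordGE hw
    rw [sum_range_mul_shift (by omega), he α m _ le_rfl, zero_add]
    have := congrArg (subst w) (h.one_mulVec hF h0 α)
    rw [subst_X hs, subst_sum_right hs] at this
    rw [← this, h.lowerOm_one]
    simp only [subst_smul hs]
  have : ∀ k α, OrdGE k (w α - w' α) := fun k => by
    induction k with
    | zero => exact fun α => OrdGE.zero_left _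
    | succ k ih =>
      intro α m hm
      rw [map_sub, key hw he α m, key hw' he' α m, ← Finset.sum_sub_distrib]
      refine Finset.sum_eq_zero fun β _ => ?_
      rw [← Finset.sum_sub_distrib]
      refine Finset.sum_eq_zero fun b _ => ?_
      rw [← map_sub, ← sub_mul]
      -- The gain of one order has two sources: for `b ≥ 2` the matrix `Ω^0_{b-1}` has no linear
      -- term, and for `b ≤ 1` the value of `t_b` has no constant term.
      rcases lt_or_ge 1 b with hb1 | hb1
      · refine (OrdGE.subst_sub_subst (c := 1) (hasSubst_of_ordGE hw) (hasSubst_of_ordGE hw') hw hw'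
          ih fun n _ hn => h.ordGE_lowerOm hb b α β n (by omega)).mul_right _ m hm
      · exact (OrdGE.mul (ordGE_subst_sub_subst (lowerOm Om b α β) hw hw' ih) (hT β b hb1)) m hm
  exact funext fun α => eq_of_ordGE_sub fun k => this k α

variable {Fa : ℕ → Fin N → BigFun N}

/-- The points of the ancestor cone. -/
theorem IsAncestorPotentials.exists_mem_cone_iff (hF : IsVectorPotential A F)
    (hFa : IsAncestorPotentials A F Fa) : ∃ Om, IsCalibration F Om ∧ IsBased Om ∧
      ∀ (τ : Type) (f : Loop N (MvPowerSeries τ ℂ)), f ∈ cone A Fa τ ↔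
        ∃ (w : Fin N → MvPowerSeries τ ℂ) (y : Fin N → LSer τ), (∀ α, OrdGE 1 (w α)) ∧
          (∀ α, IsNonneg (y α)) ∧ (∀ α, constantCoeff (zcoeff 0 (y α)) = -A α) ∧
          f = toLoop ((matAt w (fundSol Om)).mulVec fun α => zpow 1 * y α) := by
  obtain ⟨Om, v, h, h0, ht, hFd, hd⟩ := hFa
  obtain rfl : Fa = descendantPotential A Om v := funext fun a => funext fun α => hFd a α
  have hb := isBased_of_ancestor h h0 ht hd
  refine ⟨Om, h, hb, fun τ f => ⟨fun hf => ?_, ?_⟩⟩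
  · obtain ⟨hf0, hf1, hfe⟩ := hf
    let q : ℕ → Fin N → MvPowerSeries τ ℂ := fun b α => f b α
    have hT : IsGoodPoint fun i : Fin N × ℕ => q i.2 i.1 + if i.2 = 1 then C (A i.1) else 0 := by
      intro β b hb1
      rw [ordGE_one_iff]
      interval_cases b
      · simpa [q] using hf0 β
      · simp [q, hf1 β]
    obtain ⟨w, hw, hE, hval⟩ := exists_value hF h hb ht q hT
    have hE : SolvesHodograph Om q w := hE
    have hE0 := (h.solvesHodograph_iff hb hw q).mp hE
    -- By the hodograph equation the nonnegative part of `T(w)⁻¹ q` has no `z^0` term, so it can be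
    -- divided by `z`.
    refine ⟨w, fun α => zpow (-1) * positivePart Om q w α, hw, fun α k hk => ?_, fun α => ?_, ?_⟩
    · rw [zcoeff_zpow_mul, positivePart]
      rcases eq_or_ne k (-1) with rfl | hk1
      · rw [sub_self, zcoeff_nonnegPart _ le_rfl, hE0]
      · exact isNonneg_nonnegPart _ _ (by omega)
    · rw [zcoeff_zpow_mul, positivePart, zcoeff_nonnegPart _ (by omega),
        ← coeff_zero_eq_constantCoeff_apply, Matrix.mulVec, dotProduct, map_sum, map_sum]
      have : ∀ β, coeff 0 (zcoeff (0 - -1) (matAt w (fundInv Om) α β * seqVec q β)) =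
          if α = β then -A β else 0 := fun β => by
        rw [h.matAt_fundInv hb hw, coeff_zcoeff_descSeq_mul (h.ordGE_lowerOm_subst hb hw α β) _ _ 0
          (D := 0) (by simp), Finset.sum_range_one, h.lowerOm_zero, Matrix.one_apply]
        have e1 : zcoeff (0 - -1 + ((0 : ℕ) : ℤ)) (seqVec q β) = q 1 β := zcoeff_ofSeq _ 1
        rw [e1]
        split_ifs
        · rw [subst_one_right (hasSubst_of_ordGE hw), one_mul]; exact hf1 β
        · rw [subst_zero_right (hasSubst_of_ordGE hw), zero_mul, map_zero]
      rw [Finset.sum_congr rfl fun β _ => this β]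
      simp
    · have e : (fun α => zpow 1 * (zpow (-1) * positivePart Om q w α)) = positivePart Om q w :=
        funext fun α => by rw [← mul_assoc, zpow_mul_zpow, add_neg_cancel, zpow_zero, one_mul]
      rw [e]
      funext k α
      rcases lt_or_ge k 0 with hk | hk
      · obtain ⟨a, rfl⟩ : ∃ a : ℕ, k = -(a : ℤ) - 1 := ⟨(-k - 1).toNat, by omega⟩
        ext m
        rw [toLoop, h.coeff_zcoeff_positivePart hb hw q a α m (B := m.degree + 2) (by omega)]
        have hv := (hval a α _).mp (hfe a α)
        have hv := hv m _ le_rfl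
        rw [coeff_neg_one_pow_mul] at hv
        simp_rw [coeff_neg_one_pow_mul, ← Finset.mul_sum]
        rw [← hv, ← mul_assoc, ← pow_add, ← two_mul, pow_mul, neg_one_sq, one_pow, one_mul]
      · lift k to ℕ using hk
        exact (h.zcoeff_positivePart hb hw q k α).symm
  · rintro ⟨w, y, hw, hy, hyA, rfl⟩
    set f := toLoop ((matAt w (fundSol Om)).mulVec fun α => zpow 1 * y α) with hf
    have hc : ∀ k α, constantCoeff (f k α) = constantCoeff (zcoeff (k - 1) (y α)) := fun k α => by
      rw [hf, toLoop, ← coeff_zero_eq_constantCoeff_apply, Matrix.mulVec, dotProduct, map_sum,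
        map_sum]
      have : ∀ β, coeff 0 (zcoeff k (matAt w (fundSol Om) α β * (zpow 1 * y β))) =
          if α = β then constantCoeff (zcoeff (k - 1) (y β)) else 0 := fun β => by
        rw [h.matAt_fundSol hb hw, coeff_zcoeff_descSeq_mul (h.ordGE_signed_subst hb hw α β) _ _ 0
          (D := 0) (by simp), Finset.sum_range_one, h.zero, Matrix.one_apply, pow_zero, one_mul,
          zcoeff_zpow_mul, Nat.cast_zero, add_zero]
        split_ifs
        · rw [subst_one_right (hasSubst_of_ordGE hw), one_mul]; rfl
        · rw [subst_zero_right (hasSubst_of_ordGE hw), zero_mul, map_zero]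
      rw [Finset.sum_congr rfl fun β _ => this β]
      simp
    have hf0 : ∀ α, constantCoeff (f 0 α) = 0 := fun α => by
      rw [hc, hy α _ (by omega), map_zero]
    have hf1 : ∀ α, constantCoeff (f 1 α) = -A α := fun α => by rw [hc, sub_self, hyA]
    let q : ℕ → Fin N → MvPowerSeries τ ℂ := fun b α => f b α
    have hT : IsGoodPoint fun i : Fin N × ℕ => q i.2 i.1 + if i.2 = 1 then C (A i.1) else 0 := by
      intro β b hb1
      rw [ordGE_one_iff]
      interval_cases b
      · simpa [q] using hf0 β
      · simp [q, hf1 β]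
    obtain ⟨w', hw', hE', hval⟩ := exists_value hF h hb ht q hT
    set x : Fin N → LSer τ := fun α => zpow 1 * y α with hx
    set fv := (matAt w (fundSol Om)).mulVec x with hfv
    -- The evaluation sees only the nonnegative part `q` of the loop; dropping the rest changes
    -- `T(w)⁻¹` of it in negative powers only. Hence the given `w` solves the hodograph equation for
    -- `q` and, by uniqueness, is the value of the topological solution.
    have hxq : (matAt w (fundInv Om)).mulVec (seqVec q) =
        x - (matAt w (fundInv Om)).mulVec fun β => fv β - nonnegPart (fv β) := by
      have : (fun β => fv β - nonnegPart (fv β)) = fv - seqVec q := rfl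
      rw [this, Matrix.mulVec_sub, hfv, Matrix.mulVec_mulVec, h.matAt_fundInv_mul_fundSol hb hw,
        Matrix.one_mulVec, sub_sub_cancel]
    have hneg := h.isNeg_mulVec_fundInv hb hw fun β => isNeg_sub_nonnegPart (fv β)
    have hxk : ∀ k : ℤ, 0 ≤ k → ∀ α, zcoeff k ((matAt w (fundInv Om)).mulVec (seqVec q) α) =
        zcoeff k (x α) := fun k hk α => by
      rw [hxq, Pi.sub_apply, map_sub, hneg α k hk, sub_zero]
    have hx0 : ∀ k < 1, ∀ α, zcoeff k (x α) = 0 := fun k hk α => by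
      rw [hx, zcoeff_zpow_mul, hy α _ (by omega)]
    have hE : SolvesHodograph Om q w := (h.solvesHodograph_iff hb hw q).mpr fun α => by
      rw [hxk 0 le_rfl, hx0 0 (by omega)]
    obtain rfl : w = w' := SolvesHodograph.unique hF h hb hT hw hw' hE hE'
    have hpos : positivePart Om q w = x := funext fun α => zcoeff_ext fun k => by
      rcases lt_or_ge k 0 with hk | hk
      · rw [positivePart, isNonneg_nonnegPart _ k hk, hx0 k (by omega)]
      · rw [positivePart, zcoeff_nonnegPart _ hk, hxk k hk]
    refine ⟨hf0, hf1, fun a α => (hval a α _).mpr fun m B hB => ?_⟩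
    have e1 := h.coeff_zcoeff_positivePart hb hw q a α m (B := B) (by omega)
    rw [hpos] at e1
    simp_rw [coeff_neg_one_pow_mul, ← Finset.mul_sum] at e1
    change _ = _ at e1
    rw [coeff_neg_one_pow_mul, show coeff m (f (-(a : ℤ) - 1) α) = _ from e1, ← mul_assoc, ← pow_add, ← two_mul,
      pow_mul, neg_one_sq, one_pow, one_mul]

end ConePoints

/-! ### Power series of matrices acting on loops -/

section LoopMat

variable {N : ℕ} {σ : Type*} {τ : Type}

/-- A power series `∑_k M_k z^k` of matrices as a matrix over `ℂ((z))[[σ]]`. -/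
def loopMat (P : PowerSeries (Matrix (Fin N) (Fin N) (MvPowerSeries σ ℂ))) :
    Matrix (Fin N) (Fin N) (LSer σ) :=
  Matrix.of fun α β => ofSeq fun k => PowerSeries.coeff k P α β

theorem loopMat_apply (P : PowerSeries (Matrix (Fin N) (Fin N) (MvPowerSeries σ ℂ)))
    (α β : Fin N) : loopMat P α β = ofSeq fun k => PowerSeries.coeff k P α β := rfl

theorem isNonneg_loopMat (P : PowerSeries (Matrix (Fin N) (Fin N) (MvPowerSeries σ ℂ)))
    (α β : Fin N) : IsNonneg (loopMat P α β) := isNonneg_ofSeq _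

theorem zcoeff_loopMat (P : PowerSeries (Matrix (Fin N) (Fin N) (MvPowerSeries σ ℂ)))
    (α β : Fin N) (k : ℕ) : zcoeff (k : ℤ) (loopMat P α β) = PowerSeries.coeff k P α β :=
  zcoeff_ofSeq _ k

theorem zcoeff_zero_loopMat (P : PowerSeries (Matrix (Fin N) (Fin N) (MvPowerSeries σ ℂ)))
    (α β : Fin N) : zcoeff 0 (loopMat P α β) = PowerSeries.constantCoeff P α β :=
  (zcoeff_loopMat P α β 0).trans (by rw [PowerSeries.coeff_zero_eq_constantCoeff_apply])

theorem loopMat_mul (P P' : PowerSeries (Matrix (Fin N) (Fin N) (MvPowerSeries σ ℂ))) :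
    loopMat (P * P') = loopMat P * loopMat P' := by
  ext1 α β
  rw [Matrix.mul_apply]
  simp_rw [loopMat_apply, ofSeq_mul]
  refine zcoeff_ext fun k => ?_
  rw [map_sum]
  rcases lt_or_ge k 0 with hk | hk
  · simp_rw [zcoeff_ofSeq_neg _ hk, Finset.sum_const_zero]
  · lift k to ℕ using hk
    simp_rw [zcoeff_ofSeq]
    rw [PowerSeries.coeff_mul, Matrix.sum_apply, Finset.sum_comm]
    rfl

theorem loopMat_C (M : Matrix (Fin N) (Fin N) (MvPowerSeries σ ℂ)) :
    loopMat (PowerSeries.C M) = M.map lift := by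
  ext1 α β
  refine zcoeff_ext fun k => ?_
  rw [Matrix.map_apply, zcoeff_lift]
  rcases lt_or_ge k 0 with hk | hk
  · rw [isNonneg_loopMat _ _ _ k hk, if_neg (by omega)]
  · lift k to ℕ using hk
    rw [zcoeff_loopMat, PowerSeries.coeff_C]
    rcases eq_or_ne k 0 with rfl | h
    · simp
    · rw [if_neg h, if_neg (by exact_mod_cast h), Matrix.zero_apply]

theorem loopMat_one : loopMat (1 : PowerSeries (Matrix (Fin N) (Fin N) (MvPowerSeries σ ℂ))) = 1 := by
  rw [← map_one PowerSeries.C, loopMat_C, Matrix.map_one _ (map_zero _) (map_one _)]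

/-- The action of `End(ℂᴺ)[[z]]` on vectors over `ℂ((z))[[σ]]`. -/
def constLoopMat (σ : Type*) (R : EndSeries N) : Matrix (Fin N) (Fin N) (LSer σ) :=
  loopMat (PowerSeries.map (C : ℂ →+* MvPowerSeries σ ℂ).mapMatrix R)

theorem constLoopMat_mul (R R' : EndSeries N) :
    constLoopMat σ (R * R') = constLoopMat σ R * constLoopMat σ R' := by
  rw [constLoopMat, map_mul, loopMat_mul]; rfl

theorem constLoopMat_one : constLoopMat σ (1 : EndSeries N) = 1 := by
  rw [constLoopMat, map_one, loopMat_one]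

theorem constLoopMat_apply (R : EndSeries N) (α β : Fin N) :
    constLoopMat σ R α β =
      C (LaurentZ.ofPS (PowerSeries.mk fun k => PowerSeries.coeff k R α β)) := by
  classical
  refine MvPowerSeries.ext fun m => ?_
  rw [constLoopMat, loopMat_apply, coeff_ofSeq, coeff_C]
  have : ∀ k, PowerSeries.coeff k (PowerSeries.map (C : ℂ →+* MvPowerSeries σ ℂ).mapMatrix R) α β =
      C (PowerSeries.coeff k R α β) := fun k => by rw [PowerSeries.coeff_map]; rfl
  simp_rw [this, coeff_C]
  split_ifs with h
  · rfl
  · exact map_zero LaurentZ.ofPS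

/-- Each monomial in the parameters has a Laurent series in `z` as its coefficient, so the
coefficientwise action is finite and becomes matrix multiplication over `ℂ((z))[[τ]]`. -/
theorem zcoeff_constLoopMat_mulVec (R : EndSeries N) (f : Fin N → LSer τ) :
    LoopMulDefined R (toLoop f) ∧
      loopMul R (toLoop f) = toLoop ((constLoopMat τ R).mulVec f) := by
  have e : ∀ (k : ℤ) α (m : τ →₀ ℕ) μ,
      {i : ℕ | PowerSeries.coeff i R α μ * coeff m (zcoeff (k - i) (f μ)) ≠ 0}.Finite ∧
      coeff m (zcoeff k (constLoopMat τ R α μ * f μ)) =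
        ∑ᶠ i : ℕ, PowerSeries.coeff i R α μ * coeff m (zcoeff (k - i) (f μ)) := fun k α m μ => by
    have := LaurentZ.zc_ofPS_mul k (PowerSeries.mk fun k => PowerSeries.coeff k R α μ)
      (coeff m (f μ))
    simp only [PowerSeries.coeff_mk] at this
    rw [constLoopMat_apply, coeff_zcoeff, coeff_C_mul]
    exact this
  refine ⟨fun k α m => ?_, ?_⟩
  · refine (Set.finite_iUnion fun μ => (e k α m μ).1).subset fun i hi => ?_
    obtain ⟨μ, -, hμ⟩ := Finset.exists_ne_zero_of_sum_ne_zero hi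
    exact Set.mem_iUnion.mpr ⟨μ, hμ⟩
  · funext k α
    ext m
    change ∑ᶠ i : ℕ, ∑ μ, _ = coeff m (zcoeff k (∑ μ, constLoopMat τ R α μ * f μ))
    rw [map_sum, map_sum, Finset.sum_congr rfl fun μ _ => (e k α m μ).2]
    exact finsum_sum_comm _ _ fun μ _ => (e k α m μ).1

end LoopMat

/-! ### The constant part -/

section ConstantPart

variable {N : ℕ} {A : Fin N → ℂ} {F : Fin N → Fun N}

theorem structureConst_constantPart (F : Fin N → Fun N) (α β γ : Fin N) :
    structureConst (constantPart F) α β γ = C (structureConstAtZero F α β γ) := by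
  classical
  have hc : ∀ β γ, structureConstAtZero F α β γ = structureConstAtZero F α γ β := fun β γ => by
    rw [structureConstAtZero, structureConst_comm, structureConstAtZero]
  have e : ∀ β' γ' : Fin N, pderiv ℂ β (pderiv ℂ γ
      (C (structureConstAtZero F α β' γ' / 2) * X β' * X γ' : Fun N)) =
      C (structureConstAtZero F α β' γ' / 2 *
        ((if β' = γ then 1 else 0) * (if γ' = β then 1 else 0) +
          (if β' = β then 1 else 0) * (if γ' = γ then 1 else 0))) := fun β' γ' => by
    have hX : ∀ i j : Fin N, pderiv ℂ i (X j : Fun N) = C (if j = i then 1 else 0) := fun i j => by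
      rw [pderiv_X, Pi.single_apply]
      split_ifs <;> simp_all
    simp only [Derivation.leibniz, map_add, pderiv_C, hX, smul_eq_mul, mul_zero, add_zero, map_mul]
    ring
  rw [structureConst, constantPart]
  simp only [map_sum, e]
  simp only [← map_sum]
  congr 1
  simp only [mul_add, Finset.sum_add_distrib, mul_ite, mul_one, mul_zero, Finset.sum_ite_eq',
    Finset.mem_univ, if_true]
  rw [hc γ β]
  ring

theorem mulMat_constantPart (F : Fin N → Fun N) (γ : Fin N) :
    mulMat (constantPart F) γ = (atZero (mulMat F γ)).map C := by
  ext1 α β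
  exact structureConst_constantPart F α γ β

theorem IsVectorPotential.constantPart (hF : IsVectorPotential A F) :
    IsVectorPotential A (constantPart F) where
  unit α β := by
    have e := congrArg constantCoeff (hF.unit α β)
    simp only [structureConst_constantPart, structureConstAtZero, smul_eq_C_mul, ← map_mul,
      ← map_sum] at e ⊢
    have e1 : ∑ μ, A μ * constantCoeff (structureConst F α μ β) = if α = β then 1 else 0 := by
      rw [map_sum] at e
      simp only [map_mul, constantCoeff_C] at e
      rw [e]
      split_ifs <;> simp
    rw [e1]
    split_ifs <;> simp
  assoc α β γ δ := by
    have e := congrArg constantCoeff (hF.assoc α β γ δ)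
    simp only [structureConst_constantPart, structureConstAtZero, ← map_mul, ← map_sum] at e ⊢
    rw [e]

end ConstantPart

/-! ### Frames -/

section Frame

variable {N : ℕ} {A : Fin N → ℂ} {F : Fin N → Fun N} {u H : Fin N → Fun N}
  {D : Fin N → Fin N → Fun N} {Γt : Matrix (Fin N) (Fin N) (Fun N)}
  {R : ℕ → Matrix (Fin N) (Fin N) (Fun N)}

theorem dU_eq (u : Fin N → Fun N) (γ : Fin N) :
    dU u γ = Matrix.diagonal fun i => jacobian u i γ := by
  ext1 i j
  rw [dU, dMat, Matrix.map_apply, Matrix.diagonal_apply, Matrix.diagonal_apply]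
  split_ifs
  · rfl
  · exact map_zero _

/-- The columns of the inverse Jacobian are the idempotents `∂/∂u^k`, common eigenvectors of
multiplication with eigenvalues `∂u^k/∂t^δ`. -/
theorem IsCanonicalCoordinates.mulMat_mul_inv (h : IsCanonicalCoordinates F u) (δ : Fin N) :
    mulMat F δ * (jacobian u)⁻¹ = (jacobian u)⁻¹ * dU u δ := by
  have hIJ : (jacobian u)⁻¹ * jacobian u = 1 := Matrix.nonsing_inv_mul _ h.isUnit_det
  ext1 α l
  rw [dU_eq, Matrix.mul_diagonal, Matrix.mul_apply]
  set I := (jacobian u)⁻¹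
  -- Expansion of `∂/∂t^δ` in the idempotents.
  have e : ∀ γ, mulMat F δ α γ =
      ∑ k, ∑ β, structureConst F α β γ * I β k * jacobian u k δ := fun γ => by
    rw [Finset.sum_comm]
    simp_rw [mul_assoc, ← Finset.mul_sum, ← Matrix.mul_apply, hIJ, Matrix.one_apply]
    simp
  simp_rw [e, Finset.sum_mul]
  rw [Finset.sum_comm]
  have e2 : ∀ k, ∑ γ, ∑ β, structureConst F α β γ * I β k * jacobian u k δ * I γ l =
      jacobian u k δ * if k = l then I α k else 0 := fun k => by
    rw [← h.mul_eq k l α, Finset.sum_comm, Finset.mul_sum]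
    refine Finset.sum_congr rfl fun β _ => ?_
    rw [Finset.mul_sum]
    exact Finset.sum_congr rfl fun γ _ => by ring
  simp_rw [e2]
  simp [mul_comm]

theorem IsCanonicalCoordinates.jacobian_mul_mulMat (h : IsCanonicalCoordinates F u) (δ : Fin N) :
    jacobian u * mulMat F δ = dU u δ * jacobian u := by
  have hIJ : (jacobian u)⁻¹ * jacobian u = 1 := Matrix.nonsing_inv_mul _ h.isUnit_det
  have hJI : jacobian u * (jacobian u)⁻¹ = 1 := Matrix.mul_nonsing_inv _ h.isUnit_det
  have := congrArg (fun M => jacobian u * M * jacobian u) (h.mulMat_mul_inv δ)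
  simpa only [Matrix.mul_assoc, hIJ, Matrix.mul_one, ← Matrix.mul_assoc (jacobian u) (jacobian u)⁻¹,
    hJI, Matrix.one_mul] using this

theorem diagonal_mul_comm {n S : Type*} [Fintype n] [DecidableEq n] [CommRing S] (a b : n → S) :
    Matrix.diagonal a * Matrix.diagonal b = Matrix.diagonal b * Matrix.diagonal a := by
  rw [Matrix.diagonal_mul_diagonal, Matrix.diagonal_mul_diagonal]
  simp_rw [mul_comm]

theorem isUnit_det_diagonal (hH : ∀ i, IsUnit (H i)) : IsUnit (Matrix.diagonal H).det := by
  rw [Matrix.det_diagonal]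
  exact IsUnit.prod_univ_iff.mpr hH

theorem IsSemisimpleFrame.isUnit_det_frame (h : IsSemisimpleFrame F u D Γt H R) :
    IsUnit (frameMatrix u H).det := by
  rw [frameMatrix, Matrix.det_mul]
  exact (isUnit_det_diagonal h.isUnit_H).mul h.canonical.isUnit_det

theorem IsSemisimpleFrame.frame_mul_mulMat (h : IsSemisimpleFrame F u D Γt H R) (γ : Fin N) :
    frameMatrix u H * mulMat F γ = dU u γ * frameMatrix u H := by
  rw [frameMatrix, Matrix.mul_assoc, h.canonical.jacobian_mul_mulMat, ← Matrix.mul_assoc,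
    ← Matrix.mul_assoc, dU_eq, diagonal_mul_comm]

/-- A gauge transformation: `dH H⁻¹ = -D̃` cancels the diagonal part of the connection, and `H`
commutes with `dU`, so the rest becomes `[Γ, dU]`. -/
theorem pdMat_frameMatrix (hJ : IsUnit (jacobian u).det) (hHu : ∀ i, IsUnit (H i)) {γ : Fin N}
    (hconn : dMat γ (jacobian u) * (jacobian u)⁻¹ =
      Matrix.diagonal (D γ) + (Γt * dU u γ - dU u γ * Γt))
    (hdH : ∀ i, pderiv ℂ γ (H i) = -(D γ i * H i)) :
    pdMat γ (frameMatrix u H) =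
      (rotationMatrix H Γt * dU u γ - dU u γ * rotationMatrix H Γt) * frameMatrix u H := by
  have hIJ : (jacobian u)⁻¹ * jacobian u = 1 := Matrix.nonsing_inv_mul _ hJ
  have hH : (Matrix.diagonal H)⁻¹ * Matrix.diagonal H = 1 :=
    Matrix.nonsing_inv_mul _ (isUnit_det_diagonal hHu)
  have e1 : pdMat γ (Matrix.diagonal H) = -(Matrix.diagonal H * Matrix.diagonal (D γ)) := by
    ext1 i j
    rw [Matrix.diagonal_mul_diagonal, pdMat_apply, Matrix.neg_apply, Matrix.diagonal_apply,
      Matrix.diagonal_apply]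
    split_ifs
    · rw [hdH, mul_comm]
    · rw [map_zero, neg_zero]
  have e2 : pdMat γ (jacobian u) =
      (Matrix.diagonal (D γ) + (Γt * dU u γ - dU u γ * Γt)) * jacobian u := by
    rw [← hconn, Matrix.mul_assoc, hIJ, Matrix.mul_one, dMat_eq_pdMat]
  have e3 : Matrix.diagonal H * dU u γ = dU u γ * Matrix.diagonal H := by
    rw [dU_eq, diagonal_mul_comm]
  rw [frameMatrix, pdMat_mul, e1, e2, rotationMatrix]
  have e4 : (Matrix.diagonal H * Γt * (Matrix.diagonal H)⁻¹ * dU u γ -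
      dU u γ * (Matrix.diagonal H * Γt * (Matrix.diagonal H)⁻¹)) * Matrix.diagonal H =
      Matrix.diagonal H * (Γt * dU u γ - dU u γ * Γt) := by
    rw [Matrix.sub_mul, Matrix.mul_sub]
    simp only [Matrix.mul_assoc, hH, ← e3, Matrix.mul_one]
    rw [← Matrix.mul_assoc (Matrix.diagonal H)⁻¹, hH, Matrix.one_mul,
      ← Matrix.mul_assoc (dU u γ), ← e3, Matrix.mul_assoc]
  rw [← Matrix.mul_assoc _ (Matrix.diagonal H), e4, Matrix.add_mul, Matrix.mul_add, Matrix.neg_mul,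
    Matrix.mul_assoc, Matrix.mul_assoc, neg_add_cancel_left]

theorem IsSemisimpleFrame.pdMat_frame (h : IsSemisimpleFrame F u D Γt H R) (γ : Fin N) :
    pdMat γ (frameMatrix u H) =
      (rotationMatrix H Γt * dU u γ - dU u γ * rotationMatrix H Γt) * frameMatrix u H :=
  pdMat_frameMatrix h.canonical.isUnit_det h.isUnit_H (h.connection γ) (h.deriv_H γ)

/-! ### The formal solution at the irregular singularity -/

theorem pdMat_loopMat {P P' : PowerSeries (Matrix (Fin N) (Fin N) (Fun N))} (γ : Fin N)
    (h0 : PowerSeries.constantCoeff P' = 0)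
    (h : ∀ k, pdMat γ (PowerSeries.coeff k P) = PowerSeries.coeff (k + 1) P') :
    pdMat γ (loopMat P) = zMul (-1) (loopMat P') := by
  ext1 α β
  refine zcoeff_ext fun k => ?_
  rw [pdMat_apply, zcoeff_pderiv, zMul_apply, zcoeff_zpow_mul]
  rcases lt_trichotomy k (-1) with hk | rfl | hk
  · rw [isNonneg_loopMat _ _ _ k (by omega), isNonneg_loopMat _ _ _ _ (by omega), map_zero]
  · rw [isNonneg_loopMat _ _ _ (-1) (by omega), sub_self, zcoeff_zero_loopMat, h0, map_zero]
    rfl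
  · lift k to ℕ using (by omega)
    rw [zcoeff_loopMat, sub_neg_eq_add, show (k : ℤ) + 1 = ((k + 1 : ℕ) : ℤ) by push_cast; rfl,
      zcoeff_loopMat, ← h, pdMat_apply]

theorem loopMat_sub (P P' : PowerSeries (Matrix (Fin N) (Fin N) (Fun N))) :
    loopMat (P - P') = loopMat P - loopMat P' := by
  ext1 α β
  refine zcoeff_ext fun k => ?_
  rw [Matrix.sub_apply, map_sub]
  rcases lt_or_ge k 0 with hk | hk
  · simp only [isNonneg_loopMat _ _ _ _ hk, sub_zero]
  · lift k to ℕ using hk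
    simp only [zcoeff_loopMat, map_sub, Matrix.sub_apply]

theorem loopMat_neg (P : PowerSeries (Matrix (Fin N) (Fin N) (Fun N))) :
    loopMat (-P) = -loopMat P := by
  have h0 := loopMat_sub P P
  have h := loopMat_sub (P - P) P
  rw [h0] at h
  simpa using h

/-- The series `R(-z, t)`. -/
def signedSeries (R : ℕ → Matrix (Fin N) (Fin N) (Fun N)) :
    PowerSeries (Matrix (Fin N) (Fin N) (Fun N)) := PowerSeries.mk fun k => (-1) ^ k * R k

/-- From the recursion and `dΨ = [Γ, dU]Ψ` one gets `d(R_k Ψ) = [R_{k+1}, dU]Ψ`, and `Ψ C = dU Ψ`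
turns the commutator into the right side. The extra `dU` term is what a factor `e^{-U/z}` on the
left would remove. -/
theorem IsSemisimpleFrame.pdMat_solution (h : IsSemisimpleFrame F u D Γt H R) (γ : Fin N) :
    pdMat γ (loopMat (signedSeries R * PowerSeries.C (frameMatrix u H))) =
      -zMul (-1) (loopMat (signedSeries R * PowerSeries.C (frameMatrix u H)) *
        (mulMat F γ).map lift - (dU u γ).map lift *
        loopMat (signedSeries R * PowerSeries.C (frameMatrix u H))) := by
  set Ψ := frameMatrix u H with hΨ
  have hc : ∀ k (M : Matrix (Fin N) (Fin N) (Fun N)), Commute ((-1) ^ k) M :=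
    fun k M => (Commute.neg_one_left M).pow_left _
  have hd : ∀ k, pdMat γ (R k * Ψ) = (R (k + 1) * dU u γ - dU u γ * R (k + 1)) * Ψ := fun k => by
    rw [← h.R_succ k γ, pdMat_mul, h.pdMat_frame γ, Matrix.add_mul, Matrix.mul_assoc, dMat_eq_pdMat]
  have hsgn : ∀ k (M : Matrix (Fin N) (Fin N) (Fun N)),
      pdMat γ ((-1) ^ k * M) = (-1) ^ k * pdMat γ M := fun k M => by
    rcases Nat.even_or_odd k with h2 | h2
    · rw [h2.neg_one_pow, one_mul, one_mul]
    · rw [h2.neg_one_pow, neg_one_mul, neg_one_mul]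
      ext1 i j
      simp
  rw [← loopMat_C, ← loopMat_C, ← loopMat_mul, ← loopMat_mul, ← loopMat_sub, ← zMul_neg,
    ← loopMat_neg]
  have hcoef : ∀ k, PowerSeries.coeff k (-(signedSeries R * PowerSeries.C Ψ *
      PowerSeries.C (mulMat F γ) - PowerSeries.C (dU u γ) *
      (signedSeries R * PowerSeries.C Ψ))) =
      -((-1) ^ k * ((R k * dU u γ - dU u γ * R k) * Ψ)) := fun k => by
    rw [map_neg, map_sub, PowerSeries.coeff_mul_C, PowerSeries.coeff_C_mul, PowerSeries.coeff_mul_C,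
      signedSeries, PowerSeries.coeff_mk, Matrix.sub_mul, mul_sub, mul_assoc, mul_assoc,
      hΨ, h.frame_mul_mulMat, ← mul_assoc (dU u γ) ((-1) ^ k * R k), ← mul_assoc (dU u γ) ((-1) ^ k),
      ← (hc k (dU u γ)).eq]
    simp only [mul_assoc]
  refine pdMat_loopMat γ ?_ fun k => ?_
  -- No pole in `z` arises because `R_0 = 1` commutes with `dU`.
  · rw [← PowerSeries.coeff_zero_eq_constantCoeff_apply, hcoef, h.R_zero]
    simp
  · rw [hcoef, PowerSeries.coeff_mul_C, signedSeries, PowerSeries.coeff_mk, mul_assoc, hsgn, hd,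
      pow_succ]
    simp

/-! ### Flat coordinates of the constant part -/

/-- The map `J(0)⁻¹ (u - u(0))`. -/
def flatMap (u : Fin N → Fun N) (α : Fin N) : Fun N :=
  ∑ i, C ((atZero (jacobian u))⁻¹ α i) * (u i - C (constantCoeff (u i)))

theorem atZero_mul (M M' : Matrix (Fin N) (Fin N) (Fun N)) :
    atZero (M * M') = atZero M * atZero M' := map_mul (constantCoeff.mapMatrix) M M'

theorem atZero_one : atZero (1 : Matrix (Fin N) (Fin N) (Fun N)) = 1 :=
  map_one (constantCoeff.mapMatrix)

theorem isUnit_det_atZero {M : Matrix (Fin N) (Fin N) (Fun N)} (h : IsUnit M.det) :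
    IsUnit (atZero M).det := by
  have := h.map (constantCoeff : Fun N →+* ℂ)
  rwa [RingHom.map_det] at this

theorem ordGE_flatMap (u : Fin N → Fun N) (α : Fin N) : OrdGE 1 (flatMap u α) :=
  OrdGE.sum fun i _ => OrdGE.mul_left _ (by rw [ordGE_one_iff, map_sub, constantCoeff_C, sub_self])

theorem pderiv_flatMap (u : Fin N → Fun N) (α γ : Fin N) :
    pderiv ℂ γ (flatMap u α) =
      (((atZero (jacobian u))⁻¹.map C : Matrix (Fin N) (Fin N) (Fun N)) * jacobian u) α γ := by
  rw [flatMap, map_sum, Matrix.mul_apply]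
  refine Finset.sum_congr rfl fun i _ => ?_
  rw [Derivation.leibniz, pderiv_C, smul_zero, add_zero, map_sub, pderiv_C, sub_zero]
  rfl

theorem IsCanonicalCoordinates.constantCoeff_pderiv_flatMap (h : IsCanonicalCoordinates F u)
    (α γ : Fin N) : constantCoeff (pderiv ℂ γ (flatMap u α)) = if α = γ then 1 else 0 := by
  have e : atZero (((atZero (jacobian u))⁻¹.map C : Matrix (Fin N) (Fin N) (Fun N)) * jacobian u) = 1 := by
    rw [atZero_mul]
    have : atZero ((atZero (jacobian u))⁻¹.map C : Matrix (Fin N) (Fin N) (Fun N)) =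
        (atZero (jacobian u))⁻¹ := by ext1 i j; simp [atZero]
    rw [this, Matrix.nonsing_inv_mul _ (isUnit_det_atZero h.isUnit_det)]
  rw [pderiv_flatMap, ← Matrix.one_apply, ← e]
  rfl

/-- Formal inverse function theorem: `flatMap` is tangent to the identity, so `v ↦ w - (flatMap -
id)(v)` is a contraction. -/
theorem exists_subst_flatMap_eq (h : IsCanonicalCoordinates F u) {τ : Type}
    {w : Fin N → MvPowerSeries τ ℂ} (hw : ∀ α, OrdGE 1 (w α)) :
    ∃ v : Fin N → MvPowerSeries τ ℂ, (∀ α, OrdGE 1 (v α)) ∧ ∀ α, subst v (flatMap u α) = w α := by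
  have h2 : ∀ α, OrdGE 2 (flatMap u α - X α) := fun α => by
    refine ordGE_succ_of_pderiv ?_ fun γ => ?_
    · rw [map_sub, constantCoeff_X, sub_zero, ordGE_one_iff.mp (ordGE_flatMap u α)]
    · rw [ordGE_one_iff, map_sub, map_sub, h.constantCoeff_pderiv_flatMap, pderiv_X,
        Pi.single_apply]
      split_ifs <;> simp_all
  obtain ⟨v, hv, he⟩ := exists_fixedPoint (fun v α => w α - subst v (flatMap u α - X α))
    (fun v : Fin N → MvPowerSeries τ ℂ => ∀ α, OrdGE 1 (v α)) 0 (fun _ => OrdGE.zero _)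
    (fun v hv α => (hw α).sub (((h2 α).mono (by omega)).subst (hasSubst_of_ordGE hv) hv))
    (fun v hv α => by
      obtain ⟨y, hy, hvy⟩ := hv 1
      simpa using (hvy α).add (hy α))
    (fun x y k hx hy hxy α => by
      rw [sub_sub_sub_cancel_left]
      refine OrdGE.subst_sub_subst (hasSubst_of_ordGE hy) (hasSubst_of_ordGE hx) hy hx
        (fun i => ?_) fun n _ hn => h2 α n (by omega)
      rw [← neg_sub]
      exact (hxy i).neg)
  refine ⟨v, hv, fun α => ?_⟩
  have hs := hasSubst_of_ordGE hv
  have := congrFun he α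
  rw [← substAlgHom_apply hs, map_sub, substAlgHom_apply, substAlgHom_apply, subst_X hs] at this
  rw [sub_eq_iff_eq_add, add_comm, sub_add_cancel] at this
  exact this.symm

end Frame

/-! ### Reconstruction of the fundamental solution -/

section Reconstruction

variable {N : ℕ} {A : Fin N → ℂ} {F : Fin N → Fun N} {u H : Fin N → Fun N}
  {D : Fin N → Fin N → Fun N} {Γt : Matrix (Fin N) (Fin N) (Fun N)}
  {R : ℕ → Matrix (Fin N) (Fin N) (Fun N)} {Om Omc : ℕ → Matrix (Fin N) (Fin N) (Fun N)}
  {τ : Type}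

theorem IsCalibration.pdMat_matAt_fundSol (h : IsCalibration F Om) (hb : IsBased Om)
    {w : Fin N → MvPowerSeries τ ℂ} (hw : ∀ α, OrdGE 1 (w α)) (j : τ) :
    pdMat j (matAt w (fundSol Om)) = -zMul (-1) (matAt w (fundSol Om) *
      (∑ δ, pderiv ℂ j (w δ) • substMat w (mulMat F δ)).map lift) := by
  have hs := hasSubst_of_ordGE hw
  have hls : HasSubst fun i => lift (w i) := hs.map LaurentZ.const
  ext1 α β
  rw [pdMat_apply, matAt, substMat_apply, pderiv_subst fun i => ordGE_lift (hw i)]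
  have e : ∀ δ, subst (fun i => lift (w i)) (pderiv LaurentZ δ (fundSol Om α β)) =
      -(zpow (-1) * ∑ μ, subst (fun i => lift (w i)) (fundSol Om α μ) *
        lift (subst w (mulMat F δ μ β))) := fun δ => by
    rw [← pdMat_apply, h.pdMat_fundSol hb, Matrix.neg_apply, subst_neg_right hls, zMul_apply,
      subst_zpow_mul hls, Matrix.mul_apply, subst_sum_right hls]
    simp_rw [subst_mul hls, Matrix.map_apply, lift_subst hs]
  simp_rw [e, pderiv_lift, Matrix.neg_apply, zMul_apply, Matrix.mul_apply, Matrix.map_apply,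
    Matrix.sum_apply, map_sum, Matrix.smul_apply, smul_eq_mul, map_mul, substMat_apply,
    Finset.mul_sum, neg_mul, Finset.sum_neg_distrib, Finset.sum_mul]
  refine congrArg Neg.neg (Finset.sum_comm.trans
    (Finset.sum_congr rfl fun μ _ => Finset.sum_congr rfl fun δ _ => ?_))
  rw [mul_assoc, mul_assoc, mul_comm (lift (pderiv ℂ j (w δ)))]

theorem atZero_mulMat (h : IsSemisimpleFrame F u D Γt H R) (δ : Fin N) :
    atZero (mulMat F δ) =
      (atZero (frameMatrix u H))⁻¹ * atZero (dU u δ) * atZero (frameMatrix u H) := by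
  rw [Matrix.mul_assoc, ← atZero_mul (dU u δ), ← h.frame_mul_mulMat, atZero_mul,
    ← Matrix.mul_assoc, Matrix.nonsing_inv_mul _ (isUnit_det_atZero h.isUnit_det_frame),
    Matrix.one_mul]

/-- The reason for the choice of `flatMap`: it pulls the constant multiplication back to a form with
the same eigenvalues `du^i` as the given one, diagonalised by the constant frame `Ψ(0)`. -/
theorem sum_pderiv_flatMap_mulMat (h : IsSemisimpleFrame F u D Γt H R) (γ : Fin N) :
    ∑ δ, pderiv ℂ γ (flatMap u δ) • mulMat (constantPart F) δ =
      ((atZero (frameMatrix u H))⁻¹).map C * dU u γ * (atZero (frameMatrix u H)).map C := by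
  have hJ : ∀ i, ∑ δ, C (atZero (jacobian u) i δ) * pderiv ℂ γ (flatMap u δ) =
      jacobian u i γ := fun i => by
    have e : (atZero (jacobian u)).map C * ((((atZero (jacobian u))⁻¹).map C :
        Matrix (Fin N) (Fin N) (Fun N)) * jacobian u) = jacobian u := by
      rw [← Matrix.mul_assoc, ← Matrix.map_mul,
        Matrix.mul_nonsing_inv _ (isUnit_det_atZero h.canonical.isUnit_det),
        Matrix.map_one _ (map_zero _) (map_one _), Matrix.one_mul]
    simp_rw [pderiv_flatMap]
    exact congrFun (congrFun e i) γ
  ext1 α β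
  rw [Matrix.sum_apply, dU_eq, Matrix.mul_apply]
  simp_rw [Matrix.mul_diagonal, Matrix.smul_apply, mulMat_constantPart, Matrix.map_apply,
    atZero_mulMat h, dU_eq]
  have e0 : ∀ δ, atZero (Matrix.diagonal fun i => jacobian u i δ) =
      Matrix.diagonal fun i => atZero (jacobian u) i δ := fun δ => by
    rw [atZero, Matrix.diagonal_map (map_zero _)]
    rfl
  simp_rw [e0, Matrix.mul_apply (N := atZero (frameMatrix u H)), Matrix.mul_diagonal, ← hJ,
    map_sum, map_mul, smul_eq_mul, Finset.mul_sum, Finset.sum_mul]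
  rw [Finset.sum_comm]
  refine Finset.sum_congr rfl fun i _ => Finset.sum_congr rfl fun δ _ => ?_
  ring

/-- The series `Ψ⁻¹(0) R(-z, t) Ψ`. -/
def frameSeries (u H : Fin N → Fun N) (R : ℕ → Matrix (Fin N) (Fin N) (Fun N)) :
    PowerSeries (Matrix (Fin N) (Fin N) (Fun N)) :=
  PowerSeries.C (((atZero (frameMatrix u H))⁻¹).map C) *
    (signedSeries R * PowerSeries.C (frameMatrix u H))

theorem IsSemisimpleFrame.constantCoeff_signedSeries (h : IsSemisimpleFrame F u D Γt H R) :
    PowerSeries.constantCoeff (signedSeries R) = 1 := by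
  rw [signedSeries, ← PowerSeries.coeff_zero_eq_constantCoeff_apply, PowerSeries.coeff_mk,
    h.R_zero, pow_zero, one_mul]

theorem IsSemisimpleFrame.constantCoeff_frameSeries (h : IsSemisimpleFrame F u D Γt H R) :
    atZero (PowerSeries.constantCoeff (frameSeries u H R)) = 1 := by
  rw [frameSeries, map_mul, map_mul, h.constantCoeff_signedSeries, PowerSeries.constantCoeff_C,
    PowerSeries.constantCoeff_C, one_mul, atZero_mul]
  have : atZero (((atZero (frameMatrix u H))⁻¹).map C) = (atZero (frameMatrix u H))⁻¹ := by
    ext1 i j; simp [atZero]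
  rw [this, Matrix.nonsing_inv_mul _ (isUnit_det_atZero h.isUnit_det_frame)]

theorem IsSemisimpleFrame.exists_frameSeries_inv (h : IsSemisimpleFrame F u D Γt H R) :
    ∃ P, frameSeries u H R * P = 1 := by
  have hΨ : frameMatrix u H * (frameMatrix u H)⁻¹ = 1 := Matrix.mul_nonsing_inv _ h.isUnit_det_frame
  have h0 : ((atZero (frameMatrix u H))⁻¹).map C *
      ((atZero (frameMatrix u H)).map C : Matrix (Fin N) (Fin N) (Fun N)) = 1 := by
    rw [← Matrix.map_mul, Matrix.nonsing_inv_mul _ (isUnit_det_atZero h.isUnit_det_frame),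
      Matrix.map_one _ (map_zero _) (map_one _)]
  have hR := PowerSeries.mul_invOfUnit (signedSeries R) 1
    (by rw [h.constantCoeff_signedSeries, Units.val_one])
  refine ⟨PowerSeries.C (frameMatrix u H)⁻¹ * PowerSeries.invOfUnit (signedSeries R) 1 *
    PowerSeries.C ((atZero (frameMatrix u H)).map C), ?_⟩
  rw [frameSeries]
  simp only [mul_assoc]
  rw [← mul_assoc (PowerSeries.C (frameMatrix u H)), ← map_mul, hΨ, map_one, one_mul,
    ← mul_assoc (signedSeries R), hR, one_mul, ← map_mul, h0, map_one]

theorem IsSemisimpleFrame.constantCoeff_seriesAtZero (h : IsSemisimpleFrame F u D Γt H R) :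
    PowerSeries.constantCoeff (seriesAtZero R) = ((1 : (Matrix (Fin N) (Fin N) ℂ)ˣ) :
      Matrix (Fin N) (Fin N) ℂ) := by
  rw [seriesAtZero, ← PowerSeries.coeff_zero_eq_constantCoeff_apply, PowerSeries.coeff_mk,
    h.R_zero, pow_zero, one_mul, atZero_one, Units.val_one]

theorem IsSemisimpleFrame.reconstructionSeries_mul (h : IsSemisimpleFrame F u D Γt H R) :
    reconstructionSeries u H R * (PowerSeries.C (atZero (frameMatrix u H))⁻¹ * (seriesAtZero R *
      PowerSeries.C (atZero (frameMatrix u H)))) = 1 := by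
  have h1 : atZero (frameMatrix u H) * (atZero (frameMatrix u H))⁻¹ = 1 :=
    Matrix.mul_nonsing_inv _ (isUnit_det_atZero h.isUnit_det_frame)
  have h2 : (atZero (frameMatrix u H))⁻¹ * atZero (frameMatrix u H) = 1 :=
    Matrix.nonsing_inv_mul _ (isUnit_det_atZero h.isUnit_det_frame)
  have hR := PowerSeries.invOfUnit_mul (seriesAtZero R) 1 h.constantCoeff_seriesAtZero
  rw [reconstructionSeries]
  simp only [mul_assoc]
  rw [← mul_assoc (PowerSeries.C (atZero (frameMatrix u H))), ← map_mul, h1, map_one, one_mul,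
    ← mul_assoc (PowerSeries.invOfUnit _ _), hR, one_mul, ← map_mul, h2, map_one]

theorem IsSemisimpleFrame.mul_reconstructionSeries (h : IsSemisimpleFrame F u D Γt H R) :
    (PowerSeries.C (atZero (frameMatrix u H))⁻¹ * (seriesAtZero R *
      PowerSeries.C (atZero (frameMatrix u H)))) * reconstructionSeries u H R = 1 := by
  have h1 : atZero (frameMatrix u H) * (atZero (frameMatrix u H))⁻¹ = 1 :=
    Matrix.mul_nonsing_inv _ (isUnit_det_atZero h.isUnit_det_frame)
  have h2 : (atZero (frameMatrix u H))⁻¹ * atZero (frameMatrix u H) = 1 :=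
    Matrix.nonsing_inv_mul _ (isUnit_det_atZero h.isUnit_det_frame)
  have hR := PowerSeries.mul_invOfUnit (seriesAtZero R) 1 h.constantCoeff_seriesAtZero
  rw [reconstructionSeries]
  simp only [mul_assoc]
  rw [← mul_assoc (PowerSeries.C (atZero (frameMatrix u H))), ← map_mul, h1, map_one, one_mul,
    ← mul_assoc (seriesAtZero R), hR, one_mul, ← map_mul, h2, map_one]

theorem IsSemisimpleFrame.exists_upperTriangular (h : IsSemisimpleFrame F u D Γt H R) :
    ∃ g ∈ upperTriangularGroup N, (g : EndSeries N) = reconstructionSeries u H R := by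
  refine ⟨⟨_, _, h.reconstructionSeries_mul, h.mul_reconstructionSeries⟩, ?_, rfl⟩
  rw [upperTriangularGroup, MonoidHom.mem_ker]
  refine Units.ext ?_
  change PowerSeries.constantCoeff (reconstructionSeries u H R) = 1
  have e := PowerSeries.constantCoeff_invOfUnit (seriesAtZero R) 1
  rw [reconstructionSeries, map_mul, map_mul, e, PowerSeries.constantCoeff_C,
    PowerSeries.constantCoeff_C, inv_one, Units.val_one, mul_one,
    Matrix.nonsing_inv_mul _ (isUnit_det_atZero h.isUnit_det_frame)]

/-! ### The two fundamental solutions -/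

theorem constantCoeff_loopMat (P : PowerSeries (Matrix (Fin N) (Fin N) (Fun N))) :
    (constantCoeff.mapMatrix : Matrix (Fin N) (Fin N) (LSer (Fin N)) →+* _) (loopMat P) =
      constantCoeff.mapMatrix (constLoopMat (Fin N)
        (PowerSeries.map (constantCoeff : Fun N →+* ℂ).mapMatrix P)) := by
  ext1 α β
  rw [RingHom.mapMatrix_apply, RingHom.mapMatrix_apply, Matrix.map_apply, Matrix.map_apply,
    constLoopMat_apply, constantCoeff_C, loopMat_apply, ← coeff_zero_eq_constantCoeff_apply,
    coeff_ofSeq]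
  rfl

theorem map_frameSeries (u H : Fin N → Fun N) (R : ℕ → Matrix (Fin N) (Fin N) (Fun N)) :
    PowerSeries.map (constantCoeff : Fun N →+* ℂ).mapMatrix (frameSeries u H R) =
      PowerSeries.C (atZero (frameMatrix u H))⁻¹ * (seriesAtZero R *
        PowerSeries.C (atZero (frameMatrix u H))) := by
  have e1 : (constantCoeff : Fun N →+* ℂ).mapMatrix (((atZero (frameMatrix u H))⁻¹).map C) =
      (atZero (frameMatrix u H))⁻¹ := by
    ext1 i j; simp
  have e2 : PowerSeries.map (constantCoeff : Fun N →+* ℂ).mapMatrix (signedSeries R) =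
      seriesAtZero R := by
    ext1 k
    rw [PowerSeries.coeff_map, signedSeries, seriesAtZero, PowerSeries.coeff_mk,
      PowerSeries.coeff_mk, map_mul, map_pow, map_neg, map_one]
    rfl
  rw [frameSeries, map_mul, map_mul, PowerSeries.map_C, PowerSeries.map_C, e1, e2]
  rfl

theorem pdMat_constLoopMat (G : EndSeries N) (γ : Fin N) :
    pdMat γ (constLoopMat (Fin N) G) = 0 := by
  ext1 α β
  rw [pdMat_apply, constLoopMat_apply, pderiv_C, Matrix.zero_apply]

/-- The fundamental solution in terms of that of the constant part. -/
theorem IsSemisimpleFrame.fundSol_eq (h : IsSemisimpleFrame F u D Γt H R)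
    (hO : IsCalibration F Om) (hb : IsBased Om) (hOc : IsCalibration (constantPart F) Omc)
    (hbc : IsBased Omc) :
    fundSol Om = constLoopMat (Fin N) (reconstructionSeries u H R) *
      (matAt (flatMap u) (fundSol Omc) * loopMat (frameSeries u H R)) := by
  set G := constLoopMat (Fin N) (reconstructionSeries u H R)
  set Tc := matAt (flatMap u) (fundSol Omc) with hTc
  set M := loopMat (frameSeries u H R) with hM
  have hu := ordGE_flatMap u
  have hus := hasSubst_of_ordGE hu
  set Ψ := frameMatrix u H with hΨ
  set P0 : Matrix (Fin N) (Fin N) (Fun N) := ((atZero Ψ)⁻¹).map C with hP0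
  set P1 : Matrix (Fin N) (Fin N) (Fun N) := (atZero Ψ).map C with hP1
  have hP : P1 * P0 = 1 := by
    rw [hP1, hP0, ← Matrix.map_mul, Matrix.mul_nonsing_inv _ (isUnit_det_atZero h.isUnit_det_frame),
      Matrix.map_one _ (map_zero _) (map_one _)]
  have hPl : P1.map lift * P0.map lift = (1 : Matrix (Fin N) (Fin N) (LSer (Fin N))) := by
    rw [← Matrix.map_mul, hP, Matrix.map_one _ (map_zero _) (map_one _)]
  set Q := loopMat (signedSeries R * PowerSeries.C Ψ) with hQ
  have hMQ : M = P0.map lift * Q := by rw [hM, frameSeries, loopMat_mul, loopMat_C]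
  have hdT : ∀ γ, pdMat γ Tc =
      -zMul (-1) (Tc * (P0.map lift * (dU u γ).map lift * P1.map lift)) := fun γ => by
    rw [hTc, hOc.pdMat_matAt_fundSol hbc hu]
    have e1 : ∀ δ, substMat (flatMap u) (mulMat (constantPart F) δ) =
        mulMat (constantPart F) δ := fun δ => by
      rw [mulMat_constantPart]
      ext1 i j
      rw [substMat_apply, Matrix.map_apply, subst_C]
    simp_rw [e1]
    rw [sum_pderiv_flatMap_mulMat h, Matrix.map_mul, Matrix.map_mul]
  have hdQ : ∀ γ, pdMat γ Q = -zMul (-1) (Q * (mulMat F γ).map lift - (dU u γ).map lift * Q) :=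
    fun γ => h.pdMat_solution γ
  have hd0 : ∀ γ, pdMat γ (P0.map lift) = 0 := fun γ => by
    rw [pdMat_map_lift]
    ext1 i j
    rw [Matrix.map_apply, pdMat_apply, hP0, Matrix.map_apply, pderiv_C, map_zero,
      Matrix.zero_apply]
  -- The `dU` term from the derivative of `Tc` cancels the one from `Q`; what remains is the system
  -- satisfied by `fundSol`.
  have hdTM : ∀ γ, pdMat γ (Tc * M) = -zMul (-1) (Tc * M * (mulMat F γ).map lift) := fun γ => by
    rw [pdMat_mul, hdT, hMQ, pdMat_mul, hd0, hdQ, Matrix.zero_mul, zero_add]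
    simp only [Matrix.neg_mul, Matrix.mul_neg, ← zMul_mul, mul_zMul, Matrix.mul_sub, zMul_sub,
      Matrix.mul_assoc]
    rw [← Matrix.mul_assoc (P1.map lift), hPl, Matrix.one_mul]
    abel
  have hY := linear_system_unique (R := LaurentZ) (fun γ => -zMul (-1) ((mulMat F γ).map lift))
    (fundSol Om - G * (Tc * M)) (fun γ => ?_) fun a b => ?_
  · exact sub_eq_zero.mp hY
  · rw [pdMat_sub, hO.pdMat_fundSol hb, pdMat_mul, pdMat_constLoopMat, Matrix.zero_mul, zero_add,
      hdTM]
    simp only [Matrix.mul_neg, mul_zMul, Matrix.sub_mul, Matrix.mul_assoc]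
    abel
  · have e1 : (constantCoeff.mapMatrix : Matrix (Fin N) (Fin N) (LSer (Fin N)) →+* _) Tc = 1 := by
      ext1 i j
      rw [RingHom.mapMatrix_apply, Matrix.map_apply, hTc, matAt, substMat_apply,
        constantCoeff_subst_of_ordGE fun i => ordGE_lift (hu i), hOc.constantCoeff_fundSol,
        Matrix.one_apply]
      split_ifs <;> simp
    -- At the origin `Tc` is the identity, and `G` is inverse to the value of `M` there.
    have e2 : (constantCoeff.mapMatrix : Matrix (Fin N) (Fin N) (LSer (Fin N)) →+* _)
        (G * (Tc * M)) = 1 := by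
      rw [map_mul, map_mul, e1, one_mul, hM, constantCoeff_loopMat, map_frameSeries, ← map_mul,
        ← constLoopMat_mul, h.reconstructionSeries_mul, constLoopMat_one, map_one]
    have e3 := congrFun (congrFun e2 a) b
    rw [RingHom.mapMatrix_apply, Matrix.map_apply, Matrix.one_apply] at e3
    rw [Matrix.sub_apply, map_sub, hO.constantCoeff_fundSol, e3, sub_self]

/-! ### The cones -/

theorem matAt_constLoopMat (G : EndSeries N) (v : Fin N → MvPowerSeries τ ℂ) :
    matAt v (constLoopMat (Fin N) G) = constLoopMat τ G := by
  ext1 α β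
  rw [matAt, substMat_apply, constLoopMat_apply, constLoopMat_apply, subst_C]

theorem matAt_matAt {w : Fin N → Fun N} (hw : ∀ α, OrdGE 1 (w α)) {v : Fin N → MvPowerSeries τ ℂ}
    (hv : ∀ α, OrdGE 1 (v α)) (M : Matrix (Fin N) (Fin N) (LSer (Fin N))) :
    matAt v (matAt w M) = matAt (fun α => subst v (w α)) M := by
  have hws := hasSubst_of_ordGE hw
  have hvs := hasSubst_of_ordGE hv
  ext1 α β
  simp only [matAt, substMat_apply, lift_subst hvs]
  exact subst_comp_subst_apply (hws.map LaurentZ.const) (hvs.map LaurentZ.const) _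

/-- A power series in `z` whose leading matrix is the identity at the origin preserves the
conditions imposed on `y` in the description of the cone. -/
theorem constantCoeff_zcoeff_mulVec {P : PowerSeries (Matrix (Fin N) (Fin N) (Fun N))}
    (hP : atZero (PowerSeries.constantCoeff P) = 1) {v : Fin N → MvPowerSeries τ ℂ}
    (hv : ∀ α, OrdGE 1 (v α)) {y : Fin N → LSer τ} (hy : ∀ α, IsNonneg (y α)) :
    (∀ α, IsNonneg ((matAt v (loopMat P)).mulVec y α)) ∧
      ∀ α, constantCoeff (zcoeff 0 ((matAt v (loopMat P)).mulVec y α)) =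
        constantCoeff (zcoeff 0 (y α)) := by
  have hvs := hasSubst_of_ordGE hv
  have hM : ∀ α β, IsNonneg (matAt v (loopMat P) α β) := fun α β =>
    (isNonneg_loopMat P α β).subst hvs
  refine ⟨fun α => IsNonneg.sum fun β _ => (hM α β).mul (hy β), fun α => ?_⟩
  rw [Matrix.mulVec, dotProduct, map_sum, map_sum]
  have e : ∀ β, constantCoeff (zcoeff 0 (matAt v (loopMat P) α β * y β)) =
      if α = β then constantCoeff (zcoeff 0 (y β)) else 0 := fun β => by
    rw [(hM α β).zcoeff_zero_mul (hy β), map_mul, matAt, substMat_apply, zcoeff_subst hvs,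
      zcoeff_zero_loopMat, constantCoeff_subst_of_ordGE hv]
    have := congrFun (congrFun hP α) β
    rw [Matrix.one_apply] at this
    change constantCoeff (PowerSeries.constantCoeff P α β) = _ at this
    rw [Algebra.algebraMap_self, RingHom.id_apply, this]
    split_ifs <;> simp
  rw [Finset.sum_congr rfl fun β _ => e β]
  simp

/-- By the factorisation of the fundamental solution, `G` carries the ruling of the constant cone
over `φ(v)` onto the ruling of the given cone over `v`. One inclusion needs a preimage of `w` under
`φ` and the inverse of `M`, the other only `φ` and `M`. -/
theorem IsSemisimpleFrame.isImageCone (h : IsSemisimpleFrame F u D Γt H R)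
    (hF : IsVectorPotential A F) {Fa Fc : ℕ → Fin N → BigFun N}
    (hFa : IsAncestorPotentials A F Fa) (hFc : IsAncestorPotentials A (constantPart F) Fc) :
    IsImageCone (reconstructionSeries u H R) (cone A Fc) (cone A Fa) := by
  obtain ⟨Om, hO, hb, hcone⟩ := hFa.exists_mem_cone_iff hF
  obtain ⟨Omc, hOc, hbc, hconec⟩ := hFc.exists_mem_cone_iff hF.constantPart
  have hT := h.fundSol_eq hO hb hOc hbc
  obtain ⟨P, hP⟩ := h.exists_frameSeries_inv
  have hP0 : atZero (PowerSeries.constantCoeff P) = 1 := by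
    have := congrArg (fun P => atZero (PowerSeries.constantCoeff P)) hP
    simp only [map_mul, map_one, atZero_mul, atZero_one, h.constantCoeff_frameSeries] at this
    rwa [Matrix.one_mul] at this
  have hval : ∀ {τ : Type} {v : Fin N → MvPowerSeries τ ℂ}, (∀ α, OrdGE 1 (v α)) →
      ∀ x : Fin N → LSer τ, (matAt v (fundSol Om)).mulVec x =
        (constLoopMat τ (reconstructionSeries u H R)).mulVec
          ((matAt (fun α => subst v (flatMap u α)) (fundSol Omc)).mulVec
            ((matAt v (loopMat (frameSeries u H R))).mulVec x)) := fun hv x => by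
    have hvs := hasSubst_of_ordGE hv
    rw [hT, matAt_mul hvs, matAt_mul hvs, matAt_constLoopMat, matAt_matAt (ordGE_flatMap u) hv,
      Matrix.mulVec_mulVec, Matrix.mulVec_mulVec, Matrix.mul_assoc]
  have hz : ∀ {τ : Type} (M : Matrix (Fin N) (Fin N) (LSer τ)) (y : Fin N → LSer τ),
      (M.mulVec fun α => zpow 1 * y α) = fun α => zpow 1 * M.mulVec y α := fun M y => by
    funext α
    simp only [Matrix.mulVec, dotProduct, Finset.mul_sum, mul_left_comm]
  intro τ
  refine ⟨fun f hf => ?_, Set.Subset.antisymm ?_ ?_⟩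
  · obtain ⟨w, y, -, -, -, rfl⟩ := (hconec τ f).mp hf
    exact (zcoeff_constLoopMat_mulVec _ _).1
  · rintro _ ⟨f, hf, rfl⟩
    obtain ⟨w, y, hw, hy, hyA, rfl⟩ := (hconec τ f).mp hf
    obtain ⟨v, hv, hvw⟩ := exists_subst_flatMap_eq h.canonical hw
    obtain ⟨hy', hyA'⟩ := constantCoeff_zcoeff_mulVec hP0 hv hy
    refine (hcone τ _).mpr ⟨v, (matAt v (loopMat P)).mulVec y, hv, hy', fun α => ?_, ?_⟩
    · rw [hyA', hyA]
    · have hvs := hasSubst_of_ordGE hv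
      rw [(zcoeff_constLoopMat_mulVec _ _).2, ← hz, hval hv, Matrix.mulVec_mulVec _ (matAt v _) (matAt v _),
        ← matAt_mul hvs, ← loopMat_mul, hP, loopMat_one, matAt_one hvs, Matrix.one_mulVec]
      simp_rw [hvw]
  · intro f hf
    obtain ⟨v, y, hv, hy, hyA, rfl⟩ := (hcone τ f).mp hf
    obtain ⟨hy', hyA'⟩ := constantCoeff_zcoeff_mulVec h.constantCoeff_frameSeries hv hy
    refine ⟨_, (hconec τ _).mpr ⟨fun α => subst v (flatMap u α),
      (matAt v (loopMat (frameSeries u H R))).mulVec y,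
      fun α => (ordGE_flatMap u α).subst (hasSubst_of_ordGE hv) hv, hy', fun α => ?_, rfl⟩, ?_⟩
    · rw [hyA', hyA]
    · rw [(zcoeff_constLoopMat_mulVec _ _).2, hval hv, ← hz]

end Reconstruction

/-! ### The tangent algebra and its idempotents -/

section Idempotents

variable {n S : Type*} [Fintype n] [DecidableEq n] [CommRing S] {a : n → S} {Cm : n → Matrix n n S}

/-- The commutative ring with structure matrices `Cm` and unit `a`. -/
def TangentAlg (_ : IsCommMult a Cm) : Type _ := n → S

namespace TangentAlg

variable (h : IsCommMult a Cm)

instance : AddCommGroup (TangentAlg h) := inferInstanceAs (AddCommGroup (n → S))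

/-- The element with the given coordinates. -/
def mk (x : n → S) : TangentAlg h := x

variable {h}

/-- The coordinates of an element. -/
def coord (x : TangentAlg h) : n → S := x

instance : Mul (TangentAlg h) := ⟨fun x y => (multBy Cm x.coord).mulVec y.coord⟩

theorem coord_mul (x y : TangentAlg h) : (x * y).coord = (multBy Cm x.coord).mulVec y.coord := rfl

instance : CommRing (TangentAlg h) :=
  { (inferInstance : AddCommGroup (TangentAlg h)),
    (inferInstance : Mul (TangentAlg h)) with
    one := mk h a
    left_distrib := fun x y z => Matrix.mulVec_add (multBy Cm x.coord) y.coord z.coord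
    right_distrib := fun x y z => by
      change (multBy Cm (x.coord + y.coord)).mulVec z.coord = _
      rw [multBy_add, Matrix.add_mulVec]; rfl
    zero_mul := fun x => by
      change (multBy Cm 0).mulVec x.coord = 0
      simp [multBy]
    mul_zero := fun x => Matrix.mulVec_zero (multBy Cm x.coord)
    mul_assoc := fun x y z => by
      change (multBy Cm ((multBy Cm x.coord).mulVec y.coord)).mulVec z.coord = _
      rw [h.multBy_mulVec, ← Matrix.mulVec_mulVec]; rfl
    mul_comm := fun x y => h.multBy_mulVec_comm x.coord y.coord
    one_mul := fun x => by
      change (multBy Cm a).mulVec x.coord = x.coord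
      rw [h.multBy_unit, Matrix.one_mulVec]
    mul_one := fun x => h.multBy_mulVec_unit x.coord }

end TangentAlg

end Idempotents

/-! ### Lifting idempotents from the origin to formal power series -/

section FormalIdempotents

variable {N : ℕ} {A : Fin N → ℂ} {F : Fin N → Fun N} {Cm : Fin N → Matrix (Fin N) (Fin N) (Fun N)}
  {a : Fin N → Fun N} {h : IsCommMult a Cm}

namespace TangentAlg

/-- All coordinates vanish to order `k`. -/
def VecOrd (k : ℕ) (x : TangentAlg h) : Prop := ∀ α, OrdGE k (x.coord α)

theorem VecOrd.add {k : ℕ} {x y : TangentAlg h} (hx : VecOrd k x) (hy : VecOrd k y) :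
    VecOrd k (x + y) := fun α => (hx α).add (hy α)

theorem VecOrd.neg {k : ℕ} {x : TangentAlg h} (hx : VecOrd k x) : VecOrd k (-x) :=
  fun α => (hx α).neg

theorem VecOrd.mul {k l : ℕ} {x y : TangentAlg h} (hx : VecOrd k x) (hy : VecOrd l y) :
    VecOrd (k + l) (x * y) := fun α => by
  rw [coord_mul, Matrix.mulVec, dotProduct]
  refine OrdGE.sum fun β _ => OrdGE.mul ?_ (hy β)
  rw [multBy_apply]
  exact OrdGE.sum fun γ _ => (hx γ).mul_right _

theorem VecOrd.mono {k l : ℕ} {x : TangentAlg h} (hx : VecOrd l x) (hk : k ≤ l) : VecOrd k x :=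
  fun α => (hx α).mono hk

theorem VecOrd.zero_left (x : TangentAlg h) : VecOrd 0 x := fun _ => OrdGE.zero_left _

theorem eq_zero_of_vecOrd {x : TangentAlg h} (hx : ∀ k, VecOrd k x) : x = 0 :=
  funext fun α => eq_of_ordGE_sub fun k => by
    change OrdGE k (x.coord α - 0)
    rw [sub_zero]
    exact hx k α

/-- Idempotents modulo the maximal ideal lift to idempotents. -/
theorem exists_idempotent (p : TangentAlg h) (hp : VecOrd 1 (p * p - p)) :
    ∃ x : TangentAlg h, x * x = x ∧ VecOrd 1 (x - p) := by
  -- Simplified Newton iteration for `x² - x`: modulo the maximal ideal the derivative `2p - 1` is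
  -- its own inverse, since `(2p - 1)² = 1 + 4(p² - p)`.
  let Φ : TangentAlg h → TangentAlg h := fun x => x - (2 * p - 1) * (x * x - x)
  obtain ⟨x, hx, he⟩ := exists_fixedPoint (ι := Fin N) (fun x => (Φ (mk h x)).coord)
    (fun x => VecOrd 1 (mk h x - p)) p (by
      change VecOrd 1 (p - p)
      rw [sub_self]
      exact fun _ => OrdGE.zero _)
    (fun x hx => by
      set y := mk h x
      have e : Φ y - p = (y - p) + -((2 * p - 1) * ((y - p) * (y + p) + -(y - p) + (p * p - p))) := by
        simp only [Φ]; ring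
      change VecOrd 1 (Φ y - p)
      rw [e]
      refine hx.add (VecOrd.neg ?_)
      simpa using (VecOrd.zero_left (2 * p - 1)).mul
        (VecOrd.add (VecOrd.add (hx.mul (VecOrd.zero_left _)) hx.neg) hp))
    (fun x hx => by
      obtain ⟨y, hy, hxy⟩ := hx 1
      have : mk h x - p = (mk h x - mk h y) + (mk h y - p) := by ring
      rw [this]
      exact VecOrd.add hxy hy)
    (fun x y k hx hy hxy => by
      set x' := mk h x
      set y' := mk h y
      have hxy : VecOrd k (x' - y') := hxy
      have e : Φ x' - Φ y' = (x' - y') * (-4 * (p * p - p) +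
          ((x' - p) + (y' - p)) + -(2 * p * ((x' - p) + (y' - p)))) := by
        simp only [Φ]; ring
      change VecOrd (k + 1) (Φ x' - Φ y')
      rw [e]
      refine hxy.mul (VecOrd.add (VecOrd.add ?_ (hx.add hy)) (VecOrd.neg ?_))
      · simpa using (VecOrd.zero_left (-4 : TangentAlg h)).mul hp
      · simpa using (VecOrd.zero_left (2 * p)).mul (hx.add hy))
  set y := mk h x
  have he : Φ y = y := he
  refine ⟨y, ?_, hx⟩
  have e0 : (2 * p - 1) * (y * y - y) = 0 := by
    simp only [Φ] at he
    exact sub_eq_self.mp he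
  -- Multiplying once more by `2p - 1` expresses `y² - y` as a multiple of itself by an element of
  -- positive order, so it vanishes to every order.
  have e1 : y * y - y = -4 * (p * p - p) * (y * y - y) := by linear_combination (2 * p - 1) * e0
  have hk : ∀ k, VecOrd k (y * y - y) := fun k => by
    induction k with
    | zero => exact VecOrd.zero_left _
    | succ k ih =>
      rw [e1]
      refine VecOrd.mono (VecOrd.mul (k := 1) ?_ ih) (by omega)
      simpa using (VecOrd.zero_left (-4 : TangentAlg h)).mul hp
  exact sub_eq_zero.mp (eq_zero_of_vecOrd hk)

theorem eq_zero_of_idempotent {x : TangentAlg h} (hx : x * x = x) (h1 : VecOrd 1 x) : x = 0 := by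
  refine eq_zero_of_vecOrd fun k => ?_
  induction k with
  | zero => exact VecOrd.zero_left _
  | succ k ih =>
    rw [← hx]
    exact ih.mul h1

end TangentAlg

open TangentAlg

theorem constantCoeff_multBy (hss : Fin N → Fin N → ℂ) (k l : Fin N) (α : Fin N) :
    constantCoeff ((multBy (mulMat F) (fun β => C (hss k β))).mulVec (fun β => C (hss l β)) α) =
      ∑ β, ∑ γ, structureConstAtZero F α β γ * hss k β * hss l γ := by
  simp only [Matrix.mulVec, dotProduct, multBy_apply, mulMat_apply, map_sum, map_mul,
    constantCoeff_C, Finset.sum_mul]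
  rw [Finset.sum_comm]
  refine Finset.sum_congr rfl fun β _ => Finset.sum_congr rfl fun γ _ => ?_
  rw [structureConstAtZero]; ring

/-- Orthogonal idempotents in the tangent algebra. -/
theorem IsVectorPotential.exists_idempotents (hF : IsVectorPotential A F)
    (hss : IsSemisimpleAtOrigin F) : ∃ P : Matrix (Fin N) (Fin N) (Fun N), IsUnit P.det ∧
      ∀ k l α, (multBy (mulMat F) (P.col k)).mulVec (P.col l) α = if k = l then P α k else 0 := by
  obtain ⟨π, hπ⟩ := hss
  have h := hF.isCommMult
  let p : Fin N → TangentAlg h := fun k => TangentAlg.mk h fun α => C (π k α)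
  have hpp : ∀ k l α, constantCoeff ((p k * p l).coord α) = if k = l then π k α else 0 :=
    fun k l α => (constantCoeff_multBy (fun k => π k) k l α).trans (hπ k l α)
  have hx : ∀ k, ∃ x : TangentAlg h, x * x = x ∧ VecOrd 1 (x - p k) := fun k => by
    refine exists_idempotent (p k) fun α => ordGE_one_iff.mpr ?_
    change constantCoeff ((p k * p k).coord α - C (π k α)) = 0
    rw [map_sub, hpp, if_pos rfl, constantCoeff_C, sub_self]
  choose x hxx hxp using hx
  have hxc : ∀ k α, constantCoeff ((x k).coord α) = π k α := fun k α => by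
    have := ordGE_one_iff.mp (hxp k α)
    change constantCoeff ((x k).coord α - C (π k α)) = 0 at this
    rwa [map_sub, constantCoeff_C, sub_eq_zero] at this
  -- The product of two lifts is an idempotent without constant term, and such an idempotent is
  -- zero.
  have hort : ∀ k l, k ≠ l → x k * x l = 0 := fun k l hkl => by
    refine eq_zero_of_idempotent (by rw [mul_mul_mul_comm, hxx, hxx]) ?_
    have e : x k * x l = (x k - p k) * x l + p k * (x l - p l) + p k * p l := by ring
    rw [e]
    refine VecOrd.add (VecOrd.add ?_ ?_) fun α => ordGE_one_iff.mpr ?_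
    · simpa using (hxp k).mul (VecOrd.zero_left (x l))
    · simpa using (VecOrd.zero_left (p k)).mul (hxp l)
    · rw [hpp, if_neg hkl]
  refine ⟨Matrix.of fun α k => (x k).coord α, ?_, fun k l α => ?_⟩
  · rw [MvPowerSeries.isUnit_iff_constantCoeff, RingHom.map_det]
    have e : (constantCoeff : Fun N →+* ℂ).mapMatrix (Matrix.of fun α k => (x k).coord α) =
        (Pi.basisFun ℂ (Fin N)).toMatrix π := by
      ext1 α k
      simp [hxc, Module.Basis.toMatrix_apply]
    rw [e]
    have := (Pi.basisFun ℂ (Fin N)).isUnit_det π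
    rwa [Module.Basis.det_apply] at this
  · change (x k * x l).coord α = _
    split_ifs with hkl
    · subst hkl
      rw [hxx]; rfl
    · rw [hort k l hkl]; rfl

/-- The exponential of a power series without constant term. -/
theorem exists_exp {σ : Type*} (φ : MvPowerSeries σ ℂ) (h0 : constantCoeff φ = 0) :
    ∃ E : MvPowerSeries σ ℂ, IsUnit E ∧ ∀ i, pderiv ℂ i E = pderiv ℂ i φ * E := by
  let e : MvPowerSeries Unit ℂ := fun n => ((n ()).factorial : ℂ)⁻¹
  have he : ∀ n, coeff n e = ((n ()).factorial : ℂ)⁻¹ := fun _ => rfl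
  have hd : pderiv ℂ () e = e := by
    refine MvPowerSeries.ext fun n => ?_
    rw [coeff_pderiv, he, he, Finsupp.add_apply, Finsupp.single_eq_same, Nat.factorial_succ]
    have : ((n () : ℂ) + 1) ≠ 0 := Nat.cast_add_one_ne_zero _
    push_cast
    field_simp
  have hφ : ∀ _ : Unit, OrdGE 1 φ := fun _ => ordGE_one_iff.mpr h0
  refine ⟨subst (fun _ => φ) e, ?_, fun i => ?_⟩
  · rw [MvPowerSeries.isUnit_iff_constantCoeff, constantCoeff_subst_of_ordGE hφ,
      ← coeff_zero_eq_constantCoeff_apply, he]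
    simp
  · rw [pderiv_subst hφ, Fintype.sum_unique]
    change subst _ (pderiv ℂ () e) * _ = _
    rw [hd, mul_comm]

end FormalIdempotents

/-! ### Existence of frames -/

section FrameExistence

variable {N : ℕ} {A : Fin N → ℂ} {F : Fin N → Fun N} {u : Fin N → Fun N}

theorem commutator_apply (J : Matrix (Fin N) (Fin N) (Fun N)) (Z : Matrix (Fin N) (Fin N) (Fun N))
    (γ i j : Fin N) :
    (Z * (Matrix.diagonal fun i => J i γ) - (Matrix.diagonal fun i => J i γ) * Z) i j =
      Z i j * (J j γ - J i γ) := by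
  rw [Matrix.sub_apply, Matrix.mul_diagonal, Matrix.diagonal_mul]
  ring

/-- Solvability of the equation `M_δ = [Y, Λ_δ]` off the diagonal. -/
theorem exists_commutator {J P : Matrix (Fin N) (Fin N) (Fun N)} (hJP : J * P = 1)
    (M : Fin N → Matrix (Fin N) (Fin N) (Fun N))
    (hM : ∀ γ δ, M δ * (Matrix.diagonal fun i => J i γ) - (Matrix.diagonal fun i => J i γ) * M δ =
      M γ * (Matrix.diagonal fun i => J i δ) - (Matrix.diagonal fun i => J i δ) * M γ) :
    ∃ Y : Matrix (Fin N) (Fin N) (Fun N), (∀ i, Y i i = 0) ∧ ∀ δ, M δ =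
      Matrix.diagonal (fun i => M δ i i) +
        (Y * (Matrix.diagonal fun i => J i δ) - (Matrix.diagonal fun i => J i δ) * Y) := by
  -- Off the diagonal the equation reads `M_ij = Y_ij (du^j - du^i)`; contraction with `∂/∂u^j`, on
  -- which `du^j - du^i` takes the value `1`, isolates `Y_ij`.
  refine ⟨Matrix.of fun i j => if i = j then 0 else ∑ γ, P γ j * M γ i j, fun i => if_pos rfl,
    fun δ => ?_⟩
  ext1 i j
  rw [Matrix.add_apply, commutator_apply, Matrix.of_apply]
  rcases eq_or_ne i j with rfl | hij
  · simp
  · rw [Matrix.diagonal_apply_ne _ hij, zero_add, if_neg hij, Finset.sum_mul]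
    have e : ∀ γ, P γ j * M γ i j * (J j δ - J i δ) = M δ i j * (J j γ * P γ j - J i γ * P γ j) :=
      fun γ => by
        have := congrFun (congrFun (hM γ δ) i) j
        rw [commutator_apply, commutator_apply] at this
        linear_combination -P γ j * this
    simp_rw [e, ← Finset.mul_sum, Finset.sum_sub_distrib, ← Matrix.mul_apply, hJP]
    rw [Matrix.one_apply_eq, Matrix.one_apply_ne hij, sub_zero, mul_one]

/-- The directions enter a diagonal entry through `(du^j - du^i)(δ) · (du^i - du^j)(γ)`, which is
symmetric. This yields the closedness of the diagonal one-forms that are integrated below. -/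
theorem commutator_mul_commutator_diag (J Z G : Matrix (Fin N) (Fin N) (Fun N)) (γ δ i : Fin N) :
    ((Z * (Matrix.diagonal fun i => J i δ) - (Matrix.diagonal fun i => J i δ) * Z) *
      (G * (Matrix.diagonal fun i => J i γ) - (Matrix.diagonal fun i => J i γ) * G)) i i =
    ((Z * (Matrix.diagonal fun i => J i γ) - (Matrix.diagonal fun i => J i γ) * Z) *
      (G * (Matrix.diagonal fun i => J i δ) - (Matrix.diagonal fun i => J i δ) * G)) i i := by
  rw [Matrix.mul_apply, Matrix.mul_apply]
  refine Finset.sum_congr rfl fun j _ => ?_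
  simp only [commutator_apply]
  ring

theorem commutator_diag (J Z : Matrix (Fin N) (Fin N) (Fun N)) (γ i : Fin N) :
    (Z * (Matrix.diagonal fun i => J i γ) - (Matrix.diagonal fun i => J i γ) * Z) i i = 0 := by
  rw [commutator_apply, sub_self, mul_zero]

/-- Equality of mixed derivatives of a solution that is invertible. -/
theorem zero_curvature {Ψ P : Matrix (Fin N) (Fin N) (Fun N)} (hΨ : Ψ * P = 1)
    {W : Fin N → Matrix (Fin N) (Fin N) (Fun N)} (h : ∀ γ, pdMat γ Ψ = W γ * Ψ) (γ δ : Fin N) :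
    pdMat γ (W δ) + W δ * W γ = pdMat δ (W γ) + W γ * W δ := by
  have e : ∀ γ δ, pdMat γ (pdMat δ Ψ) = (pdMat γ (W δ) + W δ * W γ) * Ψ := fun γ δ => by
    rw [h δ, pdMat_mul, h γ, add_mul, mul_assoc]
  have e2 : (pdMat γ (W δ) + W δ * W γ) * Ψ = (pdMat δ (W γ) + W γ * W δ) * Ψ := by
    rw [← e, ← e, pdMat_comm]
  have e3 := congrArg (fun M => M * P) e2
  simpa only [mul_assoc, hΨ, mul_one] using e3

/-- The derivative of the diagonalisation, conjugated by `J`. The commutator has zero diagonal, so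
the derivatives of the eigenvalues are governed by those of the multiplication matrices. -/
theorem pdMat_diagonal_of_mulMat {J P : Matrix (Fin N) (Fin N) (Fun N)} (hJP : J * P = 1)
    (hPJ : P * J = 1) (hC : ∀ γ, mulMat F γ * P = P * Matrix.diagonal fun i => J i γ)
    (γ δ : Fin N) :
    pdMat δ (Matrix.diagonal fun i => J i γ) = J * pdMat δ (mulMat F γ) * P -
      (J * pdMat δ P * (Matrix.diagonal fun i => J i γ) -
        (Matrix.diagonal fun i => J i γ) * (J * pdMat δ P)) := by
  set L := Matrix.diagonal fun i => J i γ with hL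
  have hJC : J * mulMat F γ = L * J := by
    have := congrArg (fun M => J * M * J) (hC γ)
    simpa only [mul_assoc, hPJ, mul_one, ← mul_assoc J P, hJP, one_mul] using this
  have e := congrArg (fun M => J * pdMat δ M) (hC γ)
  simp only [pdMat_mul] at e
  rw [mul_add, mul_add, ← mul_assoc J P, hJP, one_mul, ← mul_assoc J (mulMat F γ), hJC] at e
  rw [← hL, mul_assoc L] at e
  rw [mul_assoc J, mul_assoc J, eq_sub_iff_add_eq]
  rw [← eq_sub_iff_add_eq] at e
  rw [e]
  abel

theorem sum_multBy_col (F : Fin N → Fun N) (P : Matrix (Fin N) (Fin N) (Fun N)) (k l α : Fin N) :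
    (multBy (mulMat F) (P.col k)).mulVec (P.col l) α =
      ∑ β, ∑ γ, structureConst F α β γ * P β k * P γ l := by
  simp only [Matrix.mulVec, dotProduct, multBy_apply, mulMat_apply, Finset.sum_mul, Matrix.col_apply]
  rw [Finset.sum_comm]
  exact Finset.sum_congr rfl fun β _ => Finset.sum_congr rfl fun γ _ => by ring

/-- The forms dual to the idempotents are closed: `∂_δ J_{kγ}` is the diagonal entry `(J (∂_δ C_γ)
P)_{kk}`, symmetric in `γ` and `δ` because the `C_γ` consist of second derivatives. Their primitives
are the coordinates. -/
theorem IsVectorPotential.exists_canonicalCoordinates (hF : IsVectorPotential A F)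
    (hss : IsSemisimpleAtOrigin F) : ∃ u, IsCanonicalCoordinates F u := by
  obtain ⟨P, hP, hm⟩ := hF.exists_idempotents hss
  set J := P⁻¹ with hJ
  have hJP : J * P = 1 := Matrix.nonsing_inv_mul _ hP
  have hPJ : P * J = 1 := Matrix.mul_nonsing_inv _ hP
  have hC : ∀ γ, mulMat F γ * P = P * Matrix.diagonal fun i => J i γ := fun γ => by
    have e : mulMat F γ = ∑ l, J l γ • multBy (mulMat F) (P.col l) := by
      have : ∀ δ, ∑ l, J l γ * P δ l = if δ = γ then 1 else 0 := fun δ => by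
        rw [← Matrix.one_apply, ← hPJ, Matrix.mul_apply]
        exact Finset.sum_congr rfl fun _ _ => mul_comm _ _
      simp_rw [multBy, Finset.smul_sum, smul_smul, Matrix.col_apply]
      rw [Finset.sum_comm]
      simp_rw [← Finset.sum_smul, this]
      simp
    ext1 α k
    rw [Matrix.mul_diagonal]
    conv_lhs => rw [e]
    rw [Finset.sum_mul, Matrix.sum_apply]
    have e2 : ∀ l, (J l γ • multBy (mulMat F) (P.col l) * P) α k =
        J l γ * if l = k then P α l else 0 := fun l => by
      rw [← hm l k α, Matrix.smul_mul, Matrix.smul_apply, smul_eq_mul]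
      rfl
    simp_rw [e2]
    simp [mul_comm]
  have hcl : ∀ k γ δ, pderiv ℂ δ (J k γ) = pderiv ℂ γ (J k δ) := fun k γ δ => by
    have e : ∀ γ δ, pderiv ℂ δ (J k γ) = (J * pdMat δ (mulMat F γ) * P) k k := fun γ δ => by
      have := congrFun (congrFun (pdMat_diagonal_of_mulMat hJP hPJ hC γ δ) k) k
      rwa [Matrix.sub_apply, commutator_diag, sub_zero, pdMat_apply, Matrix.diagonal_apply_eq] at this
    rw [e, e, pdMat_mulMat]
  choose u _ hu using fun k => exists_pderiv_eq (fun γ => J k γ) fun γ δ => hcl k δ γ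
  have hj : jacobian u = J := by
    ext1 k γ
    exact hu k γ
  have hji : (jacobian u)⁻¹ = P := by rw [hj, hJ, Matrix.nonsing_inv_nonsing_inv _ hP]
  refine ⟨u, ?_, fun k l α => ?_⟩
  · rw [hj]
    exact (Matrix.isUnit_iff_isUnit_det _).mp (IsUnit.of_mul_eq_one _ hJP)
  · rw [hji, ← hm k l α, sum_multBy_col]

theorem pdMat_dU_comm (u : Fin N → Fun N) (γ δ : Fin N) :
    pdMat δ (dU u γ) = pdMat γ (dU u δ) := by
  rw [dU, dU, dMat_eq_pdMat, dMat_eq_pdMat, pdMat_comm]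

/-- The connection in canonical coordinates. -/
theorem IsCanonicalCoordinates.exists_connection (h : IsCanonicalCoordinates F u) :
    ∃ (Γt : Matrix (Fin N) (Fin N) (Fun N)) (D : Fin N → Fin N → Fun N), (∀ i, Γt i i = 0) ∧
      (∀ α, dMat α (jacobian u) * (jacobian u)⁻¹ =
        Matrix.diagonal (D α) + (Γt * dU u α - dU u α * Γt)) ∧
      ∀ i γ δ, pderiv ℂ γ (D δ i) = pderiv ℂ δ (D γ i) := by
  set J := jacobian u with hJ
  set P := J⁻¹ with hP
  have hJP : J * P = 1 := Matrix.mul_nonsing_inv _ h.isUnit_det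
  have hPJ : P * J = 1 := Matrix.nonsing_inv_mul _ h.isUnit_det
  have hC : ∀ γ, mulMat F γ * P = P * Matrix.diagonal fun i => J i γ := fun γ => by
    rw [h.mulMat_mul_inv, dU_eq]
  have hX : ∀ δ, J * pdMat δ P = -(pdMat δ J * P) := fun δ => by
    have := congrArg (pdMat δ) hJP
    rw [pdMat_mul, pdMat_one] at this
    exact eq_neg_of_add_eq_zero_right this
  -- The commutators of `dJ J⁻¹` with `dU` are differences of `∂_δ ∂_γ U` and `J (∂_δ C_γ) P`, both
  -- symmetric, so the solvability condition holds.
  obtain ⟨Γt, h0, hΓ⟩ := exists_commutator hJP (fun δ => pdMat δ J * P) fun γ δ => by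
    have e := fun γ δ => pdMat_diagonal_of_mulMat hJP hPJ hC γ δ
    simp only [hX] at e
    have e1 : ∀ γ δ, pdMat δ J * P * (Matrix.diagonal fun i => J i γ) -
        (Matrix.diagonal fun i => J i γ) * (pdMat δ J * P) =
        pdMat δ (Matrix.diagonal fun i => J i γ) - J * pdMat δ (mulMat F γ) * P := fun γ δ => by
      rw [e γ δ, Matrix.neg_mul, Matrix.mul_neg]
      abel
    rw [e1, e1, pdMat_mulMat, ← dU_eq, ← dU_eq, pdMat_dU_comm]
  refine ⟨Γt, fun δ i => (pdMat δ J * P) i i, h0, fun α => ?_, fun i γ δ => ?_⟩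
  · rw [dU_eq]
    exact hΓ α
  · have hz := zero_curvature hJP (W := fun δ => pdMat δ J * P)
      (fun γ => by rw [mul_assoc, hPJ, mul_one]) γ δ
    have hz := congrFun (congrFun hz i) i
    have hs : ∀ γ δ, (pdMat δ J * P * (pdMat γ J * P)) i i =
        (pdMat δ J * P) i i * (pdMat γ J * P) i i +
        ((Γt * (Matrix.diagonal fun i => J i δ) - (Matrix.diagonal fun i => J i δ) * Γt) *
          (Γt * (Matrix.diagonal fun i => J i γ) - (Matrix.diagonal fun i => J i γ) * Γt)) i i :=
      fun γ δ => by
        conv_lhs => rw [hΓ γ, hΓ δ]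
        rw [add_mul, mul_add, mul_add, Matrix.add_apply, Matrix.add_apply, Matrix.add_apply,
          Matrix.diagonal_mul_diagonal, Matrix.diagonal_apply_eq, Matrix.diagonal_mul,
          Matrix.mul_diagonal, commutator_diag, commutator_diag]
        ring
    simp only [Matrix.add_apply, pdMat_apply] at hz
    rw [hs, hs, commutator_mul_commutator_diag,
      mul_comm ((pdMat δ J * P) i i)] at hz
    exact add_right_cancel hz

/-- Put `∇ = d + (·)W` with `W = [G, dU]`. If `[Y, dU] = ∇P`, then flatness of `∇` makes the second
covariant derivatives of `P` symmetric, and the Jacobi identity removes the terms with `G`. The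
derivatives are independent letters in an abstract ring. -/
theorem commutator_symm_of_curvature {M : Type*} [Ring M] {Y P Yγ Yδ Lγ Ld Lγδ Pγ Pδ Pγδ Wγ Wδ Wγδ Wδγ G : M}
    (hγ : Y * Lγ - Lγ * Y = Pγ + P * Wγ) (hδ : Y * Ld - Ld * Y = Pδ + P * Wδ)
    (hdγ : Yδ * Lγ + Y * Lγδ - (Lγδ * Y + Lγ * Yδ) = Pγδ + (Pδ * Wγ + P * Wγδ))
    (hdδ : Yγ * Ld + Y * Lγδ - (Lγδ * Y + Ld * Yγ) = Pγδ + (Pγ * Wδ + P * Wδγ))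
    (hW : Wδγ + Wδ * Wγ = Wγδ + Wγ * Wδ) (hGγ : Wγ = G * Lγ - Lγ * G)
    (hGδ : Wδ = G * Ld - Ld * G) (hL : Lγ * Ld = Ld * Lγ) :
    (Yδ + Y * Wδ) * Lγ - Lγ * (Yδ + Y * Wδ) = (Yγ + Y * Wγ) * Ld - Ld * (Yγ + Y * Wγ) := by
  have jac : Wδ * Lγ - Lγ * Wδ = Wγ * Ld - Ld * Wγ := by
    rw [hGγ, hGδ]
    have : (G * Ld - Ld * G) * Lγ - Lγ * (G * Ld - Ld * G) - ((G * Lγ - Lγ * G) * Ld -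
      Ld * (G * Lγ - Lγ * G)) = (Lγ * Ld - Ld * Lγ) * G - G * (Lγ * Ld - Ld * Lγ) := by noncomm_ring
    rw [hL, sub_self, zero_mul, mul_zero, sub_self] at this
    exact sub_eq_zero.mp this
  have e : (Yδ + Y * Wδ) * Lγ - Lγ * (Yδ + Y * Wδ) - ((Yγ + Y * Wγ) * Ld - Ld * (Yγ + Y * Wγ)) =
      (Yδ * Lγ + Y * Lγδ - (Lγδ * Y + Lγ * Yδ)) - (Yγ * Ld + Y * Lγδ - (Lγδ * Y + Ld * Yγ)) +
      Y * ((Wδ * Lγ - Lγ * Wδ) - (Wγ * Ld - Ld * Wγ)) + (Y * Lγ - Lγ * Y) * Wδ -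
      (Y * Ld - Ld * Y) * Wγ := by noncomm_ring
  rw [hdγ, hdδ, hγ, hδ, jac, sub_self, mul_zero, add_zero] at e
  have e2 : Pγδ + (Pδ * Wγ + P * Wγδ) - (Pγδ + (Pγ * Wδ + P * Wδγ)) + (Pγ + P * Wγ) * Wδ -
      (Pδ + P * Wδ) * Wγ = P * ((Wγδ + Wγ * Wδ) - (Wδγ + Wδ * Wγ)) := by noncomm_ring
  rw [e2, hW, sub_self, mul_zero] at e
  exact sub_eq_zero.mp e

/-! ### Recursive construction of the matrices `R_k` -/

section Recursion

variable {G : Matrix (Fin N) (Fin N) (Fun N)} {W : Fin N → Matrix (Fin N) (Fin N) (Fun N)}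

/-- Matrices that can occur in the recursion for the matrices `R_k`. -/
def IsRecursionMatrix (u : Fin N → Fun N) (W : Fin N → Matrix (Fin N) (Fin N) (Fun N))
    (M : Matrix (Fin N) (Fin N) (Fun N)) : Prop :=
  (∀ γ i, (pdMat γ M + M * W γ) i i = 0) ∧
    ∃ P, ∀ γ, M * dU u γ - dU u γ * M = pdMat γ P + P * W γ

theorem commutator_symm_of_recursion (hW : ∀ γ, W γ = G * dU u γ - dU u γ * G)
    (hz : ∀ γ δ, pdMat γ (W δ) + W δ * W γ = pdMat δ (W γ) + W γ * W δ)
    {Y P : Matrix (Fin N) (Fin N) (Fun N)}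
    (h : ∀ γ, Y * dU u γ - dU u γ * Y = pdMat γ P + P * W γ) (γ δ : Fin N) :
    (pdMat δ Y + Y * W δ) * dU u γ - dU u γ * (pdMat δ Y + Y * W δ) =
      (pdMat γ Y + Y * W γ) * dU u δ - dU u δ * (pdMat γ Y + Y * W γ) := by
  have h1 := congrArg (pdMat δ) (h γ)
  have h2 := congrArg (pdMat γ) (h δ)
  rw [pdMat_sub, pdMat_mul, pdMat_mul, pdMat_add, pdMat_mul] at h1 h2
  rw [pdMat_dU_comm u δ γ, pdMat_comm γ δ] at h2
  refine commutator_symm_of_curvature (h γ) (h δ) h1 h2 (hz γ δ) (hW γ) (hW δ) ?_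
  rw [dU_eq, dU_eq, diagonal_mul_comm]

/-- The equation determines the next matrix off the diagonal, as `Y`. Its diagonal `d` is still free
and is chosen to make the diagonal of the next left side vanish, as the next step requires; this
amounts to integrating the one-forms `-(Y W)_{ii}`. -/
theorem IsRecursionMatrix.exists_next (hu : IsUnit (jacobian u).det)
    (hW : ∀ γ, W γ = G * dU u γ - dU u γ * G)
    (hz : ∀ γ δ, pdMat γ (W δ) + W δ * W γ = pdMat δ (W γ) + W γ * W δ)
    {M : Matrix (Fin N) (Fin N) (Fun N)} (hM : IsRecursionMatrix u W M) :
    ∃ M', IsRecursionMatrix u W M' ∧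
      ∀ γ, pdMat γ M + M * W γ = M' * dU u γ - dU u γ * M' := by
  have hJP : jacobian u * (jacobian u)⁻¹ = 1 := Matrix.mul_nonsing_inv _ hu
  obtain ⟨hd, P, hP⟩ := hM
  obtain ⟨Y, hY0, hY⟩ := exists_commutator hJP (fun δ => pdMat δ M + M * W δ) fun γ δ => by
    rw [← dU_eq, ← dU_eq]
    exact commutator_symm_of_recursion hW hz hP γ δ
  have hY : ∀ γ, Y * dU u γ - dU u γ * Y = pdMat γ M + M * W γ := fun γ => by
    rw [hY γ, dU_eq]
    simp only [hd]
    rw [Matrix.diagonal_zero, zero_add]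
  -- Up to a diagonal matrix the covariant derivative of `Y` is again a commutator with `dU`. This
  -- makes the diagonal of its product with `W` symmetric, which is the closedness needed for `d`.
  obtain ⟨Z, -, hZ⟩ := exists_commutator hJP (fun δ => pdMat δ Y + Y * W δ) fun γ δ => by
    rw [← dU_eq, ← dU_eq]
    exact commutator_symm_of_recursion hW hz hY γ δ
  have hW0 : ∀ γ i, W γ i i = 0 := fun γ i => by rw [hW, dU_eq, commutator_diag]
  have hYd : ∀ γ i, (pdMat γ Y + Y * W γ) i i = (Y * W γ) i i := fun γ i => by
    rw [Matrix.add_apply, pdMat_apply, hY0, map_zero, zero_add]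
  have hcl : ∀ i γ δ, pderiv ℂ δ ((Y * W γ) i i) = pderiv ℂ γ ((Y * W δ) i i) := fun i γ δ => by
    have e : pdMat δ (pdMat γ Y + Y * W γ) - pdMat γ (pdMat δ Y + Y * W δ) =
        (pdMat δ Y + Y * W δ) * W γ - (pdMat γ Y + Y * W γ) * W δ := by
      have hz' : pdMat δ (W γ) = pdMat γ (W δ) + W δ * W γ - W γ * W δ := by rw [hz γ δ]; abel
      rw [pdMat_add, pdMat_add, pdMat_mul, pdMat_mul, pdMat_comm δ γ, hz']
      noncomm_ring
    have e := congrFun (congrFun e i) i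
    have hs : ∀ γ δ, ((pdMat δ Y + Y * W δ) * W γ) i i =
        ((Z * (Matrix.diagonal fun i => jacobian u i δ) -
          (Matrix.diagonal fun i => jacobian u i δ) * Z) *
        (G * (Matrix.diagonal fun i => jacobian u i γ) -
          (Matrix.diagonal fun i => jacobian u i γ) * G)) i i := fun γ δ => by
      rw [hZ δ, add_mul, Matrix.add_apply, Matrix.diagonal_mul, hW0, mul_zero, zero_add, hW γ, dU_eq]
    rw [Matrix.sub_apply, Matrix.sub_apply, pdMat_apply, pdMat_apply, hYd, hYd, hs, hs,
      commutator_mul_commutator_diag, sub_self, sub_eq_zero] at e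
    exact e
  choose d _ hdd using fun i => exists_pderiv_eq (fun γ => -((Y * W γ) i i)) fun γ δ => by
    rw [map_neg, map_neg, hcl i δ γ]
  have hcomm : ∀ γ, (Y + Matrix.diagonal d) * dU u γ - dU u γ * (Y + Matrix.diagonal d) =
      pdMat γ M + M * W γ := fun γ => by
    rw [← hY γ, add_mul, mul_add, dU_eq, diagonal_mul_comm]
    abel
  refine ⟨Y + Matrix.diagonal d, ⟨fun γ i => ?_, M, hcomm⟩, fun γ => (hcomm γ).symm⟩
  rw [pdMat_add, add_mul, Matrix.add_apply, Matrix.add_apply, Matrix.add_apply, pdMat_apply, hY0,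
    map_zero, zero_add, pdMat_apply, Matrix.diagonal_apply_eq, hdd, Matrix.diagonal_mul, hW0,
    mul_zero, add_zero, neg_add_cancel]

theorem exists_recursion (hu : IsUnit (jacobian u).det)
    (hW : ∀ γ, W γ = G * dU u γ - dU u γ * G)
    (hz : ∀ γ δ, pdMat γ (W δ) + W δ * W γ = pdMat δ (W γ) + W γ * W δ) :
    ∃ R : ℕ → Matrix (Fin N) (Fin N) (Fun N), R 0 = 1 ∧
      ∀ k γ, pdMat γ (R k) + R k * W γ = R (k + 1) * dU u γ - dU u γ * R (k + 1) := by
  have h0 : IsRecursionMatrix u W 1 := by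
    refine ⟨fun γ i => ?_, 0, fun γ => ?_⟩
    · rw [pdMat_one, zero_add, one_mul, hW, dU_eq, commutator_diag]
    · rw [one_mul, mul_one, sub_self, pdMat_zero, zero_mul, zero_add]
  choose f hf1 hf2 using fun M : {M // IsRecursionMatrix u W M} => M.2.exists_next hu hW hz
  let R : ℕ → {M // IsRecursionMatrix u W M} := fun k =>
    Nat.rec ⟨1, h0⟩ (fun _ M => ⟨f M, hf1 M⟩) k
  exact ⟨fun k => (R k).1, rfl, fun k γ => hf2 (R k) γ⟩

end Recursion

/-- Since `D̃` is closed, `H` is the exponential of a primitive of `-D̃`; the flatness needed for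
the `R_k` comes from the invertible solution `Ψ`. -/
theorem IsVectorPotential.exists_frame (hF : IsVectorPotential A F) (hss : IsSemisimpleAtOrigin F) :
    ∃ u D Γt H R, IsSemisimpleFrame F u D Γt H R := by
  obtain ⟨u, hu⟩ := hF.exists_canonicalCoordinates hss
  obtain ⟨Γt, D, h0, hconn, hcl⟩ := hu.exists_connection
  choose φ hφ0 hφ using fun i => exists_pderiv_eq (fun γ => -D γ i) fun γ δ => by
    rw [map_neg, map_neg, hcl i γ δ]
  choose H hH hdH using fun i => exists_exp (φ i) (hφ0 i)
  have hdH : ∀ α i, pderiv ℂ α (H i) = -(D α i * H i) := fun α i => by rw [hdH, hφ, neg_mul]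
  have hΨ : IsUnit (frameMatrix u H).det := by
    rw [frameMatrix, Matrix.det_mul]
    exact (isUnit_det_diagonal hH).mul hu.isUnit_det
  obtain ⟨R, hR0, hR⟩ := exists_recursion hu.isUnit_det
    (W := fun γ => rotationMatrix H Γt * dU u γ - dU u γ * rotationMatrix H Γt) (fun _ => rfl)
    (zero_curvature (Matrix.mul_nonsing_inv _ hΨ)
      fun γ => pdMat_frameMatrix hu.isUnit_det hH (hconn γ) (hdH γ))
  exact ⟨u, D, Γt, H, R, hu, h0, hconn, hH, hdH, hR0, hR⟩

end FrameExistence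

end FlatF

end

/-! ### The reconstruction theorem -/

theorem mainTheorem3 {N : ℕ} (A : Fin N → ℂ) (F : Fin N → FlatF.Fun N)
    (hF : FlatF.IsVectorPotential A F) (hss : FlatF.IsSemisimpleAtOrigin F) :
    -- the constant part is again a flat F-manifold with unit `A`, and both ancestor cones exist
    FlatF.IsVectorPotential A (FlatF.constantPart F) ∧
    (∃ Fa, FlatF.IsAncestorPotentials A F Fa) ∧
    (∃ Fc, FlatF.IsAncestorPotentials A (FlatF.constantPart F) Fc) ∧
    -- canonical coordinates, the metric and the matrices `R_k` exist
    (∃ u D Γt H R, FlatF.IsSemisimpleFrame F u D Γt H R) ∧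
    ∀ Fa Fc : ℕ → Fin N → FlatF.BigFun N,
      FlatF.IsAncestorPotentials A F Fa →
      FlatF.IsAncestorPotentials A (FlatF.constantPart F) Fc →
      (∃ R ∈ FlatF.upperTriangularGroup N,
        FlatF.IsImageCone (R : FlatF.EndSeries N) (FlatF.cone A Fc) (FlatF.cone A Fa)) ∧
      ∀ u D Γt H R, FlatF.IsSemisimpleFrame F u D Γt H R →
        (∃ g ∈ FlatF.upperTriangularGroup N,
          (g : FlatF.EndSeries N) = FlatF.reconstructionSeries u H R) ∧
        FlatF.IsImageCone (FlatF.reconstructionSeries u H R)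
          (FlatF.cone A Fc) (FlatF.cone A Fa) := by
  obtain ⟨u, D, Γt, H, R, hframe⟩ := hF.exists_frame hss
  refine ⟨hF.constantPart, hF.exists_ancestorPotentials, hF.constantPart.exists_ancestorPotentials,
    ⟨u, D, Γt, H, R, hframe⟩, fun Fa Fc hFa hFc => ⟨?_, fun u D Γt H R h =>
      ⟨h.exists_upperTriangular, h.isImageCone hF hFa hFc⟩⟩⟩
  obtain ⟨g, hg, e⟩ := hframe.exists_upperTriangular
  exact ⟨g, hg, e ▸ hframe.isImageCone hF hFa hFc⟩
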